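/- Let $a\in\mathbb{Q}$. A pair $(x_0,x_1)\in\mathbb{Q}\times\mathbb{Q}$ of initial conditions generates a sequence of period $9$ of the Lyness recurrence $$x_{n+2}=\frac{a+x_{n+1}}{x_n},\qquad n\ge 0,$$ if the infinite sequence $(x_n)_{n\ge0}$ is well defined (i.e. $x_n\neq 0$ for all $n\ge 0$) and $9$ is its prime period, i.e. the least integer $d\ge1$ such that $x_{n+d}=x_n$ for all $n\ge0$. (i) For $a\in\{6,8\}$ there are no initial conditions $(x_0,x_1)\in\mathbb{Q}\times\mathbb{Q}$ that generate a sequence of period $9$. (ii) For $a=9$ there are no initial conditions $(x_0,x_1)\in\mathbb{Q}^+\times\mathbb{Q}^+$ that generate a sequence of period $9$, but there are infinitely many such initial conditions in $\mathbb{Q}\times\mathbb{Q}$. Here $\mathbb{Q}^+$ is the set of positive rational numbers. -/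

import Mathlib

/-- `x` is a sequence of rational numbers generated by the Lyness recurrence
`x_{n+2} = (a + x_{n+1}) / x_n`. The recurrence divides by every term of the sequence, so the
infinite sequence exists only if no term vanishes. -/
def IsLynessSequence (a : ℚ) (x : ℕ → ℚ) : Prop :=
  ∀ n : ℕ, x n ≠ 0 ∧ x (n + 2) = (a + x (n + 1)) / x n

/-- `p` is the period (that is, the prime or least positive period) of the sequence `x`. -/
def HasPeriod (x : ℕ → ℚ) (p : ℕ) : Prop :=
  IsLeast {d : ℕ | 0 < d ∧ Function.Periodic x d} p

/-- The initial conditions `x₀ = c.1`, `x₁ = c.2` such that the Lyness recurrence with parameter `a`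
generates a well-defined sequence of period `p`. -/
def lynessPeriodic (a : ℚ) (p : ℕ) : Set (ℚ × ℚ) :=
  {c | ∃ x : ℕ → ℚ, IsLynessSequence a x ∧ x 0 = c.1 ∧ x 1 = c.2 ∧ HasPeriod x p}

/-! The function (x+1)(y+1)(x+y+a)/(xy) of consecutive terms is a first integral of the recurrence.
A nine-cycle whose period is not a divisor of 3 lies on one level of it, a cubic on which the
recurrence is translation by a point of order 9 (`IsLynessSequence.curve`). All claims are thus
about rational points of this cubic for a = 6, 8, 9.

For a = 9, the coordinates σ = x + y and x - y turn the cubic into a quartic model, and a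
Weierstrass model of it has a rational point whose abscissa is not 2-adically integral. Each
doubling multiplies the 2-adic size of that abscissa by 4, so there are infinitely many points
(`lynessPeriodic_nine_infinite`). Positive points are excluded by quadratic reciprocity modulo 503:
if σ = m/k > 0 in lowest terms and 503 - 9σ > 0, then m and 503k - 9m would both be squares modulo
503 away from 503, whereas 503k - 9m ≡ -9m and -1 is not a square (`no_pos_coprime_solution`).

For a = 6, 8 the proof is a 3-descent. The three sums of terms with index in one class modulo 3 are
functions on the quotient by the subgroup of order 3; shifted by a constant they satisfy a Hesse
cubic s(p³+q³+r³) = n pqr with pqr ≠ 0. Put n/s = 3c/m, so m = 90, c = 109 or m = 56, c = 107. With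
X = mp, Y = mq, Z = cr, the identity for X³+Y³+Z³-3XYZ makes a linear form times a norm from ℤ[ω]
equal to (c³-m³)r³, and c³-m³ = C E³ with E = 31 or 19. Conditions at 2 and 3 force the Eisenstein
factor, after division by ω² or 1 - ω, to be a perfect cube (`factorization_six`,
`factorization_eight`). The traces of its cube root yield three integers with sum nγ and product
(sγ)³, a point of the 3-isogenous curve. Cubic residues modulo 19 and 31 show that these integers,
without their common factor, are cubes (`exists_cubes_six`, `exists_cubes_eight`); their cube roots
are a point of the original Hesse cubic. This inverts multiplication by 3, and |pqr| drops strictly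
(`descent_six`, `descent_eight`), so no point with pqr ≠ 0 exists. -/

/-! ### The first integral and the cubic of nine-cycles -/

theorem lyness_curve_invariant {a x y z : ℚ} (h : z * x = a + y) :
    (a * (y + 1) * (z + 1) * (y + z + a) - (a - 1) * (a ^ 2 - a + 1) * (y * z)) * x =
    (a * (x + 1) * (y + 1) * (x + y + a) - (a - 1) * (a ^ 2 - a + 1) * (x * y)) * z := by
  linear_combination (a * (y + 1)) * (z + y + 1 + a - x - y - 1 - a + 0) * h

/-- On a cycle of length nine, either the third iterate fixes the term or the pair of initial
conditions lies on a cubic curve. -/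
theorem lyness_nine_cycle_factor {a x0 x1 x2 x3 x4 x5 x6 x7 x8 : ℚ}
    (n0 : x0 ≠ 0) (n1 : x1 ≠ 0) (n2 : x2 ≠ 0) (n8 : x8 ≠ 0)
    (h0 : x2 * x0 = a + x1) (h1 : x3 * x1 = a + x2) (h2 : x4 * x2 = a + x3)
    (h3 : x5 * x3 = a + x4) (h4 : x6 * x4 = a + x5)
    (h6 : x8 * x6 = a + x7) (h7 : x0 * x7 = a + x8) (h8 : x1 * x8 = a + x0) :
    x3 = x0 ∨ a * (x0 + 1) * (x1 + 1) * (x0 + x1 + a) =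
      (a - 1) * (a ^ 2 - a + 1) * (x0 * x1) := by
  have e2 : x2 = (a + x1) / x0 := by field_simp; linarith
  have e8 : x8 = (a + x0) / x1 := by field_simp; linarith
  have m2 : a + x1 ≠ 0 := by rw [← h0]; positivity
  have m8 : a + x0 ≠ 0 := by rw [← h8]; positivity
  have e3 : x3 = (a * x0 + a + x1) / (x0 * x1) := by
    rw [eq_div_iff (by positivity)]; rw [e2] at h1; field_simp at h1; linarith
  have e7 : x7 = (a * x1 + a + x0) / (x0 * x1) := by
    rw [eq_div_iff (by positivity)]; rw [e8] at h7; field_simp at h7; linarith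
  have e4 : x4 = (a * x0 * x1 + a * x0 + a + x1) / (x1 * (a + x1)) := by
    rw [eq_div_iff (by positivity)]; rw [e2, e3] at h2; field_simp at h2; linarith
  have e6 : x6 = (a * x0 * x1 + a * x1 + a + x0) / (x0 * (a + x0)) := by
    rw [eq_div_iff (by positivity)]; rw [e8, e7] at h6; field_simp at h6; linarith
  -- The cycle is computed forward up to x4 and backward down to x6; eliminating x5 closes it.
  have key : x4 * x6 * x3 = a * x3 + a + x4 := by linear_combination x3 * h4 + h3
  rw [e4, e6, e3] at key
  field_simp at key
  have : (a * x0 + a + x1 - x0 ^ 2 * x1) * (a * (x0 + 1) * (x1 + 1) * (x0 + x1 + a) -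
      (a - 1) * (a ^ 2 - a + 1) * (x0 * x1)) = 0 := by
    linear_combination key
  rcases mul_eq_zero.1 this with h | h
  · left; rw [e3]; field_simp; linarith
  · right; linarith

theorem IsLynessSequence.mul_eq {a : ℚ} {x : ℕ → ℚ} (h : IsLynessSequence a x) (n : ℕ) :
    x (n + 2) * x n = a + x (n + 1) := by
  rw [(h n).2, div_mul_cancel₀ _ (h n).1]

theorem HasPeriod.not_periodic {x : ℕ → ℚ} {p d : ℕ} (h : HasPeriod x p) (hd : 0 < d)
    (hdp : d < p) : ¬ Function.Periodic x d := fun hx => by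
  have := h.2 ⟨hd, hx⟩
  omega

/-- Off the cubic at one index means off it at every index, by the first integral. The other
alternative of `lyness_nine_cycle_factor` then holds everywhere and gives the period 3, against
minimality of 9. -/
theorem IsLynessSequence.curve {a : ℚ} {x : ℕ → ℚ} (h : IsLynessSequence a x)
    (hp : HasPeriod x 9) :
    a * (x 0 + 1) * (x 1 + 1) * (x 0 + x 1 + a) = (a - 1) * (a ^ 2 - a + 1) * (x 0 * x 1) := by
  by_contra hC
  refine hp.not_periodic (d := 3) (by norm_num) (by norm_num) fun n => ?_
  have hper := hp.1.2
  have hn : ∀ n, a * (x n + 1) * (x (n + 1) + 1) * (x n + x (n + 1) + a) ≠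
      (a - 1) * (a ^ 2 - a + 1) * (x n * x (n + 1)) := by
    intro n
    induction n with
    | zero => exact hC
    | succ n ih =>
      intro h'
      have := lyness_curve_invariant (h.mul_eq n)
      have h2 : x (n + 2) ≠ 0 := (h _).1
      rw [show n + 1 + 1 = n + 2 from rfl] at h'
      rw [sub_eq_zero.2 h', zero_mul, eq_comm, mul_eq_zero, or_iff_left h2, sub_eq_zero] at this
      exact ih this
  refine (lyness_nine_cycle_factor (h n).1 (h (n + 1)).1 (h (n + 2)).1 (h (n + 8)).1 (h.mul_eq n)
    (h.mul_eq (n + 1)) (h.mul_eq (n + 2)) (h.mul_eq (n + 3)) (h.mul_eq (n + 4))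
    (h.mul_eq (n + 6)) ?_ ?_).resolve_right (hn n)
  · have := h.mul_eq (n + 7)
    rwa [show n + 7 + 2 = n + 9 by rfl, hper n] at this
  · have := h.mul_eq (n + 8)
    rwa [show n + 8 + 2 = n + 1 + 9 by ring, hper (n + 1), show n + 8 + 1 = n + 9 by rfl,
      hper n] at this

/-! ### Infinitely many cycles for a = 9: doubling and 2-adic size -/

/-- Duplication on the elliptic curve `v² = u³ + A u² + P u + R`. -/
def duplicate (A P : ℚ) (c : ℚ × ℚ) : ℚ × ℚ :=
  let t := (3 * c.1 ^ 2 + 2 * A * c.1 + P) / (2 * c.2)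
  (t ^ 2 - A - 2 * c.1, -(c.2 + t * (t ^ 2 - A - 2 * c.1 - c.1)))

theorem duplicate_mem {A P R : ℚ} {c : ℚ × ℚ} (h : c.2 ^ 2 = c.1 ^ 3 + A * c.1 ^ 2 + P * c.1 + R)
    (h0 : c.2 ≠ 0) : (duplicate A P c).2 ^ 2 =
      (duplicate A P c).1 ^ 3 + A * (duplicate A P c).1 ^ 2 + P * (duplicate A P c).1 + R := by
  obtain ⟨u, v⟩ := c
  obtain ⟨t, ht⟩ : ∃ t, t = (3 * u ^ 2 + 2 * A * u + P) / (2 * v) := ⟨_, rfl⟩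
  simp only [duplicate, ← ht] at h h0 ⊢
  have ht' : 2 * v * t = 3 * u ^ 2 + 2 * A * u + P := by rw [ht]; field_simp
  linear_combination h + (t ^ 2 - A - 3 * u) * ht'

/-- The division-free duplication formula: for a large 2-adic abscissa u the right side has the size
of u⁴, while v² has the size of u³. The factor 4 on the left is what makes the size grow. -/
theorem duplicate_fst {A P R : ℚ} {c : ℚ × ℚ} (h : c.2 ^ 2 = c.1 ^ 3 + A * c.1 ^ 2 + P * c.1 + R)
    (h0 : c.2 ≠ 0) : (duplicate A P c).1 * (4 * c.2 ^ 2) =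
      c.1 ^ 4 + (((-2 * P) * c.1 ^ 2 + (-8 * R) * c.1) + (P ^ 2 - 4 * A * R)) := by
  obtain ⟨u, v⟩ := c
  obtain ⟨t, ht⟩ : ∃ t, t = (3 * u ^ 2 + 2 * A * u + P) / (2 * v) := ⟨_, rfl⟩
  simp only [duplicate, ← ht] at h h0 ⊢
  have ht' : 2 * v * t = 3 * u ^ 2 + 2 * A * u + P := by rw [ht]; field_simp
  linear_combination (-4 * A - 8 * u) * h + (2 * v * t + 3 * u ^ 2 + 2 * A * u + P) * ht'

theorem padicNorm_add_of_lt {a b : ℚ} (h : padicNorm 2 b < padicNorm 2 a) :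
    padicNorm 2 (a + b) = padicNorm 2 a := by
  rw [padicNorm.add_eq_max_of_ne h.ne', max_eq_left h.le]

theorem padicNorm_add_lt {a b c : ℚ} (ha : padicNorm 2 a < c) (hb : padicNorm 2 b < c) :
    padicNorm 2 (a + b) < c :=
  padicNorm.nonarchimedean.trans_lt (max_lt ha hb)

theorem padicNorm_mul_pow_lt {a u : ℚ} {i j : ℕ} (ha : padicNorm 2 a ≤ 1)
    (hu : 1 < padicNorm 2 u) (hij : i < j) : padicNorm 2 (a * u ^ i) < padicNorm 2 u ^ j := by
  rw [padicNorm.mul, IsAbsoluteValue.abv_pow (padicNorm 2)]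
  calc _ ≤ 1 * padicNorm 2 u ^ i := by gcongr
    _ < _ := by rw [one_mul]; exact pow_lt_pow_right₀ hu hij

/-- Duplication multiplies the `2`-adic absolute value of a nonintegral abscissa by `4`. -/
theorem duplicate_padicNorm {A P R : ℤ} {c : ℚ × ℚ}
    (h : c.2 ^ 2 = c.1 ^ 3 + A * c.1 ^ 2 + P * c.1 + R) (hu : 1 < padicNorm 2 c.1) :
    c.2 ≠ 0 ∧ padicNorm 2 (duplicate A P c).1 = 4 * padicNorm 2 c.1 := by
  have hint : ∀ z : ℤ, padicNorm 2 z ≤ 1 := padicNorm.of_int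
  have hpow : ∀ (u : ℚ) (k : ℕ), padicNorm 2 (u ^ k) = padicNorm 2 u ^ k :=
    IsAbsoluteValue.abv_pow (padicNorm 2)
  have hv : padicNorm 2 c.2 ^ 2 = padicNorm 2 c.1 ^ 3 := by
    rw [← hpow, h, add_assoc, add_assoc, padicNorm_add_of_lt, hpow]
    rw [hpow]
    refine padicNorm_add_lt (padicNorm_mul_pow_lt (hint _) hu (by norm_num)) (padicNorm_add_lt ?_ ?_)
    · simpa using padicNorm_mul_pow_lt (i := 1) (j := 3) (hint P) hu (by norm_num)
    · simpa using padicNorm_mul_pow_lt (i := 0) (j := 3) (hint R) hu (by norm_num)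
  have h0 : c.2 ≠ 0 := by
    intro h0
    rw [h0, padicNorm.zero] at hv
    have : 0 < padicNorm 2 c.1 ^ 3 := by positivity
    norm_num at hv
    exact this.ne hv
  refine ⟨h0, ?_⟩
  have h1 := congrArg (padicNorm 2) (duplicate_fst h h0)
  rw [padicNorm.mul, padicNorm.mul, hpow, hv, padicNorm_add_of_lt, hpow] at h1
  · have h4 : padicNorm 2 4 = 1 / 4 := by
      rw [show (4 : ℚ) = ((2 : ℕ) : ℚ) ^ 2 by norm_num, hpow, padicNorm.padicNorm_p_of_prime]
      norm_num
    rw [h4] at h1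
    have : padicNorm 2 c.1 ^ 3 ≠ 0 := by positivity
    apply mul_right_cancel₀ this
    linear_combination 4 * h1
  · rw [hpow]
    refine padicNorm_add_lt (padicNorm_add_lt ?_ ?_) ?_
    · simpa using padicNorm_mul_pow_lt (i := 2) (j := 4) (hint (-2 * P)) hu (by norm_num)
    · simpa using padicNorm_mul_pow_lt (i := 1) (j := 4) (hint (-8 * R)) hu (by norm_num)
    · have := padicNorm_mul_pow_lt (i := 0) (j := 4) (hint (P ^ 2 - 4 * A * R)) hu (by norm_num)
      rw [pow_zero, mul_one] at this
      exact_mod_cast this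

/-- The points `2 ^ k • P` for a point `P` in the kernel of reduction modulo `2`. -/
def dyadicPoint (k : ℕ) : ℚ × ℚ :=
  (duplicate (292465 : ℤ) (11216388096 : ℤ))^[k]
    -- The denominator is 17² · 2¹², so the 2-adic norm of the abscissa starts at 4⁶.
    (434354579289 / 1183744, 392787598900794147 / 1287913472)

theorem dyadicPoint_spec (k : ℕ) : (dyadicPoint k).2 ^ 2 = (dyadicPoint k).1 ^ 3 +
    (292465 : ℤ) * (dyadicPoint k).1 ^ 2 + (11216388096 : ℤ) * (dyadicPoint k).1 +
      (115869896146944 : ℤ) ∧ padicNorm 2 (dyadicPoint k).1 = 4 ^ (k + 6) := by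
  induction k with
  | zero =>
    constructor
    · norm_num [dyadicPoint]
    · have h1 : padicNorm 2 434354579289 = 1 := by
        have := (padicNorm.nat_eq_one_iff (p := 2) 434354579289).2 (by norm_num)
        exact_mod_cast this
      have h2 : padicNorm 2 289 = 1 := by
        have := (padicNorm.nat_eq_one_iff (p := 2) 289).2 (by norm_num)
        exact_mod_cast this
      have h3 : padicNorm 2 2 = 1 / 2 := by
        have := padicNorm.padicNorm_p_of_prime (p := 2)
        norm_num at this ⊢
        exact this
      simp only [dyadicPoint, Function.iterate_zero, id]
      rw [padicNorm.div, show (1183744 : ℚ) = 289 * 2 ^ 12 by norm_num, padicNorm.mul,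
        IsAbsoluteValue.abv_pow (padicNorm 2), h1, h2, h3]
      norm_num
  | succ k ih =>
    have hd := duplicate_padicNorm ih.1 (by rw [ih.2]; exact one_lt_pow₀ (by norm_num) (by omega))
    have hs : dyadicPoint (k + 1) = duplicate (292465 : ℤ) (11216388096 : ℤ) (dyadicPoint k) :=
      Function.iterate_succ_apply' _ _ _
    rw [hs]
    refine ⟨duplicate_mem ih.1 hd.1, ?_⟩
    rw [hd.2, ih.2]
    ring

/-- A point of the cubic curve whose orbit avoids zero gives a Lyness cycle of length nine. -/
theorem mem_lynessPeriodic_nine {x y : ℚ} (hx : x ≠ 0) (hy : y ≠ 0) (hx9 : 9 + x ≠ 0)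
    (hy9 : 9 + y ≠ 0)
    (hC : 9 * (x + 1) * (y + 1) * (x + y + 9) = 584 * (x * y)) : (x, y) ∈ lynessPeriodic 9 9 := by
  have h36 : (9 * x + 9 + y) * (9 * x * y + 9 * y + 9 + x) = 72 * y * x * (9 + x) := by
    linear_combination hC
  have h74 : (9 * y + 9 + x) * (9 * x * y + 9 * x + 9 + y) = 72 * x * y * (9 + y) := by
    linear_combination hC
  obtain ⟨n3, n6⟩ := mul_ne_zero_iff.1 (h36 ▸ (by positivity : 72 * y * x * (9 + x) ≠ 0))
  obtain ⟨n7, n4⟩ := mul_ne_zero_iff.1 (h74 ▸ (by positivity : 72 * x * y * (9 + y) ≠ 0))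
  -- Indexing by `ZMod 9` builds in the period. The entry at 5 has been simplified by means of the
  -- cubic; 72 is a(a - 1).
  let w : ZMod 9 → ℚ := ![x, y, (9 + y) / x, (9 * x + 9 + y) / (x * y),
    (9 * x * y + 9 * x + 9 + y) / (y * (9 + y)), 72 * x * y / ((9 + x) * (9 + y)),
    (9 * x * y + 9 * y + 9 + x) / (x * (9 + x)), (9 * y + 9 + x) / (x * y), (9 + x) / y]
  have hw0 : ∀ i, w i ≠ 0 := by
    intro i
    fin_cases i
    · exact hx
    · exact hy
    · exact div_ne_zero hy9 hx
    · exact div_ne_zero n3 (by positivity)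
    · exact div_ne_zero n4 (by positivity)
    · exact div_ne_zero (by positivity) (by positivity)
    · exact div_ne_zero n6 (by positivity)
    · exact div_ne_zero n7 (by positivity)
    · exact div_ne_zero hx9 hy
  have hw : ∀ i, w (i + 2) * w i = 9 + w (i + 1) := by
    intro i
    fin_cases i
    · change (9 + y) / x * x = 9 + y
      field_simp
    · change (9 * x + 9 + y) / (x * y) * y = 9 + (9 + y) / x
      field_simp
      ring
    · change (9 * x * y + 9 * x + 9 + y) / (y * (9 + y)) * ((9 + y) / x) =
        9 + (9 * x + 9 + y) / (x * y)
      field_simp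
      ring
    · change 72 * x * y / ((9 + x) * (9 + y)) * ((9 * x + 9 + y) / (x * y)) =
        9 + (9 * x * y + 9 * x + 9 + y) / (y * (9 + y))
      field_simp
      linear_combination -hC
    · change (9 * x * y + 9 * y + 9 + x) / (x * (9 + x)) *
        ((9 * x * y + 9 * x + 9 + y) / (y * (9 + y))) = 9 + 72 * x * y / ((9 + x) * (9 + y))
      field_simp
      linear_combination hC
    · change (9 * y + 9 + x) / (x * y) * (72 * x * y / ((9 + x) * (9 + y))) =
        9 + (9 * x * y + 9 * y + 9 + x) / (x * (9 + x))
      field_simp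
      linear_combination -hC
    · change (9 + x) / y * ((9 * x * y + 9 * y + 9 + x) / (x * (9 + x))) =
        9 + (9 * y + 9 + x) / (x * y)
      field_simp
      ring
    · change x * ((9 * y + 9 + x) / (x * y)) = 9 + (9 + x) / y
      field_simp
      ring
    · change y * ((9 + x) / y) = 9 + x
      field_simp
  refine ⟨fun n => w n, fun n => ⟨hw0 _, ?_⟩, rfl, rfl, ⟨by norm_num, fun n => ?_⟩, ?_⟩
  · rw [eq_div_iff (hw0 _)]
    push_cast
    exact hw n
  · have : ((n + 9 : ℕ) : ZMod 9) = n := by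
      rw [Nat.cast_add, ZMod.natCast_self, add_zero]
    simp only [this]
  · rintro d ⟨hd, hper⟩
    by_contra! hd9
    -- Every d from 1 to 8 has a multiple congruent to 3 modulo 9, so a shorter period would make
    -- the terms 0, 3, 6 equal.
    have hk : ∃ k : ℕ, ((k * d : ℕ) : ZMod 9) = 3 := by
      interval_cases d
      exacts [⟨3, by decide⟩, ⟨6, by decide⟩, ⟨1, by decide⟩, ⟨3, by decide⟩, ⟨6, by decide⟩,
        ⟨2, by decide⟩, ⟨3, by decide⟩, ⟨6, by decide⟩]
    obtain ⟨k, hk⟩ := hk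
    have h3 : w 3 = w 0 := by
      have := hper.nat_mul k 0
      simp only [zero_add, Nat.cast_id] at this
      rw [hk] at this
      simpa using this
    have h6 : w 6 = w 0 := by
      have := hper.nat_mul (2 * k) 0
      simp only [zero_add, Nat.cast_id, mul_assoc] at this
      rw [Nat.cast_mul, hk] at this
      rw [show (6 : ZMod 9) = ((2 : ℕ) : ZMod 9) * 3 by decide, this, Nat.cast_zero]
    -- On the cubic this product is constant. Three equal terms would make 72 a rational cube, but
    -- its 3-adic valuation is 2.
    have hprod : w 0 * w 3 * w 6 = 72 := by
      change x * ((9 * x + 9 + y) / (x * y)) * ((9 * x * y + 9 * y + 9 + x) / (x * (9 + x))) = 72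
      field_simp
      linear_combination hC
    rw [h3, h6] at hprod
    have h72 : (w 0) ^ 3 = ((72 : ℕ) : ℚ) := by push_cast; linarith
    have hv := congrArg (padicValRat 3) h72
    rw [padicValRat.pow, padicValRat.of_nat, show 72 = 8 * 3 ^ 2 by norm_num,
      padicValNat.mul (by norm_num) (by norm_num), padicValNat.prime_pow,
      padicValNat.eq_zero_of_not_dvd (by norm_num)] at hv
    push_cast at hv
    omega

/-- In terms of σ = x + y the cubic reads xy(503 - 9σ) = 9(σ+1)(σ+9). The substitution is 9σ - 503 =
10764288/u and x - y = v/(9u), where 10764288 = 36 · 512 · 584. Growth of the 2-adic norm makes the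
abscissas distinct. -/
theorem lynessPeriodic_nine_infinite : (lynessPeriodic 9 9).Infinite := by
  let f : ℕ → ℚ × ℚ := fun k =>
    ((503 * (dyadicPoint k).1 + 10764288 + (dyadicPoint k).2) / (18 * (dyadicPoint k).1),
     (503 * (dyadicPoint k).1 + 10764288 - (dyadicPoint k).2) / (18 * (dyadicPoint k).1))
  have hne : ∀ k (z : ℤ), (dyadicPoint k).1 ≠ z := by
    intro k z h
    have h1 := (dyadicPoint_spec k).2
    rw [h] at h1
    have := padicNorm.of_int (p := 2) z
    rw [h1] at this
    exact absurd this (not_le.2 (one_lt_pow₀ (by norm_num) (by omega)))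
  have hsum : ∀ k, ((f k).1 + (f k).2) * (9 * (dyadicPoint k).1) =
      503 * (dyadicPoint k).1 + 10764288 := by
    intro k
    have h0 : (dyadicPoint k).1 ≠ 0 := by simpa using hne k 0
    simp only [f]
    field_simp
    ring
  have hC : ∀ k, 9 * ((f k).1 + 1) * ((f k).2 + 1) * ((f k).1 + (f k).2 + 9) =
      584 * ((f k).1 * (f k).2) := by
    intro k
    have h0 : (dyadicPoint k).1 ≠ 0 := by simpa using hne k 0
    have h1 := (dyadicPoint_spec k).1
    push_cast at h1
    simp only [f]
    field_simp
    linear_combination (-193757184) * h1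
  -- The values of σ at which x or y is 0 or -9. They correspond to integral u, which the 2-adic
  -- norm forbids.
  have hval : ∀ k, (f k).1 + (f k).2 ≠ -1 ∧ (f k).1 + (f k).2 ≠ -9 ∧ (f k).1 + (f k).2 ≠ 63 := by
    intro k
    refine ⟨fun h => ?_, fun h => ?_, fun h => ?_⟩
    · have := hsum k
      rw [h] at this
      exact hne k (-21024) (by push_cast; linarith)
    · have := hsum k
      rw [h] at this
      exact hne k (-18432) (by push_cast; linarith)
    · have := hsum k
      rw [h] at this
      exact hne k 168192 (by push_cast; linarith)
  have hside : ∀ x y : ℚ, 9 * (x + 1) * (y + 1) * (x + y + 9) = 584 * (x * y) → x + y ≠ -1 →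
      x + y ≠ -9 → x + y ≠ 63 → x ≠ 0 ∧ 9 + x ≠ 0 := by
    intro x y h h1 h2 h3
    have hx : ∀ y : ℚ, 9 * ((0 : ℚ) + 1) * (y + 1) * (0 + y + 9) = 584 * (0 * y) → 0 + y ≠ -1 →
        0 + y ≠ -9 → False := by
      intro y h h1 h2
      have : (y + 1) * (y + 9) = 0 := by linear_combination h / 9
      rcases mul_eq_zero.1 this with h | h
      · exact h1 (by linarith)
      · exact h2 (by linarith)
    refine ⟨?_, fun h0 => ?_⟩
    · rintro rfl
      exact hx y h h1 h2
    · obtain rfl : x = -9 := by linarith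
      have : y * (y - 72) = 0 := by linear_combination -h / 72
      rcases mul_eq_zero.1 this with rfl | h
      · norm_num at h2
      · exact h3 (by linarith)
  refine Set.infinite_of_injective_forall_mem (f := f) (fun k l hkl => ?_) fun k => ?_
  · have h1 := hsum k
    rw [hkl] at h1
    have h2 := hsum l
    have : (dyadicPoint k).1 = (dyadicPoint l).1 := by
      have h3 : ((f l).1 + (f l).2) * 9 - 503 ≠ 0 := by
        intro h3
        have : (10764288 : ℚ) = (dyadicPoint l).1 * (((f l).1 + (f l).2) * 9 - 503) := by
          linarith
        rw [h3] at this
        norm_num at this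
      apply mul_right_cancel₀ h3
      linarith
    have h4 := (dyadicPoint_spec k).2
    rw [this, (dyadicPoint_spec l).2] at h4
    have := pow_right_injective₀ (a := (4 : ℚ)) (by norm_num) (by norm_num) h4
    omega
  · obtain ⟨v1, v2, v3⟩ := hval k
    obtain ⟨hx, hx9⟩ := hside _ _ (hC k) v1 v2 v3
    obtain ⟨hy, hy9⟩ := hside (f k).2 (f k).1 (by linear_combination hC k) (by rwa [add_comm])
      (by rwa [add_comm]) (by rwa [add_comm])
    exact mem_lynessPeriodic_nine hx hy hx9 hy9 (hC k)

/-! ### No positive cycles for a = 9: quadratic residues modulo 503 -/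

instance fact_prime_503 : Fact (Nat.Prime 503) := ⟨by norm_num⟩

theorem legendreSym_eq_one_of_forall_prime {p : ℕ} [Fact p.Prime] {m : ℕ}
    (h : ∀ l : ℕ, l.Prime → l ∣ m → legendreSym p l = 1) (hm : m ≠ 0) : legendreSym p m = 1 := by
  induction m using induction_on_primes with
  | zero => exact absurd rfl hm
  | one => simp
  | prime_mul l n hl ih =>
    push_cast
    rw [legendreSym.mul, h l hl (dvd_mul_right _ _), one_mul]
    exact ih (fun q hq hqn => h q hq (hqn.mul_left l)) (by rintro rfl; simp at hm)

/-- If `-503` is a square modulo a prime `l`, then `l` is a square modulo `503`. -/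
theorem legendreSym_503_eq_one {l : ℕ} (hl : l.Prime) (h2 : l ≠ 2) (h503 : l ≠ 503) {u v : ℤ}
    (hv : ¬ (l : ℤ) ∣ v) (h : (l : ℤ) ∣ u ^ 2 + 503 * v ^ 2) : legendreSym 503 l = 1 := by
  have : Fact l.Prime := ⟨hl⟩
  have hneg : legendreSym l (-503) = 1 := by
    have hv0 : (v : ZMod l) ≠ 0 := by rwa [Ne, ZMod.intCast_zmod_eq_zero_iff_dvd]
    have h0 : ((-503 : ℤ) : ZMod l) ≠ 0 := by
      rw [Ne, ZMod.intCast_zmod_eq_zero_iff_dvd, dvd_neg]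
      intro h
      have : l ∣ 503 := by exact_mod_cast h
      exact h503 ((Nat.prime_dvd_prime_iff_eq hl (by norm_num)).1 this)
    rw [legendreSym.eq_one_iff l h0]
    refine ⟨u / v, ?_⟩
    rw [← ZMod.intCast_zmod_eq_zero_iff_dvd] at h
    push_cast at h ⊢
    field_simp
    linear_combination -h
  rw [show (-503 : ℤ) = -1 * (503 : ℕ) by norm_num, legendreSym.mul,
    legendreSym.at_neg_one h2] at hneg
  rw [legendreSym.quadratic_reciprocity' h2 (by norm_num), pow_mul,
    ← ZMod.χ₄_eq_neg_one_pow ((hl.eq_two_or_odd).resolve_left h2)]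
  have : ZMod.χ₄ (l : ZMod 4) ^ (503 / 2) = ZMod.χ₄ (l : ZMod 4) := by
    rcases ZMod.isQuadratic_χ₄ (l : ZMod 4) with h | h | h <;> rw [h] <;> norm_num
  rw [this]
  exact hneg

/-- The arithmetic obstruction: the quadratic character modulo `503` of the denominator and of the
numerator are incompatible. -/
theorem no_pos_coprime_solution {m k Y : ℤ} (hm : 0 < m) (hk : IsCoprime m k)
    (hB : 0 < 503 * k - 9 * m)
    (hY : Y ^ 2 = (503 * k - 9 * m) *
      (m ^ 2 * (503 * k - 9 * m) - 36 * k * (m + k) * (m + 9 * k))) : False := by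
  have hprime : ∀ l : ℕ, l.Prime → l ≠ 503 → (l : ℤ) ∣ m → legendreSym 503 l = 1 := by
    intro l hl h503 hlm
    by_cases h2 : l = 2
    · subst h2; norm_num
    by_cases h3 : l = 3
    · subst h3; norm_num
    have hlp := Nat.prime_iff_prime_int.1 hl
    -- Modulo a prime dividing m the right side of `hY` reduces to -503 (18k²)².
    refine legendreSym_503_eq_one hl h2 h503 (u := Y) (v := 18 * k ^ 2) (fun h => ?_) ?_
    · rcases hlp.dvd_or_dvd h with h | h
      · have : l ∣ 18 := by exact_mod_cast h
        have := (Nat.Prime.dvd_mul hl).1 (show l ∣ 2 * 9 from this)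
        rcases this with h | h
        · exact h2 ((Nat.prime_dvd_prime_iff_eq hl Nat.prime_two).1 h)
        · exact h3 ((Nat.prime_dvd_prime_iff_eq hl Nat.prime_three).1
            (hl.dvd_of_dvd_pow (show l ∣ 3 ^ 2 from h)))
      · exact hlp.not_isUnit (hk.isUnit_of_dvd' hlm (hlp.dvd_of_dvd_pow h))
    · rw [hY]
      obtain ⟨t, rfl⟩ := hlm
      exact ⟨81 * l ^ 3 * t ^ 4 - 8730 * k * l ^ 2 * t ^ 3 + (253009 + 324 * 10 - 36 * 503) * k ^ 2 * l * t ^ 2 + (324 * 9 - 36 * 5030) * k ^ 3 * t, by ring⟩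
  obtain ⟨N, hN⟩ : ∃ N : ℕ, (N : ℤ) = 503 * k - 9 * m := ⟨_, Int.toNat_of_nonneg hB.le⟩
  -- Up to the square b², the first factor is a squarefree β. It shares each of its primes with the
  -- second factor T, and such primes are only 2, 3 and 73, all squares modulo 503.
  obtain ⟨β, b, hβb, hβ⟩ := Nat.sq_mul_squarefree N
  obtain ⟨T, hT⟩ : ∃ T, T = m ^ 2 * (503 * k - 9 * m) - 36 * k * (m + k) * (m + 9 * k) := ⟨_, rfl⟩
  have hb0 : (b : ℤ) ≠ 0 := by
    rintro h
    have : b = 0 := by exact_mod_cast h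
    subst this
    simp at hβb
    subst hβb
    simp at hN
    omega
  have hBb : 503 * k - 9 * m = b ^ 2 * β := by rw [← hN, ← hβb]; push_cast; ring
  obtain ⟨y, rfl⟩ : (b : ℤ) ∣ Y := by
    rw [← Int.pow_dvd_pow_iff (two_ne_zero), hY, hBb]
    exact ⟨β * (m ^ 2 * (b ^ 2 * β) - 36 * k * (m + k) * (m + 9 * k)), by ring⟩
  have hy : y ^ 2 = β * T := by
    rw [← hT, hBb] at hY
    have : (b : ℤ) ^ 2 ≠ 0 := pow_ne_zero 2 hb0
    apply mul_left_cancel₀ this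
    linarith
  have hβT : ∀ l : ℕ, l.Prime → l ∣ β → (l : ℤ) ∣ T := by
    intro l hl hlβ
    have hlp := Nat.prime_iff_prime_int.1 hl
    obtain ⟨c, rfl⟩ := hlβ
    obtain ⟨z, rfl⟩ : (l : ℤ) ∣ y := hlp.dvd_of_dvd_pow (n := 2) (by rw [hy]; push_cast; exact ⟨_, mul_assoc _ _ _⟩)
    have h1 : (l : ℤ) * z ^ 2 = c * T := by
      have : (l : ℤ) ≠ 0 := hlp.ne_zero
      apply mul_left_cancel₀ this
      push_cast at hy
      linarith
    refine (hlp.dvd_or_dvd (show (l : ℤ) ∣ c * T from ⟨_, h1.symm⟩)).resolve_left fun h => ?_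
    have hlc : l ∣ c := by exact_mod_cast h
    exact hl.not_isUnit (hβ l (mul_dvd_mul_left l hlc))
  have hβl : ∀ l : ℕ, l.Prime → l ∣ β → l = 2 ∨ l = 3 ∨ l = 73 := by
    intro l hl hlβ
    have hlp := Nat.prime_iff_prime_int.1 hl
    have hlB : (l : ℤ) ∣ 503 * k - 9 * m := by
      rw [hBb]; exact (Int.natCast_dvd_natCast.2 hlβ).mul_left _
    have h36 : (l : ℤ) ∣ 36 * k * (m + k) * (m + 9 * k) := by
      have := (hlB.mul_left (m ^ 2)).sub (hβT l hl hlβ)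
      rwa [hT, sub_sub_cancel] at this
    have hnot : (l : ℤ) ∣ k → (l : ℤ) ∣ m → False := fun h1 h2 =>
      hlp.not_isUnit (hk.isUnit_of_dvd' h2 h1)
    have hdvd : ∀ d : ℕ, (l : ℤ) ∣ (d : ℤ) → l ∣ d := fun d h => by exact_mod_cast h
    have hpr : ∀ q : ℕ, q.Prime → l ∣ q → l = q := fun q hq h =>
      (Nat.prime_dvd_prime_iff_eq hl hq).1 h
    rcases hlp.dvd_or_dvd h36 with h | h
    · rcases hlp.dvd_or_dvd h with h | h
      · rcases hlp.dvd_or_dvd h with h | h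
        · rcases (Nat.Prime.dvd_mul hl).1 (show l ∣ 4 * 9 from hdvd 36 h) with h | h
          · exact .inl (hpr 2 Nat.prime_two (hl.dvd_of_dvd_pow (show l ∣ 2 ^ 2 from h)))
          · exact .inr (.inl (hpr 3 Nat.prime_three (hl.dvd_of_dvd_pow (show l ∣ 3 ^ 2 from h))))
        · have h9 : (l : ℤ) ∣ (9 : ℕ) * m := by
            have := (h.mul_left 503).sub hlB
            rwa [sub_sub_cancel] at this
          rcases hlp.dvd_or_dvd h9 with h' | h'
          · exact .inr (.inl (hpr 3 Nat.prime_three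
              (hl.dvd_of_dvd_pow (show l ∣ 3 ^ 2 from hdvd 9 h'))))
          · exact (hnot h h').elim
      -- Substituting m ≡ -k turns 503k - 9m into 512k; below, m ≡ -9k gives 584k = 8 · 73k.
      · have h9 : (l : ℤ) ∣ (512 : ℕ) * k := by
          have := hlB.add (h.mul_left 9)
          rwa [show 503 * k - 9 * m + 9 * (m + k) = (512 : ℕ) * k by push_cast; ring] at this
        rcases hlp.dvd_or_dvd h9 with h' | h'
        · exact .inl (hpr 2 Nat.prime_two (hl.dvd_of_dvd_pow (show l ∣ 2 ^ 9 from hdvd 512 h')))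
        · exact (hnot h' ((dvd_add_left h').1 h)).elim
    · have h9 : (l : ℤ) ∣ (584 : ℕ) * k := by
        have := hlB.add (h.mul_left 9)
        rwa [show 503 * k - 9 * m + 9 * (m + 9 * k) = (584 : ℕ) * k by push_cast; ring] at this
      rcases hlp.dvd_or_dvd h9 with h' | h'
      · rcases (Nat.Prime.dvd_mul hl).1 (show l ∣ 8 * 73 from hdvd 584 h') with h | h
        · exact .inl (hpr 2 Nat.prime_two (hl.dvd_of_dvd_pow (show l ∣ 2 ^ 3 from h)))
        · exact .inr (.inr (hpr 73 (by norm_num) h))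
      · exact (hnot h' ((dvd_add_left (h'.mul_left 9)).1 h)).elim
  have hχβ : legendreSym 503 β = 1 := by
    refine legendreSym_eq_one_of_forall_prime (fun l hl hlβ => ?_) hβ.ne_zero
    rcases hβl l hl hlβ with rfl | rfl | rfl <;> norm_num
  have hχsq : ∀ z : ℤ, ¬ (503 : ℤ) ∣ z → legendreSym 503 (z ^ 2) = 1 := fun z hz =>
    legendreSym.sq_one' 503 (by rwa [Ne, ZMod.intCast_zmod_eq_zero_iff_dvd])
  have hcongr : ∀ u v : ℤ, (503 : ℤ) ∣ u - v → legendreSym 503 u = legendreSym 503 v := by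
    intro u v huv
    rw [legendreSym.mod 503 u, legendreSym.mod 503 v]
    congr 1
    exact (Int.modEq_iff_dvd.2 huv).symm
  have hneg1 : legendreSym 503 (-1) = -1 := by norm_num
  have h503 : Prime (503 : ℤ) := by norm_num
  have hmk : ¬ (503 : ℤ) ∣ m → legendreSym 503 m = 1 := by
    intro h
    lift m to ℕ using hm.le
    refine legendreSym_eq_one_of_forall_prime (fun l hl hlm => ?_) (by omega)
    refine hprime l hl ?_ (Int.natCast_dvd_natCast.2 hlm)
    rintro rfl
    exact h (Int.natCast_dvd_natCast.2 hlm)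
  -- If 503 does not divide m, the contradiction comes from 503k - 9m ≡ -9m. Otherwise 503 divides
  -- b, hence k ≡ 9m/503, so k is a square modulo 503, and the contradiction comes from T ≡ -18²k³.
  by_cases h : (503 : ℤ) ∣ m
  · obtain ⟨m', rfl⟩ := h
    have hk' : ¬ (503 : ℤ) ∣ k := fun h => h503.not_isUnit (hk.isUnit_of_dvd' (dvd_mul_right _ _) h)
    have hbdvd : (503 : ℤ) ∣ b := by
      have : (503 : ℤ) ∣ b ^ 2 * β := by rw [← hBb]; exact ⟨k - 9 * m', by ring⟩
      refine h503.dvd_of_dvd_pow ((h503.dvd_or_dvd this).resolve_right fun h => ?_)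
      rcases hβl 503 (by norm_num) (by exact_mod_cast h) with h | h | h <;> omega
    have hkm : (503 : ℤ) ∣ k - 9 * m' := by
      obtain ⟨c, hc⟩ := hbdvd
      rw [hc] at hBb
      exact ⟨c ^ 2 * β, by linarith⟩
    have hm' : ¬ (503 : ℤ) ∣ m' := fun h => hk' ((dvd_sub_left (h.mul_left 9)).1 hkm)
    have hχm : legendreSym 503 m' = 1 := by
      have hm0 : 0 < m' := by omega
      lift m' to ℕ using hm0.le
      refine legendreSym_eq_one_of_forall_prime (fun l hl hlm => ?_) (by omega)
      refine hprime l hl ?_ ((Int.natCast_dvd_natCast.2 hlm).mul_left _)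
      rintro rfl
      exact hm' (Int.natCast_dvd_natCast.2 hlm)
    have hχk : legendreSym 503 k = 1 := by
      rw [hcongr k (3 ^ 2 * m') (by simpa using hkm), legendreSym.mul, hχm,
        hχsq 3 (by norm_num)]
      norm_num
    have hTk : legendreSym 503 T = -1 := by
      rw [hcongr T (-1 * 18 ^ 2 * k ^ 2 * k) ?_, legendreSym.mul, legendreSym.mul, legendreSym.mul,
        hχsq 18 (by norm_num), hχsq k hk', hχk, hneg1]
      · norm_num
      · rw [hT]
        exact ⟨503 * m' ^ 2 * (503 * k - 9 * (503 * m')) - 36 * k * (503 * m' ^ 2 + 10 * m' * k),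
          by ring⟩
    have hyT : legendreSym 503 (y ^ 2) = -1 := by rw [hy, legendreSym.mul, hχβ, hTk]; norm_num
    by_cases hy0 : (503 : ℤ) ∣ y
    · rw [(legendreSym.eq_zero_iff 503 _).2] at hyT
      · norm_num at hyT
      · rw [ZMod.intCast_zmod_eq_zero_iff_dvd]
        exact hy0.trans (dvd_pow_self _ two_ne_zero)
    · rw [hχsq y hy0] at hyT
      norm_num at hyT
  · have hB9 : legendreSym 503 (503 * k - 9 * m) = -1 := by
      rw [hcongr _ (-1 * 3 ^ 2 * m) ⟨k, by ring⟩, legendreSym.mul, legendreSym.mul, hmk h, hneg1,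
        hχsq 3 (by norm_num)]
      norm_num
    rw [hBb, legendreSym.mul, hχβ, mul_one] at hB9
    by_cases hb : (503 : ℤ) ∣ b
    · rw [(legendreSym.eq_zero_iff 503 _).2] at hB9
      · norm_num at hB9
      · rw [ZMod.intCast_zmod_eq_zero_iff_dvd]
        exact hb.trans (dvd_pow_self _ two_ne_zero)
    · rw [hχsq _ hb] at hB9
      norm_num at hB9

/-- The discriminant σ² - 4xy = (x - y)² is a rational square, and xy is a rational function of σ;
clearing the denominator of σ gives the integral equation. Positivity of x and y enters through σ >
0 and 503 - 9σ > 0. -/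
theorem no_pos_point_nine {x y : ℚ} (hx : 0 < x) (hy : 0 < y)
    (h : 9 * (x + 1) * (y + 1) * (x + y + 9) = (9 - 1) * (9 ^ 2 - 9 + 1) * (x * y)) : False := by
  obtain ⟨σ, hσ⟩ : ∃ σ, σ = x + y := ⟨_, rfl⟩
  have hσ0 : 0 < σ := by rw [hσ]; positivity
  have h1 : x * y * (503 - 9 * σ) = 9 * (σ + 1) * (σ + 9) := by rw [hσ]; linear_combination -h
  have hpos : 0 < 503 - 9 * σ := by
    have h2 : 0 < x * y * (503 - 9 * σ) := by rw [h1]; positivity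
    exact (pos_iff_pos_of_mul_pos h2).1 (mul_pos hx hy)
  have hden : (0 : ℚ) < σ.den := by exact_mod_cast σ.den_pos
  have hnum : σ * σ.den = σ.num := Rat.mul_den_eq_num σ
  have hsq : IsSquare (((503 * σ.den - 9 * σ.num) * (σ.num ^ 2 * (503 * σ.den - 9 * σ.num) -
      36 * σ.den * (σ.num + σ.den) * (σ.num + 9 * σ.den)) : ℤ) : ℚ) := by
    refine ⟨σ.den * (503 * σ.den - 9 * σ.num) * (x - y), ?_⟩
    push_cast
    rw [← hnum]
    have h3 : (x - y) ^ 2 = σ ^ 2 - 4 * (x * y) := by rw [hσ]; ring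
    linear_combination (-(σ.den : ℚ) ^ 4 * (503 - 9 * σ) ^ 2) * h3 +
      (σ.den : ℚ) ^ 4 * 4 * (503 - 9 * σ) * h1
  rw [Rat.isSquare_intCast_iff] at hsq
  obtain ⟨Y, hY⟩ := hsq
  refine no_pos_coprime_solution (m := σ.num) (k := σ.den) (Y := Y) (Rat.num_pos.2 hσ0)
    ?_ ?_ (by rw [hY]; ring)
  · exact (Rat.isCoprime_num_den σ)
  · have : (0 : ℚ) < 503 * σ.den - 9 * σ.num := by
      rw [← hnum]
      have := mul_pos hpos hden
      linarith
    exact_mod_cast this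

/-! ### From nine-cycles to Hesse cubics for a = 6 and a = 8 -/

theorem lyness_nine_cycle_values {a x0 x1 x2 x3 x4 x5 x6 x7 x8 : ℚ}
    (n0 : x0 ≠ 0) (n1 : x1 ≠ 0) (n2 : x2 ≠ 0) (n3 : x3 ≠ 0) (n8 : x8 ≠ 0)
    (h0 : x2 * x0 = a + x1) (h1 : x3 * x1 = a + x2) (h2 : x4 * x2 = a + x3)
    (h3 : x5 * x3 = a + x4) (h6 : x8 * x6 = a + x7) (h7 : x0 * x7 = a + x8)
    (h8 : x1 * x8 = a + x0)
    (hC : a * (x0 + 1) * (x1 + 1) * (x0 + x1 + a) = (a - 1) * (a ^ 2 - a + 1) * (x0 * x1)) :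
    a + x0 ≠ 0 ∧ a + x1 ≠ 0 ∧ x2 = (a + x1) / x0 ∧ x3 = (a * x0 + a + x1) / (x0 * x1) ∧
    x4 = (a * x0 * x1 + a * x0 + a + x1) / (x1 * (a + x1)) ∧
    x5 = a * (a - 1) * x0 * x1 / ((a + x0) * (a + x1)) ∧
    x6 = (a * x0 * x1 + a * x1 + a + x0) / (x0 * (a + x0)) ∧
    x7 = (a * x1 + a + x0) / (x0 * x1) ∧ x8 = (a + x0) / x1 := by
  have e2 : x2 = (a + x1) / x0 := by field_simp; linarith
  have e8 : x8 = (a + x0) / x1 := by field_simp; linarith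
  have m2 : a + x1 ≠ 0 := by rw [← h0]; positivity
  have m8 : a + x0 ≠ 0 := by rw [← h8]; positivity
  have e3 : x3 = (a * x0 + a + x1) / (x0 * x1) := by
    rw [eq_div_iff (by positivity)]; rw [e2] at h1; field_simp at h1; linarith
  have e7 : x7 = (a * x1 + a + x0) / (x0 * x1) := by
    rw [eq_div_iff (by positivity)]; rw [e8] at h7; field_simp at h7; linarith
  have e4 : x4 = (a * x0 * x1 + a * x0 + a + x1) / (x1 * (a + x1)) := by
    rw [eq_div_iff (by positivity)]; rw [e2, e3] at h2; field_simp at h2; linarith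
  have e6 : x6 = (a * x0 * x1 + a * x1 + a + x0) / (x0 * (a + x0)) := by
    rw [eq_div_iff (by positivity)]; rw [e8, e7] at h6; field_simp at h6; linarith
  -- Only the middle term x5 needs the cubic; the others come from running the recurrence forward or
  -- backward.
  refine ⟨m8, m2, e2, e3, e4, mul_right_cancel₀ n3 ?_, e6, e7, e8⟩
  rw [h3, e4, e3]
  field_simp
  linear_combination hC

/-- A cycle of length nine of the Lyness recurrence with parameter `6` gives a point on a Hesse cubic
that lies on none of the coordinate axes. -/
theorem exists_hesse_of_lyness_six {x : ℕ → ℚ} (h : IsLynessSequence 6 x) (hp : HasPeriod x 9) :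
    ∃ p q r : ℚ, p * q * r ≠ 0 ∧ 30 * (p ^ 3 + q ^ 3 + r ^ 3) = 109 * (p * q * r) := by
  have hC := h.curve hp
  have hper := hp.1.2
  have h7 := h.mul_eq 7
  have h8 := h.mul_eq 8
  rw [show 7 + 2 = 0 + 9 by rfl, hper 0] at h7
  rw [show 8 + 2 = 1 + 9 by rfl, hper 1, show 8 + 1 = 0 + 9 by rfl, hper 0] at h8
  obtain ⟨m8, m2, e2, e3, e4, e5, e6, e7, e8⟩ := lyness_nine_cycle_values (h 0).1 (h 1).1 (h 2).1
    (h 3).1 (h 8).1 (h.mul_eq 0) (h.mul_eq 1) (h.mul_eq 2) (h.mul_eq 3) (h.mul_eq 6) h7 h8 hC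
  have n0 := (h 0).1
  have n1 := (h 1).1
  -- The shift 13, and 33 for a = 8, is a² - 4a + 1; it brings the relation between the three sums
  -- to Hesse form. The total p + q + r is then the constant -(a³ - 6a² + 3a + 1)/a.
  obtain ⟨r, hr⟩ : ∃ r, r = x 0 + x 3 + x 6 - 13 := ⟨_, rfl⟩
  obtain ⟨p, hp⟩ : ∃ p, p = x 1 + x 4 + x 7 - 13 := ⟨_, rfl⟩
  obtain ⟨q, hq⟩ : ∃ q, q = x 2 + x 5 + x 8 - 13 := ⟨_, rfl⟩
  rw [e3, e6] at hr
  rw [e4, e7] at hp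
  rw [e2, e5, e8] at hq
  have hsum : p + q + r = (-19 / 6) := by
    rw [hp, hq, hr]
    field_simp
    linear_combination (1 * (x 0) * (x 1) + 12 * (x 0) + 12 * (x 1) + 72) * hC
  -- This is the Hesse equation after elimination of p + q through the constant total: p³ + q³ =
  -- (p+q)³ - 3pq(p+q).
  have hprod : p * q * (19 * r + 90 * (-19 / 6)) =
      30 * ((-19 / 6) ^ 3 - 3 * (-19 / 6) ^ 2 * r + 3 * (-19 / 6) * r ^ 2) := by
    rw [hp, hq, hr]
    field_simp
    linear_combination (216 * (x 0) ^ 6 * (x 1) ^ 2 + 1296 * (x 0) ^ 6 * (x 1) + 576 * (x 0) ^ 5 * (x 1) ^ 4 +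
        9324 * (x 0) ^ 5 * (x 1) ^ 3 - 6912 * (x 0) ^ 5 * (x 1) ^ 2 - 18144 * (x 0) ^ 5 * (x 1)
        + 7776 * (x 0) ^ 5 + 36 * (x 0) ^ 4 * (x 1) ^ 5 - 12174 * (x 0) ^ 4 * (x 1) ^ 4 - 2196 *
        (x 0) ^ 4 * (x 1) ^ 3 + 90288 * (x 0) ^ 4 * (x 1) ^ 2 - 404352 * (x 0) ^ 4 * (x 1) +
        108864 * (x 0) ^ 4 + 2844 * (x 0) ^ 3 * (x 1) ^ 5 - 43236 * (x 0) ^ 3 * (x 1) ^ 4 + 7344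
        * (x 0) ^ 3 * (x 1) ^ 3 + 1867536 * (x 0) ^ 3 * (x 1) ^ 2 - 1765152 * (x 0) ^ 3 * (x 1)
        + 513216 * (x 0) ^ 3 + 216 * (x 0) ^ 2 * (x 1) ^ 6 - 3672 * (x 0) ^ 2 * (x 1) ^ 5 +
        109728 * (x 0) ^ 2 * (x 1) ^ 4 + 1712016 * (x 0) ^ 2 * (x 1) ^ 3 + 4999968 * (x 0) ^ 2 *
        (x 1) ^ 2 - 1306368 * (x 0) ^ 2 * (x 1) + 1119744 * (x 0) ^ 2 + 1296 * (x 0) * (x 1) ^ 6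
        + 20736 * (x 0) * (x 1) ^ 5 - 93312 * (x 0) * (x 1) ^ 4 - 2231712 * (x 0) * (x 1) ^ 3 -
        6905088 * (x 0) * (x 1) ^ 2 + 2239488 * (x 0) * (x 1) + 1679616 * (x 0) + 7776 * (x 1) ^
        5 + 108864 * (x 1) ^ 4 + 513216 * (x 1) ^ 3 + 1119744 * (x 1) ^ 2 + 1679616 * (x 1)) * hC
  have hcub : 30 * (p ^ 3 + q ^ 3 + r ^ 3) = 109 * (p * q * r) := by
    have hq' : q = (-19 / 6) - r - p := by linarith
    rw [hq'] at hprod ⊢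
    linear_combination -hprod
  refine ⟨p, q, r, fun h0 => ?_, hcub⟩
  rw [h0, mul_zero] at hcub
  have h3 : p ^ 3 + q ^ 3 + r ^ 3 = 0 := by linarith
  have hz : (p + q + r) ^ 3 = 3 * ((p + q) * (q + r) * (r + p)) := by linear_combination h3
  rw [hsum] at hz
  -- A vanishing coordinate makes the other two opposite, so that the total would be 0 and not the
  -- nonzero constant.
  have key : ∀ u v w : ℚ, u = 0 → u ^ 3 + v ^ 3 + w ^ 3 = 0 → u + v + w = 0 := by
    intro u v w hu huv
    have : v ^ 3 = (-w) ^ 3 := by rw [hu] at huv; linarith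
    have := (Odd.strictMono_pow (by decide : Odd 3)).injective this
    rw [hu, this]; ring
  have h00 : p + q + r = 0 := by
    rcases mul_eq_zero.1 h0 with h1 | h1
    · rcases mul_eq_zero.1 h1 with h1 | h1
      · exact key _ _ _ h1 h3
      · linarith [key q p r h1 (by linarith)]
    · linarith [key r p q h1 (by linarith)]
  rw [hsum] at h00
  norm_num at h00

/-- A cycle of length nine of the Lyness recurrence with parameter `8` gives a point on a Hesse cubic
that lies on none of the coordinate axes. -/
theorem exists_hesse_of_lyness_eight {x : ℕ → ℚ} (h : IsLynessSequence 8 x) (hp : HasPeriod x 9) :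
    ∃ p q r : ℚ, p * q * r ≠ 0 ∧ 56 * (p ^ 3 + q ^ 3 + r ^ 3) = 321 * (p * q * r) := by
  have hC := h.curve hp
  have hper := hp.1.2
  have h7 := h.mul_eq 7
  have h8 := h.mul_eq 8
  rw [show 7 + 2 = 0 + 9 by rfl, hper 0] at h7
  rw [show 8 + 2 = 1 + 9 by rfl, hper 1, show 8 + 1 = 0 + 9 by rfl, hper 0] at h8
  obtain ⟨m8, m2, e2, e3, e4, e5, e6, e7, e8⟩ := lyness_nine_cycle_values (h 0).1 (h 1).1 (h 2).1
    (h 3).1 (h 8).1 (h.mul_eq 0) (h.mul_eq 1) (h.mul_eq 2) (h.mul_eq 3) (h.mul_eq 6) h7 h8 hC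
  have n0 := (h 0).1
  have n1 := (h 1).1
  obtain ⟨r, hr⟩ : ∃ r, r = x 0 + x 3 + x 6 - 33 := ⟨_, rfl⟩
  obtain ⟨p, hp⟩ : ∃ p, p = x 1 + x 4 + x 7 - 33 := ⟨_, rfl⟩
  obtain ⟨q, hq⟩ : ∃ q, q = x 2 + x 5 + x 8 - 33 := ⟨_, rfl⟩
  rw [e3, e6] at hr
  rw [e4, e7] at hp
  rw [e2, e5, e8] at hq
  have hsum : p + q + r = (-153 / 8) := by
    rw [hp, hq, hr]
    field_simp
    linear_combination (1 * (x 0) * (x 1) + 16 * (x 0) + 16 * (x 1) + 128) * hC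
  have hprod : p * q * (153 * r + 168 * (-153 / 8)) =
      56 * ((-153 / 8) ^ 3 - 3 * (-153 / 8) ^ 2 * r + 3 * (-153 / 8) * r ^ 2) := by
    rw [hp, hq, hr]
    field_simp
    linear_combination (512 * (x 0) ^ 6 * (x 1) ^ 2 + 4096 * (x 0) ^ 6 * (x 1) + 1408 * (x 0) ^ 5 * (x 1) ^ 4 +
        30272 * (x 0) ^ 5 * (x 1) ^ 3 - 96256 * (x 0) ^ 5 * (x 1) ^ 2 - 147456 * (x 0) ^ 5 * (x
        1) + 32768 * (x 0) ^ 5 + 64 * (x 0) ^ 4 * (x 1) ^ 5 - 70792 * (x 0) ^ 4 * (x 1) ^ 4 +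
        124864 * (x 0) ^ 4 * (x 1) ^ 3 + 2996224 * (x 0) ^ 4 * (x 1) ^ 2 - 3940352 * (x 0) ^ 4 *
        (x 1) + 589824 * (x 0) ^ 4 + 8768 * (x 0) ^ 3 * (x 1) ^ 5 - 55232 * (x 0) ^ 3 * (x 1) ^
        4 + 7685120 * (x 0) ^ 3 * (x 1) ^ 3 + 65867776 * (x 0) ^ 3 * (x 1) ^ 2 - 26836992 * (x
        0) ^ 3 * (x 1) + 3407872 * (x 0) ^ 3 + 512 * (x 0) ^ 2 * (x 1) ^ 6 - 85504 * (x 0) ^ 2 *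
        (x 1) ^ 5 + 3060736 * (x 0) ^ 2 * (x 1) ^ 4 + 64663552 * (x 0) ^ 2 * (x 1) ^ 3 +
        268337152 * (x 0) ^ 2 * (x 1) ^ 2 - 56623104 * (x 0) ^ 2 * (x 1) + 8388608 * (x 0) ^ 2 +
        4096 * (x 0) * (x 1) ^ 6 + 24576 * (x 0) * (x 1) ^ 5 - 2220032 * (x 0) * (x 1) ^ 4 -
        32342016 * (x 0) * (x 1) ^ 3 - 122683392 * (x 0) * (x 1) ^ 2 - 12582912 * (x 0) * (x 1)
        + 16777216 * (x 0) + 32768 * (x 1) ^ 5 + 589824 * (x 1) ^ 4 + 3407872 * (x 1) ^ 3 +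
        8388608 * (x 1) ^ 2 + 16777216 * (x 1)) * hC
  have hcub : 56 * (p ^ 3 + q ^ 3 + r ^ 3) = 321 * (p * q * r) := by
    have hq' : q = (-153 / 8) - r - p := by linarith
    rw [hq'] at hprod ⊢
    linear_combination -hprod
  refine ⟨p, q, r, fun h0 => ?_, hcub⟩
  rw [h0, mul_zero] at hcub
  have h3 : p ^ 3 + q ^ 3 + r ^ 3 = 0 := by linarith
  have hz : (p + q + r) ^ 3 = 3 * ((p + q) * (q + r) * (r + p)) := by linear_combination h3
  rw [hsum] at hz
  have key : ∀ u v w : ℚ, u = 0 → u ^ 3 + v ^ 3 + w ^ 3 = 0 → u + v + w = 0 := by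
    intro u v w hu huv
    have : v ^ 3 = (-w) ^ 3 := by rw [hu] at huv; linarith
    have := (Odd.strictMono_pow (by decide : Odd 3)).injective this
    rw [hu, this]; ring
  have h00 : p + q + r = 0 := by
    rcases mul_eq_zero.1 h0 with h1 | h1
    · rcases mul_eq_zero.1 h1 with h1 | h1
      · exact key _ _ _ h1 h3
      · linarith [key q p r h1 (by linarith)]
    · linarith [key r p q h1 (by linarith)]
  rw [hsum] at h00
  norm_num at h00

/-! ### Cubes up to units and the Euclidean ring of Eisenstein integers -/

/-- If `S * w * t = D * m ^ 3`, where no prime factor of `w` divides `D`, `S` or `t`, then `w` is a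
cube up to a unit. -/
theorem exists_unit_mul_cube {R : Type*} [EuclideanDomain R] {S w t D m : R} (h : S * w * t = D * m ^ 3) (hw : w ≠ 0)
    (hD : D ≠ 0) (hwD : ∀ μ, Prime μ → μ ∣ w → ¬ μ ∣ D) (hwS : ∀ μ, Prime μ → μ ∣ w → ¬ μ ∣ S)
    (hwt : ∀ μ, Prime μ → μ ∣ w → ¬ μ ∣ t) :
    ∃ u β : R, IsUnit u ∧ w = u * β ^ 3 := by
  have hcop := isCoprime_of_prime_dvd (fun h => hw h.1) hwD
  obtain ⟨k, hk⟩ : D ∣ S * t := by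
    refine hcop.symm.dvd_of_dvd_mul_left (y := w) ⟨m ^ 3, ?_⟩
    rw [← h]; ring
  have hwk : w * k = m ^ 3 := by
    apply mul_left_cancel₀ hD
    rw [← h]
    linear_combination -w * hk
  have hcop' : IsCoprime w k := by
    refine isCoprime_of_prime_dvd (fun h => hw h.1) fun μ hμ hμw hμk => ?_
    have : μ ∣ S * t := by rw [hk]; exact hμk.mul_left _
    rcases hμ.dvd_or_dvd this with h | h
    · exact hwS μ hμ hμw h
    · exact hwt μ hμ hμw h
  obtain ⟨β, u, hu⟩ := exists_associated_pow_of_mul_eq_pow' hcop' hwk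
  exact ⟨u, β, u.isUnit, by rw [← hu, mul_comm]⟩

/-- The ring of Eisenstein integers `ℤ[ω]` with `ω ^ 2 = -1 - ω`. -/
abbrev Eisenstein : Type := QuadraticAlgebra ℤ (-1) (-1)

namespace Eisenstein

open QuadraticAlgebra

theorem norm_eq (z : Eisenstein) : z.norm = z.re ^ 2 - z.re * z.im + z.im ^ 2 := by
  rw [norm_def]; ring

theorem norm_nonneg (z : Eisenstein) : 0 ≤ z.norm := by
  rw [norm_eq]; nlinarith [sq_nonneg (z.re - z.im), sq_nonneg z.re, sq_nonneg z.im]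

theorem norm_eq_zero {z : Eisenstein} : z.norm = 0 ↔ z = 0 := by
  refine ⟨fun h => ?_, fun h => by rw [h, QuadraticAlgebra.norm_zero]⟩
  rw [norm_eq] at h
  have h1 : z.re = 0 := by
    rw [← sq_eq_zero_iff]
    nlinarith [sq_nonneg (z.re - 2 * z.im), sq_nonneg z.re]
  have h2 : z.im = 0 := by
    rw [← sq_eq_zero_iff]
    nlinarith [sq_nonneg (z.im - 2 * z.re), sq_nonneg z.im]
  ext <;> simpa

theorem mul_star_self (z : Eisenstein) : z * star z = (z.norm : ℤ) := by
  ext <;> simp [norm_def] <;> ring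

/-- Rounded division. -/
def quo (z w : Eisenstein) : Eisenstein :=
  ⟨(2 * (z * star w).re + w.norm) / (2 * w.norm), (2 * (z * star w).im + w.norm) / (2 * w.norm)⟩

/-- Rounding leaves both coordinates of the error at most 1/2 in absolute value, and a² - ab + b² ≤
3/4 there. -/
theorem norm_sub_mul_quo_lt (z : Eisenstein) {w : Eisenstein} (hw : w ≠ 0) :
    (z - w * quo z w).norm < w.norm := by
  have hN : 0 < w.norm := lt_of_le_of_ne (norm_nonneg w) fun h => hw (norm_eq_zero.1 h.symm)
  have hround : ∀ a N : ℤ, 0 < N → |2 * (a - N * ((2 * a + N) / (2 * N)))| ≤ N := by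
    intro a N hN
    have h1 := Int.emod_add_mul_ediv (2 * a + N) (2 * N)
    have h2 := Int.emod_nonneg (2 * a + N) (by omega : 2 * N ≠ 0)
    have h3 := Int.emod_lt_of_pos (2 * a + N) (by omega : 0 < 2 * N)
    rw [abs_le]
    constructor <;> nlinarith
  obtain ⟨e, he⟩ : ∃ e, e = z * star w - (w.norm : ℤ) * quo z w := ⟨_, rfl⟩
  have h1 : (z - w * quo z w) * star w = e := by
    rw [he, ← mul_star_self]; ring
  have hre : |2 * e.re| ≤ w.norm := by
    have := hround (z * star w).re _ hN
    rw [he]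
    simpa [quo] using this
  have him : |2 * e.im| ≤ w.norm := by
    have := hround (z * star w).im _ hN
    rw [he]
    simpa [quo] using this
  have h2 : (z - w * quo z w).norm * w.norm = e.norm := by
    rw [← h1, map_mul, QuadraticAlgebra.norm_star]
  have h3 : e.norm < w.norm * w.norm := by
    rw [norm_eq]
    rw [abs_le] at hre him
    nlinarith
  rw [← h2] at h3
  exact lt_of_mul_lt_mul_right h3 hN.le

noncomputable instance : EuclideanDomain Eisenstein :=
  { (inferInstance : CommRing Eisenstein), (inferInstance : Nontrivial Eisenstein) with
    quotient := quo
    remainder := fun z w => z - w * quo z w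
    quotient_zero := fun z => by
      ext <;> simp [quo]
    quotient_mul_add_remainder_eq := fun z w => by ring
    r := fun z w => z.norm.natAbs < w.norm.natAbs
    r_wellFounded := (measure fun z : Eisenstein => z.norm.natAbs).wf
    remainder_lt := fun z w hw => by
      have h1 := norm_sub_mul_quo_lt z hw
      have h2 := norm_nonneg (z - w * quo z w)
      omega
    mul_left_not_lt := fun z w hw => by
      have h1 : 0 < w.norm := lt_of_le_of_ne (norm_nonneg w) fun h => hw (norm_eq_zero.1 h.symm)
      rw [map_mul, Int.natAbs_mul, not_lt]
      exact Nat.le_mul_of_pos_right _ (by omega) }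

theorem isUnit_cases {u : Eisenstein} (hu : IsUnit u) :
    ∃ s : ℤ, (s = 1 ∨ s = -1) ∧ (u = ⟨s, 0⟩ ∨ u = ⟨0, s⟩ ∨ u = ⟨-s, -s⟩) := by
  have hn : u.norm = 1 := by
    have h1 := hu.map (QuadraticAlgebra.norm : Eisenstein →* ℤ)
    rcases Int.isUnit_iff.1 h1 with h | h
    · exact h
    · have := norm_nonneg u
      omega
  rw [norm_eq] at hn
  have h1 : -1 ≤ u.re ∧ u.re ≤ 1 := by constructor <;> nlinarith [sq_nonneg (u.re - 2 * u.im)]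
  have h2 : -1 ≤ u.im ∧ u.im ≤ 1 := by constructor <;> nlinarith [sq_nonneg (u.im - 2 * u.re)]
  obtain ⟨x, y⟩ := u
  simp only at hn h1 h2
  obtain ⟨h1, h1'⟩ := h1
  obtain ⟨h2, h2'⟩ := h2
  interval_cases x <;> interval_cases y <;> norm_num at hn
  · exact ⟨1, by simp, by simp⟩
  · exact ⟨-1, by simp, by simp⟩
  · exact ⟨-1, by simp, by simp⟩
  · exact ⟨1, by simp, by simp⟩
  · exact ⟨1, by simp, by simp⟩
  · exact ⟨-1, by simp, by simp⟩

theorem prime_of_norm_prime {z : Eisenstein} (hz : Prime z.norm) : Prime z := by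
  rw [← irreducible_iff_prime]
  refine ⟨fun h => hz.not_isUnit (h.map (QuadraticAlgebra.norm : Eisenstein →* ℤ)), ?_⟩
  rintro a b rfl
  rw [map_mul] at hz
  rcases hz.irreducible.isUnit_or_isUnit rfl with h | h
  · exact .inl (isUnit_iff_norm_isUnit.2 h)
  · exact .inr (isUnit_iff_norm_isUnit.2 h)

theorem star_prime {z : Eisenstein} (hz : Prime z.norm) : Prime (star z) :=
  prime_of_norm_prime (by rwa [QuadraticAlgebra.norm_star])

/-- Split off the full power of a prime. -/
theorem exists_eq_pow_mul {z μ : Eisenstein} (hz : z ≠ 0) (hμ : Prime μ) :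
    ∃ (i : ℕ) (w : Eisenstein), ¬ μ ∣ w ∧ z = μ ^ i * w :=
  WfDvdMonoid.max_power_factor hz hμ.irreducible

end Eisenstein

/-! ### Cubic residue conditions at 2 and 3 -/

namespace Eisenstein

open QuadraticAlgebra

/-- `z` is congruent to `r (1 + 3 s ω)` modulo `9` for an integer `r` prime to `3`. -/
def HasSlope (s : ℤ) (z : Eisenstein) : Prop := ¬ (3 : ℤ) ∣ z.re ∧ (9 : ℤ) ∣ z.im - 3 * s * z.re

/-- Modulo 9, (1 + 3sω)(1 + 3tω) ≡ 1 + 3(s+t)ω: the slope is a homomorphism to ℤ/3, a substitute for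
a cubic residue character. -/
theorem HasSlope.mul {s t : ℤ} {z w : Eisenstein} (hz : HasSlope s z) (hw : HasSlope t w) :
    HasSlope (s + t) (z * w) := by
  obtain ⟨hz1, a, ha⟩ := hz
  obtain ⟨hw1, b, hb⟩ := hw
  have ha' : z.im = 3 * (s * z.re + 3 * a) := by linarith
  have hb' : w.im = 3 * (t * w.re + 3 * b) := by linarith
  have hre : (z * w).re = z.re * w.re - z.im * w.im := by simp; ring
  have him : (z * w).im = z.re * w.im + z.im * w.re - z.im * w.im := by simp; ring
  refine ⟨fun h => ?_, ?_⟩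
  · rw [hre] at h
    have h3 : (3 : ℤ) ∣ z.re * w.re := by
      have h4 : (3 : ℤ) ∣ z.im * w.im := (Dvd.intro _ ha'.symm).mul_right _
      exact (dvd_sub_left h4).1 h
    rcases Int.prime_three.dvd_or_dvd h3 with h | h
    · exact hz1 h
    · exact hw1 h
  · rw [him, hre, ha', hb']
    refine ⟨b * z.re + a * w.re - (s * z.re + 3 * a) * (t * w.re + 3 * b) +
      3 * (s + t) * (s * z.re + 3 * a) * (t * w.re + 3 * b), by ring⟩

theorem hasSlope_one : HasSlope 0 1 := by constructor <;> simp [QuadraticAlgebra.re_one, QuadraticAlgebra.im_one]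

theorem HasSlope.pow {s : ℤ} {z : Eisenstein} (hz : HasSlope s z) (n : ℕ) :
    HasSlope (n * s) (z ^ n) := by
  induction n with
  | zero => simpa using hasSlope_one
  | succ n ih =>
    rw [pow_succ]
    convert ih.mul hz using 1
    push_cast
    ring

theorem cube_re (z : Eisenstein) : (z ^ 3).re = z.re ^ 3 + z.im ^ 3 - 3 * z.re * z.im ^ 2 := by
  rw [pow_succ, pow_two]; simp; ring

theorem cube_im (z : Eisenstein) : (z ^ 3).im = 3 * z.re * z.im * (z.re - z.im) := by
  rw [pow_succ, pow_two]; simp; ring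

theorem hasSlope_cube {z : Eisenstein} (hz : ¬ (3 : ℤ) ∣ z.norm) : HasSlope 0 (z ^ 3) := by
  rw [norm_eq] at hz
  rw [HasSlope, cube_re, cube_im]
  obtain ⟨a, ha⟩ : ∃ a, a = z.re := ⟨_, rfl⟩
  obtain ⟨b, hb⟩ : ∃ b, b = z.im := ⟨_, rfl⟩
  rw [← ha, ← hb] at hz ⊢
  -- Divisibility by 3 is expressed in `ZMod 9` as vanishing of the triple, so that one finite check
  -- covers both moduli.
  have key : ∀ a b : ZMod 9, 3 * (a ^ 2 - a * b + b ^ 2) ≠ 0 →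
      3 * (a ^ 3 + b ^ 3 - 3 * a * b ^ 2) ≠ 0 ∧ 3 * a * b * (a - b) = 0 := by decide
  have h3 : ∀ n : ℤ, ((3 * n : ℤ) : ZMod 9) = 0 ↔ (3 : ℤ) ∣ n := by
    intro n
    rw [ZMod.intCast_zmod_eq_zero_iff_dvd]
    push_cast
    omega
  have := key a b (by
    rw [← h3] at hz
    push_cast at hz
    exact hz)
  constructor
  · rw [← h3]
    push_cast
    exact this.1
  · have h9 : ((3 * a * b * (a - b) : ℤ) : ZMod 9) = 0 := by
      push_cast
      exact this.2
    rw [ZMod.intCast_zmod_eq_zero_iff_dvd] at h9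
    simpa using h9

/-- `z ≡ 1` modulo `2`. -/
def IsOddReal (z : Eisenstein) : Prop := z.re % 2 = 1 ∧ z.im % 2 = 0

theorem IsOddReal.mul {z w : Eisenstein} (hz : IsOddReal z) (hw : IsOddReal w) :
    IsOddReal (z * w) := by
  obtain ⟨hz1, hz2⟩ := hz
  obtain ⟨hw1, hw2⟩ := hw
  obtain ⟨a, ha⟩ : ∃ a, z.re = 2 * a + 1 := ⟨z.re / 2, by omega⟩
  obtain ⟨b, hb⟩ : ∃ b, z.im = 2 * b := ⟨z.im / 2, by omega⟩
  obtain ⟨c, hc⟩ : ∃ c, w.re = 2 * c + 1 := ⟨w.re / 2, by omega⟩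
  obtain ⟨d, hd⟩ : ∃ d, w.im = 2 * d := ⟨w.im / 2, by omega⟩
  have hre : (z * w).re = 2 * (2 * a * c + a + c - 2 * b * d) + 1 := by
    simp [ha, hb, hc, hd]; ring
  have him : (z * w).im = 2 * ((2 * a + 1) * d + b * (2 * c + 1) - 2 * b * d) := by
    simp [ha, hb, hc, hd]; ring
  constructor
  · omega
  · omega

theorem IsOddReal.pow {z : Eisenstein} (hz : IsOddReal z) (n : ℕ) : IsOddReal (z ^ n) := by
  induction n with
  | zero => constructor <;> simp [QuadraticAlgebra.re_one, QuadraticAlgebra.im_one]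
  | succ n ih => rw [pow_succ]; exact ih.mul hz

/-- The unit group of ℤ[ω]/2 has order 3, so cubes prime to 2 are trivial there. -/
theorem isOddReal_cube {z : Eisenstein} (hz : z.norm % 2 = 1) : IsOddReal (z ^ 3) := by
  rw [norm_eq] at hz
  rw [IsOddReal, cube_re, cube_im]
  rcases Int.emod_two_eq_zero_or_one z.re with h1 | h1 <;>
    rcases Int.emod_two_eq_zero_or_one z.im with h2 | h2 <;>
    simp [Int.add_emod, Int.mul_emod, Int.sub_emod, pow_succ, h1, h2] at hz ⊢

theorem not_dvd_of_isCoprime {μ z : Eisenstein} {n : ℤ} (hμ : Prime μ) (hz : IsCoprime z.norm n)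
    (h : μ ∣ z) : ¬ μ ∣ (n : Eisenstein) := by
  intro hn
  obtain ⟨a, b, hab⟩ := hz
  apply hμ.not_isUnit
  rw [isUnit_iff_dvd_one]
  have : (1 : Eisenstein) = a * (z * star z) + b * n := by
    rw [mul_star_self]
    exact_mod_cast hab.symm
  rw [this]
  exact ((h.mul_right _).mul_left _).add (hn.mul_left _)

/-- Both primes above the rational prime are split off, so the rest w has no prime factor in common
with it. This is applied above 19 and 31. -/
theorem exists_split {π z : Eisenstein} (hπ : Prime π.norm) (hz : z ≠ 0) :
    ∃ i j : ℕ, ∃ w, z = π ^ i * star π ^ j * w ∧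
      ∀ μ, Prime μ → μ ∣ w → ¬ μ ∣ (π.norm : Eisenstein) := by
  obtain ⟨i, v, hv, rfl⟩ := exists_eq_pow_mul hz (prime_of_norm_prime hπ)
  obtain ⟨j, w, hw, rfl⟩ := exists_eq_pow_mul (right_ne_zero_of_mul hz) (star_prime hπ)
  refine ⟨i, j, w, by ring, fun μ hμ hμw h => ?_⟩
  rw [← mul_star_self] at h
  rcases hμ.dvd_or_dvd h with h | h
  · have := hμ.associated_of_dvd (prime_of_norm_prime hπ) h
    exact hv ((this.symm.dvd.trans hμw).mul_left _)
  · have := hμ.associated_of_dvd (star_prime hπ) h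
    exact hw (this.symm.dvd.trans hμw)

theorem pow_eq_mod_three (z : Eisenstein) (i : ℕ) : z ^ i = z ^ (i % 3) * (z ^ (i / 3)) ^ 3 := by
  rw [← pow_mul, ← pow_add]
  congr 1
  omega

/-- A number prime to `3`, real modulo `3`, that is a unit times a number real modulo `3`, is plus
or minus that number. -/
theorem eq_of_eq_unit_mul {z u y : Eisenstein} {s : ℤ} (hu : IsUnit u) (h : z = u * y)
    (hz : (3 : ℤ) ∣ z.im) (hy : HasSlope s y) : ∃ ε : ℤ, (ε = 1 ∨ ε = -1) ∧ z = ε * y := by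
  obtain ⟨h3, h9⟩ := hy
  have h3im : (3 : ℤ) ∣ y.im := by
    have : (3 : ℤ) ∣ 3 * s * y.re := ⟨s * y.re, by ring⟩
    omega
  obtain ⟨ε, hε, rfl | rfl | rfl⟩ := isUnit_cases hu
  · exact ⟨ε, hε, by rw [h]; ext <;> simp⟩
  · exfalso
    rw [h] at hz
    rcases hε with rfl | rfl <;> simp at hz <;> omega
  · exfalso
    rw [h] at hz
    rcases hε with rfl | rfl <;> simp at hz <;> omega

theorem not_three_dvd_norm {z : Eisenstein} (him : (3 : ℤ) ∣ z.im) (hre : ¬ (3 : ℤ) ∣ z.re) :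
    ¬ (3 : ℤ) ∣ z.norm := by
  intro h
  rw [norm_eq] at h
  have h6 : (3 : ℤ) ∣ z.re ^ 2 := by
    have : z.re ^ 2 = (z.re ^ 2 - z.re * z.im + z.im ^ 2) + z.im * (z.re - z.im) := by ring
    rw [this]
    exact h.add (him.mul_right _)
  exact hre (Int.prime_three.dvd_of_dvd_pow h6)

theorem norm_odd {z γ : Eisenstein} (h2 : IsOddReal z) (h : γ.norm ∣ z.norm) :
    γ.norm % 2 = 1 := by
  rcases Int.emod_two_eq_zero_or_one γ.norm with h3 | h3
  · exfalso
    have h4 := (Int.dvd_of_emod_eq_zero h3).trans h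
    rw [norm_eq] at h4
    obtain ⟨h5, h6⟩ := h2
    have h6 := Int.dvd_of_emod_eq_zero h6
    have h7 : (2 : ℤ) ∣ z.re ^ 2 := by
      have : z.re ^ 2 = (z.re ^ 2 - z.re * z.im + z.im ^ 2) + z.im * (z.re - z.im) := by ring
      rw [this]
      exact h4.add (h6.mul_right _)
    have := Int.prime_two.dvd_of_dvd_pow h7
    omega
  · exact h3

/-- The two primes above 19 have slopes 2 and 1, those above 31 slopes 1 and 2, and cubes have slope
0. -/
theorem hasSlope_six {k l i j : ℕ} {β : Eisenstein} (hβ : HasSlope 0 (β ^ 3)) :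
    HasSlope (2 * k + l + i + 2 * j) ((⟨5, 3⟩ : Eisenstein) ^ k * (⟨2, -3⟩ : Eisenstein) ^ l *
      ((⟨5, 6⟩ : Eisenstein) ^ i * (⟨-1, -6⟩ : Eisenstein) ^ j * β ^ 3)) := by
  have h1 : HasSlope 2 ⟨5, 3⟩ := by constructor <;> norm_num
  have h2 : HasSlope 1 ⟨2, -3⟩ := by constructor <;> norm_num
  have h3 : HasSlope 1 ⟨5, 6⟩ := by constructor <;> norm_num
  have h4 : HasSlope 2 ⟨-1, -6⟩ := by constructor <;> norm_num
  convert ((h1.pow k).mul (h2.pow l)).mul (((h3.pow i).mul (h4.pow j)).mul hβ) using 1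
  ring

theorem dvd_im_sign_mul {ε : ℤ} (hε : ε = 1 ∨ ε = -1) (n : ℤ) (y : Eisenstein) :
    n ∣ (ε * y).im ↔ n ∣ y.im := by
  rcases hε with rfl | rfl <;> simp

/-- Modulo 2 the primes above 19 are ω² and ω, so a product that is real modulo 2 needs 2k + l ≡ 0
modulo 3, that is k ≡ l. -/
theorem modEq_of_isOddReal {z y : Eisenstein} {k l : ℕ} {ε : ℤ} (hε : ε = 1 ∨ ε = -1) (hk : k < 3)
    (hl : l < 3) (hz : z.im % 2 = 0) (hy : IsOddReal y)
    (h : z = ε * ((⟨5, 3⟩ : Eisenstein) ^ k * (⟨2, -3⟩ : Eisenstein) ^ l * y)) : k = l := by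
  obtain ⟨h1, h2⟩ := hy
  by_contra hkl
  have key : (z.im % 2 = 0) ↔
      (((⟨5, 3⟩ : Eisenstein) ^ k * (⟨2, -3⟩ : Eisenstein) ^ l * y).im % 2 = 0) := by
    rw [h, ← Int.dvd_iff_emod_eq_zero, ← Int.dvd_iff_emod_eq_zero, dvd_im_sign_mul hε]
  rw [key] at hz
  interval_cases k <;> interval_cases l <;> simp [pow_two] at hkl hz <;> omega

/-- An Eisenstein integer satisfying the local conditions at `2` and `3`, whose norm divides
`19 * 31 ^ 3` times a cube in a coprime way, is a cube up to rational factors `19` and `31`. -/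
theorem eq_mul_cube_six {z : Eisenstein} {t m : ℤ} (hz : z ≠ 0)
    (h : z.norm * t = 19 * 31 ^ 3 * m ^ 3)
    (hcop : ∀ μ, Prime μ → μ ∣ z → ¬ μ ∣ (19 : Eisenstein) → ¬ μ ∣ (31 : Eisenstein) →
      ¬ μ ∣ star z ∧ ¬ μ ∣ (t : Eisenstein))
    (him : (9 : ℤ) ∣ z.im) (hre : ¬ (3 : ℤ) ∣ z.re) (h2 : IsOddReal z) :
    ∃ (k i : ℕ) (β : Eisenstein), k < 3 ∧ i < 3 ∧ z = 19 ^ k * 31 ^ i * β ^ 3 := by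
  obtain ⟨k, l, v, hzv, hv⟩ := exists_split (π := ⟨5, 3⟩) (z := z) (by rw [norm_eq]; norm_num) hz
  have hv0 : v ≠ 0 := by rintro rfl; exact hz (by rw [hzv, mul_zero])
  obtain ⟨i, j, w, hvw, hw⟩ := exists_split (π := ⟨5, 6⟩) (z := v) (by rw [norm_eq]; norm_num) hv0
  have hw0 : w ≠ 0 := by rintro rfl; exact hv0 (by rw [hvw, mul_zero])
  have n19 : ((⟨5, 3⟩ : Eisenstein).norm : Eisenstein) = 19 := by rw [norm_eq]; norm_num
  have n31 : ((⟨5, 6⟩ : Eisenstein).norm : Eisenstein) = 31 := by rw [norm_eq]; norm_num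
  have d19 : (⟨5, 3⟩ : Eisenstein) * ⟨2, -3⟩ = 19 := by ext <;> simp
  have d31 : (⟨5, 6⟩ : Eisenstein) * ⟨-1, -6⟩ = 31 := by ext <;> simp
  have s19 : star (⟨5, 3⟩ : Eisenstein) = ⟨2, -3⟩ := by ext <;> simp
  have s31 : star (⟨5, 6⟩ : Eisenstein) = ⟨-1, -6⟩ := by ext <;> simp
  rw [n19] at hv
  rw [n31] at hw
  rw [s19] at hzv
  rw [s31] at hvw
  have hwv : ∀ μ, μ ∣ w → μ ∣ v := fun μ h => hvw ▸ h.mul_left _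
  have hwz : ∀ μ, μ ∣ w → μ ∣ z := fun μ h => hzv ▸ (hwv μ h).mul_left _
  obtain ⟨u, β, hu, hwβ⟩ := exists_unit_mul_cube (w := w) (m := m)
    (S := ⟨5, 3⟩ ^ k * ⟨2, -3⟩ ^ l * (⟨5, 6⟩ ^ i * ⟨-1, -6⟩ ^ j)) (t := star z * t)
    (D := 19 * 31 ^ 3) (by
      have : z * star z * t = 19 * 31 ^ 3 * m ^ 3 := by rw [mul_star_self]; exact_mod_cast h
      rw [← this]
      conv_rhs => rw [hzv, hvw]
      conv_lhs => rw [hzv, hvw]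
      ring) hw0 (by
      intro h0
      have := congrArg re h0
      norm_num [pow_succ] at this)
    (fun μ hμ hμw h => (hμ.dvd_or_dvd h).elim (hv μ hμ (hwv μ hμw)) fun h =>
      hw μ hμ hμw (hμ.dvd_of_dvd_pow h))
    (fun μ hμ hμw h => by
      rcases hμ.dvd_or_dvd h with h | h <;> rcases hμ.dvd_or_dvd h with h | h
      · exact hv μ hμ (hwv μ hμw) (d19 ▸ (hμ.dvd_of_dvd_pow h).mul_right _)
      · exact hv μ hμ (hwv μ hμw) (d19 ▸ (hμ.dvd_of_dvd_pow h).mul_left _)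
      · exact hw μ hμ hμw (d31 ▸ (hμ.dvd_of_dvd_pow h).mul_right _)
      · exact hw μ hμ hμw (d31 ▸ (hμ.dvd_of_dvd_pow h).mul_left _))
    (fun μ hμ hμw h => by
      have := hcop μ hμ (hwz μ hμw) (hv μ hμ (hwv μ hμw)) (hw μ hμ hμw)
      exact (hμ.dvd_or_dvd h).elim this.1 this.2)
  -- Whole cubes of the split-off primes move into γ, leaving exponents below 3.
  obtain ⟨γ, hγ⟩ : ∃ γ : Eisenstein, γ = ⟨5, 3⟩ ^ (k / 3) * ⟨2, -3⟩ ^ (l / 3) *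
    (⟨5, 6⟩ ^ (i / 3) * ⟨-1, -6⟩ ^ (j / 3)) * β := ⟨_, rfl⟩
  have hz' : z = u * (⟨5, 3⟩ ^ (k % 3) * ⟨2, -3⟩ ^ (l % 3) *
      (⟨5, 6⟩ ^ (i % 3) * ⟨-1, -6⟩ ^ (j % 3) * γ ^ 3)) := by
    rw [hzv, hvw, hwβ, pow_eq_mod_three _ k, pow_eq_mod_three _ l, pow_eq_mod_three _ i,
      pow_eq_mod_three _ j, hγ]
    ring
  have hk := Nat.mod_lt k (by norm_num : 3 > 0)
  have hl := Nat.mod_lt l (by norm_num : 3 > 0)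
  have hi := Nat.mod_lt i (by norm_num : 3 > 0)
  have hj := Nat.mod_lt j (by norm_num : 3 > 0)
  generalize k % 3 = k' at *
  generalize l % 3 = l' at *
  generalize i % 3 = i' at *
  generalize j % 3 = j' at *
  have hγz : γ.norm ∣ z.norm := by
    rw [hz']
    simp only [map_mul, map_pow]
    exact Dvd.dvd.mul_left (Dvd.dvd.mul_left (Dvd.dvd.mul_left (dvd_pow_self _ three_ne_zero) _) _) _
  have hn3 : ¬ (3 : ℤ) ∣ γ.norm := fun h3 =>
    not_three_dvd_norm ((by norm_num : (3 : ℤ) ∣ 9).trans him) hre (h3.trans hγz)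
  have hn2 : γ.norm % 2 = 1 := norm_odd h2 hγz
  have hslope := hasSlope_six (k := k') (l := l') (i := i') (j := j') (hasSlope_cube hn3)
  obtain ⟨ε, hε, hzε⟩ := eq_of_eq_unit_mul hu hz' ((by norm_num : (3 : ℤ) ∣ 9).trans him) hslope
  have hodd : IsOddReal (⟨5, 6⟩ ^ i' * ⟨-1, -6⟩ ^ j' * γ ^ 3) :=
    ((IsOddReal.pow (by constructor <;> norm_num) i').mul
      (IsOddReal.pow (by constructor <;> norm_num) j')).mul (isOddReal_cube hn2)
  obtain rfl := modEq_of_isOddReal hε hk hl h2.2 hodd hzε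
  have h3s : (3 : ℤ) ∣ 2 * k' + k' + i' + 2 * j' := by
    obtain ⟨a1, a2⟩ := hslope
    have h9 : (9 : ℤ) ∣ (⟨5, 3⟩ ^ k' * ⟨2, -3⟩ ^ k' *
      (⟨5, 6⟩ ^ i' * ⟨-1, -6⟩ ^ j' * γ ^ 3) : Eisenstein).im := by
      rwa [hzε, dvd_im_sign_mul hε] at him
    have h10 : (9 : ℤ) ∣ 3 * (2 * k' + k' + i' + 2 * j') * (⟨5, 3⟩ ^ k' * ⟨2, -3⟩ ^ k' *
      (⟨5, 6⟩ ^ i' * ⟨-1, -6⟩ ^ j' * γ ^ 3) : Eisenstein).re := (dvd_sub_right h9).1 a2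
    rw [show (9 : ℤ) = 3 * 3 by norm_num, mul_assoc,
      mul_dvd_mul_iff_left (by norm_num : (3 : ℤ) ≠ 0)] at h10
    exact (Int.prime_three.dvd_or_dvd h10).resolve_right a1
  -- With k = l, the slope condition 2k + l + i + 2j ≡ 0 modulo 3 reduces to i ≡ j; conjugate primes
  -- then pair to rational 19 and 31.
  obtain rfl : i' = j' := by omega
  rw [← mul_pow, ← mul_pow, d19, d31] at hzε
  obtain ⟨δ, hδ⟩ : ∃ δ : Eisenstein, ε * γ ^ 3 = δ ^ 3 := by
    rcases hε with rfl | rfl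
    · exact ⟨γ, by simp⟩
    · exact ⟨-γ, by simp; ring⟩
  exact ⟨k', i', δ, hk, hi, by rw [hzε, ← hδ]; ring⟩

/-- An Eisenstein integer satisfying the local conditions at `2` and `3`, whose norm divides
`19 ^ 3 * D` times a cube in a coprime way, is a cube up to rational
factors `19`. -/
theorem eq_mul_cube_eight {z : Eisenstein} {t m D : ℤ} (hz : z ≠ 0)
    (h : z.norm * t = 19 ^ 3 * D * m ^ 3) (hD : D ≠ 0)
    (hcop : ∀ μ, Prime μ → μ ∣ z → ¬ μ ∣ (19 : Eisenstein) →
      ¬ μ ∣ star z ∧ ¬ μ ∣ (t : Eisenstein) ∧ ¬ μ ∣ (D : Eisenstein))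
    (him : (3 : ℤ) ∣ z.im) (hre : ¬ (3 : ℤ) ∣ z.re) (h2 : IsOddReal z) :
    ∃ (k : ℕ) (β : Eisenstein), k < 3 ∧ z = 19 ^ k * β ^ 3 := by
  obtain ⟨k, l, w, hzw, hw⟩ := exists_split (π := ⟨5, 3⟩) (z := z) (by rw [norm_eq]; norm_num) hz
  have hw0 : w ≠ 0 := by rintro rfl; exact hz (by rw [hzw, mul_zero])
  have n19 : ((⟨5, 3⟩ : Eisenstein).norm : Eisenstein) = 19 := by rw [norm_eq]; norm_num
  have d19 : (⟨5, 3⟩ : Eisenstein) * ⟨2, -3⟩ = 19 := by ext <;> simp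
  have s19 : star (⟨5, 3⟩ : Eisenstein) = ⟨2, -3⟩ := by ext <;> simp
  rw [n19] at hw
  rw [s19] at hzw
  have hwz : ∀ μ, μ ∣ w → μ ∣ z := fun μ h => hzw ▸ h.mul_left _
  obtain ⟨u, β, hu, hwβ⟩ := exists_unit_mul_cube (w := w) (m := m)
    (S := ⟨5, 3⟩ ^ k * ⟨2, -3⟩ ^ l) (t := star z * t)
    (D := 19 ^ 3 * D) (by
      have : z * star z * t = 19 ^ 3 * D * m ^ 3 := by rw [mul_star_self]; exact_mod_cast h
      rw [← this]
      conv_rhs => rw [hzw]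
      conv_lhs => rw [hzw]
      ring) hw0 (by
      have : (19 ^ 3 * D : ℤ) ≠ 0 := by positivity
      exact_mod_cast this)
    (fun μ hμ hμw h => (hμ.dvd_or_dvd h).elim (fun h => hw μ hμ hμw (hμ.dvd_of_dvd_pow h))
      (hcop μ hμ (hwz μ hμw) (hw μ hμ hμw)).2.2)
    (fun μ hμ hμw h => by
      rcases hμ.dvd_or_dvd h with h | h
      · exact hw μ hμ hμw (d19 ▸ (hμ.dvd_of_dvd_pow h).mul_right _)
      · exact hw μ hμ hμw (d19 ▸ (hμ.dvd_of_dvd_pow h).mul_left _))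
    (fun μ hμ hμw h => by
      have := hcop μ hμ (hwz μ hμw) (hw μ hμ hμw)
      exact (hμ.dvd_or_dvd h).elim this.1 this.2.1)
  obtain ⟨γ, hγ⟩ : ∃ γ : Eisenstein, γ = ⟨5, 3⟩ ^ (k / 3) * ⟨2, -3⟩ ^ (l / 3) * β := ⟨_, rfl⟩
  have hz' : z = u * (⟨5, 3⟩ ^ (k % 3) * ⟨2, -3⟩ ^ (l % 3) * γ ^ 3) := by
    rw [hzw, hwβ, pow_eq_mod_three _ k, pow_eq_mod_three _ l, hγ]
    ring
  have hk := Nat.mod_lt k (by norm_num : 3 > 0)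
  have hl := Nat.mod_lt l (by norm_num : 3 > 0)
  generalize k % 3 = k' at *
  generalize l % 3 = l' at *
  have hγz : γ.norm ∣ z.norm := by
    rw [hz']
    simp only [map_mul, map_pow]
    exact Dvd.dvd.mul_left (Dvd.dvd.mul_left (dvd_pow_self _ three_ne_zero) _) _
  have hn3 : ¬ (3 : ℤ) ∣ γ.norm := fun h3 => not_three_dvd_norm him hre (h3.trans hγz)
  have hslope := hasSlope_six (k := k') (l := l') (i := 0) (j := 0) (hasSlope_cube hn3)
  simp only [pow_zero, one_mul] at hslope
  obtain ⟨ε, hε, hzε⟩ := eq_of_eq_unit_mul hu hz' him hslope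
  obtain rfl := modEq_of_isOddReal hε hk hl h2.2 (isOddReal_cube (norm_odd h2 hγz)) hzε
  rw [← mul_pow, d19] at hzε
  obtain ⟨δ, hδ⟩ : ∃ δ : Eisenstein, ε * γ ^ 3 = δ ^ 3 := by
    rcases hε with rfl | rfl
    · exact ⟨γ, by simp⟩
    · exact ⟨-γ, by simp; ring⟩
  exact ⟨k', δ, hk, by rw [hzε, ← hδ]; ring⟩

end Eisenstein

/-! ### First half of the descent: the Hesse cubic factored over ℤ[ω] -/

/-- The point `(p : q : r)` of a Hesse cubic after division of its third coordinate by the common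
factor with the leading coefficient; `D = c ^ 3 - b ^ 3` for the undivided coefficient `b`. -/
structure ReducedHesse (c D b p q r : ℤ) : Prop where
  eq : (b * p + b * q + c * r) * ((b * p - c * r) ^ 2 - (b * p - c * r) * (b * q - c * r) +
    (b * q - c * r) ^ 2) = D * r ^ 3
  coprime : IsCoprime b r
  primitive : ∃ x y w : ℤ, x * p + y * q + w * r = 1

namespace ReducedHesse

open Eisenstein QuadraticAlgebra

variable {c D b p q r : ℤ}

/-- The linear factor of the Hesse cubic over the Eisenstein integers. -/
def factor (b c p q r : ℤ) : Eisenstein := ⟨b * p - c * r, b * q - c * r⟩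

theorem not_dvd_of_dvd {μ : Eisenstein} (h : ReducedHesse c D b p q r) (hμ : Prime μ)
    (hp : μ ∣ ((b * p : ℤ) : Eisenstein)) (hq : μ ∣ ((b * q : ℤ) : Eisenstein)) :
    ¬ μ ∣ (r : Eisenstein) := by
  intro hr
  have hb : ¬ μ ∣ (b : Eisenstein) := by
    intro hb
    obtain ⟨x, y, hxy⟩ := h.coprime
    have h1 : (x : Eisenstein) * b + y * r = 1 := by exact_mod_cast hxy
    exact hμ.not_isUnit (isUnit_of_dvd_one (h1 ▸ (hb.mul_left _).add (hr.mul_left _)))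
  rw [Int.cast_mul] at hp hq
  have hp := (hμ.dvd_or_dvd hp).resolve_left hb
  have hq := (hμ.dvd_or_dvd hq).resolve_left hb
  obtain ⟨x, y, w, hxy⟩ := h.primitive
  have h1 : (x : Eisenstein) * p + y * q + w * r = 1 := by exact_mod_cast hxy
  exact hμ.not_isUnit (isUnit_of_dvd_one
    (h1 ▸ ((hp.mul_left _).add (hq.mul_left _)).add (hr.mul_left _)))

theorem int_not_dvd {l : ℤ} (h : ReducedHesse c D b p q r) (hl : Prime l)
    (hA : l ∣ b * p - c * r) (hB : l ∣ b * q - c * r) : ¬ l ∣ r := by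
  intro hr
  have hp : l ∣ b * p := (dvd_sub_left (hr.mul_left c)).1 hA
  have hq : l ∣ b * q := (dvd_sub_left (hr.mul_left c)).1 hB
  have hb : ¬ l ∣ b := fun hb => hl.not_isUnit (h.coprime.isUnit_of_dvd' hb hr)
  have hp := (hl.dvd_or_dvd hp).resolve_left hb
  have hq := (hl.dvd_or_dvd hq).resolve_left hb
  obtain ⟨x, y, w, hxy⟩ := h.primitive
  exact hl.not_isUnit (isUnit_of_dvd_one
    (hxy ▸ ((hp.mul_left _).add (hq.mul_left _)).add (hr.mul_left _)))

theorem mul_factor (h : ReducedHesse c D b p q r) :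
    ((b * p + b * q + c * r : ℤ) : Eisenstein) * (factor b c p q r * star (factor b c p q r)) =
      D * r ^ 3 := by
  rw [mul_star_self, norm_eq]
  have := h.eq
  simp only [factor]
  exact_mod_cast this

theorem not_dvd_of_not_dvd_three {μ : Eisenstein} (h3 : ¬ μ ∣ (3 : Eisenstein)) :
    ¬ μ ∣ (⟨1, 2⟩ : Eisenstein) ∧ ¬ μ ∣ (⟨1, -1⟩ : Eisenstein) := by
  have h1 : (⟨1, 2⟩ : Eisenstein) * ⟨-1, -2⟩ = 3 := by ext <;> simp
  have h2 : (⟨1, -1⟩ : Eisenstein) * ⟨2, 1⟩ = 3 := by ext <;> simp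
  exact ⟨fun h => h3 (h1 ▸ h.mul_right _), fun h => h3 (h2 ▸ h.mul_right _)⟩

/-- The three linear factors are coprime outside of `3 * D`. -/
theorem coprime_factors {μ : Eisenstein} (h : ReducedHesse c D b p q r) (hμ : Prime μ)
    (h3 : ¬ μ ∣ (3 : Eisenstein)) (hD : ¬ μ ∣ (D : Eisenstein)) (hl : μ ∣ factor b c p q r) :
    ¬ μ ∣ star (factor b c p q r) ∧ ¬ μ ∣ ((b * p + b * q + c * r : ℤ) : Eisenstein) := by
  have hr : μ ∣ (r : Eisenstein) := by
    have : μ ∣ (D : Eisenstein) * r ^ 3 := h.mul_factor ▸ (hl.mul_right _).mul_left _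
    exact hμ.dvd_of_dvd_pow ((hμ.dvd_or_dvd this).resolve_left hD)
  obtain ⟨hθ, hθ'⟩ := not_dvd_of_not_dvd_three h3
  constructor
  · intro hs
    have h1 : factor b c p q r - star (factor b c p q r) = ⟨1, 2⟩ * ((b * q - c * r : ℤ) : Eisenstein) := by
      ext <;> simp [factor]; ring
    have h2 := (hμ.dvd_or_dvd (h1 ▸ hl.sub hs)).resolve_left hθ
    have h3 : ((b * p - c * r : ℤ) : Eisenstein) =
        factor b c p q r - ((b * q - c * r : ℤ) : Eisenstein) * ⟨0, 1⟩ := by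
      ext <;> simp [factor]
    have h4 : μ ∣ ((b * p - c * r : ℤ) : Eisenstein) := h3 ▸ hl.sub (h2.mul_right _)
    refine h.not_dvd_of_dvd hμ ?_ ?_ hr
    · rw [show b * p = (b * p - c * r) + c * r by ring, Int.cast_add, Int.cast_mul c r]
      exact h4.add (hr.mul_left _)
    · rw [show b * q = (b * q - c * r) + c * r by ring, Int.cast_add, Int.cast_mul c r]
      exact h2.add (hr.mul_left _)
  · intro h0
    have h1 : ((b * p + b * q + c * r : ℤ) : Eisenstein) - factor b c p q r =
        ⟨1, -1⟩ * (((b * q : ℤ) : Eisenstein) + ⟨1, 1⟩ * c * r) := by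
      ext <;> simp [factor] <;> ring
    have h2 := (hμ.dvd_or_dvd (h1 ▸ h0.sub hl)).resolve_left hθ'
    have hq : μ ∣ ((b * q : ℤ) : Eisenstein) := (dvd_add_left (hr.mul_left _)).1 h2
    refine h.not_dvd_of_dvd hμ ?_ hq hr
    have h3 : ((b * p : ℤ) : Eisenstein) =
        ((b * p + b * q + c * r : ℤ) : Eisenstein) - ((b * q : ℤ) : Eisenstein) - c * r := by
      push_cast; ring
    rw [h3]
    exact (h0.sub hq).sub (hr.mul_left _)

end ReducedHesse

/-- If `N ^ 3` divides `C * M ^ 3` with `C` free of cubes, then `N` divides `M`. -/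
theorem dvd_of_cube_dvd {C N M : ℤ} (hC : ∀ n : ℤ, n ^ 3 ∣ C → IsUnit n) (hM : M ≠ 0)
    (h : N ^ 3 ∣ C * M ^ 3) : N ∣ M := by
  have hg : 0 < Int.gcd N M := Int.gcd_pos_of_ne_zero_right _ hM
  obtain ⟨n, m, hnm, hN, hM'⟩ := Int.exists_gcd_one hg
  generalize (Int.gcd N M : ℕ) = g at *
  have hg0 : (g : ℤ) ^ 3 ≠ 0 := by positivity
  rw [hN, hM', mul_pow, mul_pow, ← mul_assoc, mul_dvd_mul_iff_right hg0] at h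
  have hu := hC n ((Int.isCoprime_iff_gcd_eq_one.2 hnm).pow.dvd_of_dvd_mul_right h)
  rw [hN, hM']
  exact mul_dvd_mul_right hu.dvd _

/-- Comparing exponents of E: the left side has 2i modulo 3 and the right side exactly 3. -/
theorem eq_zero_of_pow_mul_eq {E C n t r : ℤ} {i : ℕ} (hE : Prime E) (ht : ¬ E ∣ t)
    (hC : ¬ E ∣ C) (hr : ¬ E ∣ r) (hi : i < 3) (h : E ^ (2 * i) * n ^ 3 * t = E ^ 3 * C * r ^ 3) :
    i = 0 := by
  have key : ¬ E ∣ C * r ^ 3 := fun h =>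
    (hE.dvd_or_dvd h).elim hC fun h => hr (hE.dvd_of_dvd_pow h)
  have hE0 := hE.ne_zero
  interval_cases i
  · rfl
  · exfalso
    have h1 : n ^ 3 * t = E * (C * r ^ 3) := by
      apply mul_left_cancel₀ (pow_ne_zero 2 hE0); linear_combination h
    have h2 : E ∣ n := by
      have : E ∣ n ^ 3 * t := Dvd.intro _ h1.symm
      exact hE.dvd_of_dvd_pow ((hE.dvd_or_dvd this).resolve_right ht)
    obtain ⟨m, rfl⟩ := h2
    refine key ⟨E * m ^ 3 * t, ?_⟩
    apply mul_left_cancel₀ hE0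
    linear_combination -h1
  · exfalso
    refine key ⟨n ^ 3 * t, ?_⟩
    apply mul_left_cancel₀ (pow_ne_zero 3 hE0)
    linear_combination -h

theorem isUnit_of_cube_dvd {C : ℕ} (hC : ∀ n < C + 1, n ^ 3 ∣ C → n = 1) (h0 : 0 < C) {n : ℤ}
    (h : n ^ 3 ∣ (C : ℤ)) : IsUnit n := by
  rw [Int.isUnit_iff_natAbs_eq]
  rw [← Int.natAbs_dvd_natAbs, Int.natAbs_pow, Int.natAbs_natCast] at h
  refine hC _ (Nat.lt_succ_of_le ?_) h
  exact (Nat.le_self_pow three_ne_zero _).trans (Nat.le_of_dvd h0 h)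

namespace ReducedHesse

open Eisenstein QuadraticAlgebra

variable {c D b p q r : ℤ}

/-- The normalisation of the linear factor: `κ` is `1` or `3`, and `e` has norm `κ`. -/
def IsNormalizer (κ : ℤ) (e : Eisenstein) : Prop :=
  κ = 1 ∧ e = ⟨-1, -1⟩ ∨ κ = 3 ∧ e = ⟨1, -1⟩

theorem IsNormalizer.norm {κ : ℤ} {e : Eisenstein} (h : IsNormalizer κ e) : e.norm = κ := by
  rw [norm_eq]
  rcases h with ⟨rfl, rfl⟩ | ⟨rfl, rfl⟩ <;> norm_num

/-- The factorisation of a point of the Hesse cubic, in terms of rational integers. -/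
structure Factorization (c C E κ b p q r u v γ N : ℤ) : Prop where
  im : κ * (b * q - c * r) = -(u ^ 3 + v ^ 3 - 3 * u * v ^ 2)
  sub : κ * (b * p - b * q) = 3 * u * v * (u - v)
  linear : κ * (b * p + b * q + c * r) = C * γ ^ 3
  norm : u ^ 2 - u * v + v ^ 2 = κ * N
  mul : γ * N = E * r
  norm_pos : 0 < N

/-- Since C is free of cubes, the norm N of β divides E r, and γ is the quotient. The integers u, v
are chosen so that κ times the linear factor equals ω²(u + vω)³ for either normalizer. -/
theorem exists_factorization {C E κ : ℤ} {e β : Eisenstein} (he : IsNormalizer κ e)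
    (hβ : factor b c p q r = e * β ^ 3) (hβ0 : β ≠ 0) (hE : E * r ≠ 0)
    (hC : ∀ n : ℤ, n ^ 3 ∣ C → IsUnit n)
    (h : β.norm ^ 3 * (κ * (b * p + b * q + c * r)) = C * (E * r) ^ 3) :
    ∃ u v γ, Factorization c C E κ b p q r u v γ β.norm := by
  obtain ⟨γ, hγ⟩ := dvd_of_cube_dvd hC hE (Dvd.intro _ h)
  have hn : β.norm ≠ 0 := fun h => hβ0 (norm_eq_zero.1 h)
  have hlin : κ * (b * p + b * q + c * r) = C * γ ^ 3 := by
    apply mul_left_cancel₀ (pow_ne_zero 3 hn)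
    rw [h, hγ]; ring
  have hpos : 0 < β.norm := lt_of_le_of_ne (norm_nonneg β) hn.symm
  have hre := cube_re β
  have him := cube_im β
  have h1 := congrArg re hβ
  have h2 := congrArg im hβ
  rcases he with ⟨rfl, rfl⟩ | ⟨rfl, rfl⟩
  · simp only [factor, re_mul, im_mul, hre, him] at h1 h2
    refine ⟨β.re, β.im, γ, ?_, ?_, hlin, ?_, by rw [hγ]; ring, hpos⟩
    · linear_combination h2
    · linear_combination h1 - h2
    · rw [norm_eq]; ring
  · simp only [factor, re_mul, im_mul, hre, him] at h1 h2
    -- Here u + vω = -√-3 β, whose cube is 3√-3 β³, and ω²√-3 = 1 - ω.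
    refine ⟨2 * β.im - β.re, β.im - 2 * β.re, γ, ?_, ?_, hlin, ?_, by rw [hγ]; ring, hpos⟩
    · linear_combination 3 * h2
    · linear_combination 3 * h1 - 3 * h2
    · rw [norm_eq]; ring

theorem not_dvd_normalized {κ : ℤ} {e z μ : Eisenstein} (h : ReducedHesse c D b p q r)
    (he : IsNormalizer κ e) (hz : factor b c p q r = e * z) (him : (3 : ℤ) ∣ z.im)
    (hre : ¬ (3 : ℤ) ∣ z.re) (hμ : Prime μ) (hμz : μ ∣ z) (hD : ¬ μ ∣ (D : Eisenstein)) :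
    ¬ μ ∣ star z ∧ ¬ μ ∣ ((κ * (b * p + b * q + c * r) : ℤ) : Eisenstein) := by
  have h3 : ¬ μ ∣ ((3 : ℤ) : Eisenstein) := not_dvd_of_isCoprime hμ
    (((Prime.coprime_iff_not_dvd Int.prime_three).2 (not_three_dvd_norm him hre)).symm) hμz
  obtain ⟨h1, h2⟩ := h.coprime_factors hμ (by exact_mod_cast h3) hD (hz ▸ hμz.mul_left _)
  refine ⟨fun h => h1 ?_, fun h => ?_⟩
  · rw [hz, star_mul]
    exact h.mul_right _
  · rw [Int.cast_mul] at h
    rcases hμ.dvd_or_dvd h with h | h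
    · rcases he with ⟨rfl, -⟩ | ⟨rfl, -⟩
      · exact hμ.not_isUnit (isUnit_of_dvd_one (by simpa using h))
      · exact h3 h
    · exact h2 h

theorem norm_normalized {κ : ℤ} {e z : Eisenstein} (h : ReducedHesse c D b p q r)
    (he : IsNormalizer κ e) (hz : factor b c p q r = e * z) :
    z.norm * (κ * (b * p + b * q + c * r)) = D * r ^ 3 := by
  rw [← h.eq, ← he.norm]
  have := congrArg QuadraticAlgebra.norm hz
  rw [map_mul, norm_eq (factor b c p q r)] at this
  simp only [factor] at this
  linear_combination -(b * p + b * q + c * r) * this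

theorem dvd_of_dvd_normalized {l : ℤ} {e z : Eisenstein} (hz : factor b c p q r = e * z)
    (hl : (l : Eisenstein) ∣ z) : l ∣ b * p - c * r ∧ l ∣ b * q - c * r := by
  obtain ⟨w, rfl⟩ := hl
  have h1 := congrArg re hz
  have h2 := congrArg im hz
  rw [mul_left_comm] at h1 h2
  simp only [factor] at h1 h2
  constructor
  · rw [h1]; exact ⟨(e * w).re, by simp⟩
  · rw [h2]; exact ⟨(e * w).im, by simp⟩

/-- The linear form exceeds the sum of the coordinates of the Eisenstein factor by 3cr, so a common
prime would divide r. -/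
theorem not_dvd_linear {l κ : ℤ} (h : ReducedHesse c D b p q r) (hl : Prime l) (h3c : ¬ l ∣ 3 * c)
    (hκ : ¬ l ∣ κ) (hA : l ∣ b * p - c * r) (hB : l ∣ b * q - c * r) :
    ¬ l ∣ κ * (b * p + b * q + c * r) := by
  intro hdvd
  have h1 := (hl.dvd_or_dvd hdvd).resolve_left hκ
  have h2 : l ∣ 3 * c * r := by
    rw [show 3 * c * r = (b * p + b * q + c * r) - (b * p - c * r) - (b * q - c * r) by ring]
    exact (h1.sub hA).sub hB
  exact (hl.dvd_or_dvd h2).elim h3c (h.int_not_dvd hl hA hB)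

theorem factorization_six {κ : ℤ} {e z : Eisenstein} (h : ReducedHesse 109 (19 * 31 ^ 3) b p q r)
    (hr : r ≠ 0) (he : IsNormalizer κ e) (hz : factor b 109 p q r = e * z)
    (him : (9 : ℤ) ∣ z.im) (hre : ¬ (3 : ℤ) ∣ z.re) (h2 : IsOddReal z) :
    ∃ u v γ N, Factorization 109 19 31 κ b p q r u v γ N := by
  have hz0 : z ≠ 0 := by rintro rfl; simp at hre
  have hnorm := h.norm_normalized he hz
  have him3 : (3 : ℤ) ∣ z.im := (by norm_num : (3 : ℤ) ∣ 9).trans him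
  have p19 : Prime (19 : ℤ) := by norm_num
  have p31 : Prime (31 : ℤ) := by norm_num
  obtain ⟨k, i, β, hk, hi, hzβ⟩ := eq_mul_cube_six hz0 hnorm (fun μ hμ hμz h19 h31 =>
    h.not_dvd_normalized he hz him3 hre hμ hμz (by
      rw [Int.cast_mul, Int.cast_pow]
      intro hd
      exact (hμ.dvd_or_dvd hd).elim h19 fun hd => h31 (hμ.dvd_of_dvd_pow hd))) him hre h2
  have hβ0 : β ≠ 0 := by rintro rfl; exact hz0 (by rw [hzβ]; simp)
  have n19 : ((19 : Eisenstein)).norm = 19 ^ 2 := by rw [norm_eq]; simp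
  have n31 : ((31 : Eisenstein)).norm = 31 ^ 2 := by rw [norm_eq]; simp
  have hzn : z.norm = (19 ^ 2) ^ k * (31 ^ 2) ^ i * β.norm ^ 3 := by
    rw [hzβ]; simp only [map_mul, map_pow, n19, n31]
  have hκ : ∀ l : ℤ, l = 31 → ¬ l ∣ κ := by
    rcases he with ⟨rfl, -⟩ | ⟨rfl, -⟩ <;> rintro l rfl <;> norm_num
  -- A rational factor 19 of z puts 19² into the norm, but 19 divides 19 · 31³ only once and then
  -- not r.
  obtain rfl : k = 0 := by
    by_contra hk0
    obtain ⟨k, rfl⟩ := Nat.exists_eq_add_one_of_ne_zero hk0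
    obtain ⟨hA, hB⟩ := dvd_of_dvd_normalized (l := 19) hz
      (by rw [hzβ, pow_succ, mul_assoc, mul_assoc]; exact (dvd_mul_right _ _).mul_left _)
    have hr19 := h.int_not_dvd p19 hA hB
    have h1 : (19 : ℤ) ∣ 31 ^ 3 * r ^ 3 := by
      refine ⟨(19 ^ 2) ^ k * (31 ^ 2) ^ i * β.norm ^ 3 * (κ * (b * p + b * q + 109 * r)), ?_⟩
      rw [hzn] at hnorm
      apply mul_left_cancel₀ (by norm_num : (19 : ℤ) ≠ 0)
      linear_combination -hnorm
    rcases p19.dvd_or_dvd h1 with h1 | h1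
    · norm_num at h1
    · exact hr19 (p19.dvd_of_dvd_pow h1)
  obtain rfl : i = 0 := by
    by_contra hi0
    have hl : ((31 : ℤ) : Eisenstein) ∣ z := by
      rw [hzβ]
      exact ((dvd_pow_self _ hi0).mul_left _).mul_right _
    obtain ⟨hA, hB⟩ := dvd_of_dvd_normalized hz hl
    refine hi0 (eq_zero_of_pow_mul_eq (C := 19) (n := β.norm) p31 (h.not_dvd_linear p31 (by norm_num)
      (hκ 31 rfl) hA hB) (by norm_num) (h.int_not_dvd p31 hA hB) hi ?_)
    rw [hzn] at hnorm
    rw [pow_mul]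
    linear_combination hnorm
  obtain ⟨u, v, γ, hF⟩ := exists_factorization (C := 19) (E := 31) he
    (by rw [hz, hzβ]; simp : factor b 109 p q r = e * β ^ 3) hβ0
    (by positivity) (fun n hn => isUnit_of_cube_dvd (C := 19) (by decide) (by norm_num) hn) (by
      rw [hzn] at hnorm
      linear_combination hnorm)
  exact ⟨u, v, γ, _, hF⟩

theorem seventeen_dvd {x y : ℤ} (h : (17 : ℤ) ∣ x ^ 2 - x * y + y ^ 2) :
    (17 : ℤ) ∣ x ∧ (17 : ℤ) ∣ y := by
  have key : ∀ a b : ZMod 17, a ^ 2 - a * b + b ^ 2 = 0 → a = 0 ∧ b = 0 := by decide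
  have h1 := (ZMod.intCast_zmod_eq_zero_iff_dvd _ 17).2 h
  push_cast at h1
  obtain ⟨hx, hy⟩ := key _ _ h1
  exact ⟨(ZMod.intCast_zmod_eq_zero_iff_dvd _ 17).1 hx,
    (ZMod.intCast_zmod_eq_zero_iff_dvd _ 17).1 hy⟩

theorem factorization_eight {κ : ℤ} {e z : Eisenstein}
    (h : ReducedHesse 107 (19 ^ 3 * 153) b p q r)
    (hr : r ≠ 0) (he : IsNormalizer κ e) (hz : factor b 107 p q r = e * z)
    (him : (3 : ℤ) ∣ z.im) (hre : ¬ (3 : ℤ) ∣ z.re) (h2 : IsOddReal z) :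
    ∃ u v γ N, Factorization 107 153 19 κ b p q r u v γ N := by
  have hz0 : z ≠ 0 := by rintro rfl; simp at hre
  have hnorm := h.norm_normalized he hz
  have p19 : Prime (19 : ℤ) := by norm_num
  have p17 : Prime (17 : ℤ) := by norm_num
  have h153 : IsCoprime z.norm 153 := by
    have h3 : IsCoprime z.norm 3 :=
      ((Prime.coprime_iff_not_dvd Int.prime_three).2 (not_three_dvd_norm him hre)).symm
    -- 17 is inert in ℤ[ω], so it would enter the norm squared, while 153 = 9 · 17 contains it once.
    have h17 : IsCoprime z.norm 17 := by
      refine ((Prime.coprime_iff_not_dvd p17).2 fun hd => ?_).symm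
      rw [norm_eq] at hd
      obtain ⟨⟨x, hx⟩, ⟨y, hy⟩⟩ := seventeen_dvd hd
      have hzl : z = ((17 : ℤ) : Eisenstein) * ⟨x, y⟩ := by ext <;> simp [hx, hy]
      obtain ⟨hA, hB⟩ := dvd_of_dvd_normalized hz (hzl ▸ dvd_mul_right _ _)
      have hr17 := h.int_not_dvd p17 hA hB
      have h1 : (17 : ℤ) ∣ (19 ^ 3 * 9) * r ^ 3 := by
        refine ⟨(x ^ 2 - x * y + y ^ 2) * (κ * (b * p + b * q + 107 * r)), ?_⟩
        rw [norm_eq, hx, hy] at hnorm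
        apply mul_left_cancel₀ (by norm_num : (17 : ℤ) ≠ 0)
        linear_combination -hnorm
      rcases p17.dvd_or_dvd h1 with h1 | h1
      · norm_num at h1
      · exact hr17 (p17.dvd_of_dvd_pow h1)
    have := (h3.mul_right h3).mul_right h17
    norm_num at this
    exact this
  obtain ⟨k, β, hk, hzβ⟩ := eq_mul_cube_eight (D := 153) hz0 hnorm (by norm_num)
    (fun μ hμ hμz h19 => by
      have hμ153 := not_dvd_of_isCoprime hμ h153 hμz
      obtain ⟨h1, h2⟩ := h.not_dvd_normalized he hz him hre hμ hμz (by
        rw [Int.cast_mul]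
        intro hd
        refine (hμ.dvd_or_dvd hd).elim (fun hd => ?_) hμ153
        rw [Int.cast_pow] at hd
        exact h19 (hμ.dvd_of_dvd_pow hd))
      exact ⟨h1, h2, hμ153⟩) him hre h2
  have hβ0 : β ≠ 0 := by rintro rfl; exact hz0 (by rw [hzβ]; simp)
  have n19 : ((19 : Eisenstein)).norm = 19 ^ 2 := by rw [norm_eq]; simp
  have hzn : z.norm = (19 ^ 2) ^ k * β.norm ^ 3 := by
    rw [hzβ]; simp only [map_mul, map_pow, n19]
  have hκ : ¬ (19 : ℤ) ∣ κ := by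
    rcases he with ⟨rfl, -⟩ | ⟨rfl, -⟩ <;> norm_num
  obtain rfl : k = 0 := by
    by_contra hk0
    have hl : ((19 : ℤ) : Eisenstein) ∣ z := by
      rw [hzβ]
      exact (dvd_pow_self _ hk0).mul_right _
    obtain ⟨hA, hB⟩ := dvd_of_dvd_normalized hz hl
    refine hk0 (eq_zero_of_pow_mul_eq (C := 153) (n := β.norm) p19 (h.not_dvd_linear p19 (by norm_num)
      hκ hA hB) (by norm_num) (h.int_not_dvd p19 hA hB) hk ?_)
    rw [hzn] at hnorm
    rw [pow_mul]
    linear_combination hnorm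
  obtain ⟨u, v, γ, hF⟩ := exists_factorization (C := 153) (E := 19) he
    (by rw [hz, hzβ]; simp : factor b 107 p q r = e * β ^ 3) hβ0
    (by positivity) (fun n hn => isUnit_of_cube_dvd (C := 153) (by decide) (by norm_num) hn) (by
      rw [hzn] at hnorm
      linear_combination hnorm)
  exact ⟨u, v, γ, _, hF⟩

end ReducedHesse

/-! ### Local analysis of primitive Hesse points at 2 and 3 -/

/-- A primitive integral point of the Hesse cubic `s (p ^ 3 + q ^ 3 + r ^ 3) = n p q r`. -/
structure HessePoint (s n p q r : ℤ) : Prop where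
  eq : s * (p ^ 3 + q ^ 3 + r ^ 3) = n * (p * q * r)
  primitive : ∃ x y w : ℤ, x * p + y * q + w * r = 1
  ne_zero : p * q * r ≠ 0

namespace HessePoint

open Eisenstein ReducedHesse

variable {s n p q r : ℤ}

theorem rotate (h : HessePoint s n p q r) : HessePoint s n q r p := by
  obtain ⟨x, y, w, hxy⟩ := h.primitive
  refine ⟨?_, ⟨y, w, x, by linear_combination hxy⟩, ?_⟩
  · linear_combination h.eq
  · have := h.ne_zero
    rwa [mul_assoc, mul_comm] at this

theorem not_dvd {l : ℤ} (h : HessePoint s n p q r) (hl : ¬ IsUnit l) (hp : l ∣ p) (hq : l ∣ q) :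
    ¬ l ∣ r := by
  intro hr
  obtain ⟨x, y, w, hxy⟩ := h.primitive
  exact hl (isUnit_of_dvd_one
    (hxy ▸ ((hp.mul_left _).add (hq.mul_left _)).add (hr.mul_left _)))

theorem reducedHesse {b c g ρ : ℤ} (h : HessePoint s n p q (ρ * g)) (hg : g ≠ 0)
    (hc : b * g * n = s * (3 * c)) (hs : s ≠ 0) (hcop : IsCoprime b ρ) :
    ReducedHesse c (c ^ 3 - (b * g) ^ 3) b p q ρ := by
  refine ⟨?_, hcop, ?_⟩
  · have h1 := h.eq
    apply mul_left_cancel₀ (mul_ne_zero hs hg)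
    -- The identity X³+Y³+Z³-3XYZ = (X+Y+Z)·N((X-Z)+(Y-Z)ω) with X = bp, Y = bq, Z = cρ.
    linear_combination b ^ 3 * g * h1 + b ^ 2 * p * q * ρ * g * hc
  · obtain ⟨x, y, w, hxy⟩ := h.primitive
    exact ⟨x, y, w * g, by linear_combination hxy⟩

theorem odd_of_even_six (h : HessePoint 30 109 p q r) (hr : (2 : ℤ) ∣ r) :
    ¬ (2 : ℤ) ∣ p ∧ ¬ (2 : ℤ) ∣ q ∧ (4 : ℤ) ∣ r := by
  have h1 := h.eq
  have h2 : ¬ ((2 : ℤ) ∣ p ∧ (2 : ℤ) ∣ q) := fun h' => h.not_dvd (by decide) h'.1 h'.2 hr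
  obtain ⟨t, rfl⟩ := hr
  have h3 : 15 * (p ^ 3 + q ^ 3 + (2 * t) ^ 3) = 109 * (p * q * t) := by linarith
  have h4 : Even (p ^ 3 + q ^ 3 + (2 * t) ^ 3) ↔ Even (p * q * t) := by
    have := congrArg Even h3
    simpa [Int.even_mul, show ¬ Even (15 : ℤ) by decide, show ¬ Even (109 : ℤ) by decide] using this
  simp only [Int.even_add, Int.even_mul, Int.even_pow, even_two, true_or, ne_eq, OfNat.ofNat_ne_zero,
    not_false_eq_true, and_true, iff_true] at h4
  rw [← even_iff_two_dvd, ← even_iff_two_dvd] at *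
  have h5 : (4 : ℤ) ∣ 2 * t ↔ Even t := by rw [even_iff_two_dvd]; omega
  rw [h5]
  tauto

theorem three_six (h : HessePoint 30 109 p q r) (hr : (3 : ℤ) ∣ r) :
    ¬ (3 : ℤ) ∣ p ∧ ¬ (3 : ℤ) ∣ q ∧ ((3 : ℤ) ∣ p - q ∧ ¬ (9 : ℤ) ∣ r ∨
      ∃ e t, r = 27 * t ∧ p + q = 3 * e ∧ (9 : ℤ) ∣ e - 2 * t) := by
  have h1 := h.eq
  have h2 : ¬ ((3 : ℤ) ∣ p ∧ (3 : ℤ) ∣ q) := fun h' => h.not_dvd (by decide) h'.1 h'.2 hr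
  obtain ⟨t, rfl⟩ := hr
  have h3 : 10 * (p ^ 3 + q ^ 3 + (3 * t) ^ 3) = 109 * (p * q * t) := by linarith
  have key : ∀ p q t : ZMod 3, 10 * (p ^ 3 + q ^ 3 + (3 * t) ^ 3) = 109 * (p * q * t) →
      ¬ (p = 0 ∧ q = 0) → p ≠ 0 ∧ q ≠ 0 ∧ (p - q = 0 ∧ t ≠ 0 ∨ p + q = 0 ∧ t = 0) := by decide
  have hd : ∀ n : ℤ, (3 : ℤ) ∣ n ↔ (n : ZMod 3) = 0 := fun n =>
    (ZMod.intCast_zmod_eq_zero_iff_dvd n 3).symm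
  obtain ⟨hp, hq, h5⟩ := key p q t (by exact_mod_cast congrArg (Int.cast : ℤ → ZMod 3) h3)
    (by rw [hd, hd] at h2; exact h2)
  rw [← Int.cast_sub, ← Int.cast_add, ne_eq, ← hd, ← hd, ← hd] at h5
  rw [ne_eq, ← hd] at hp hq
  refine ⟨hp, hq, h5.imp (fun h => ⟨h.1, fun h9 => h.2 (by omega)⟩) ?_⟩
  rintro ⟨⟨e, he⟩, t, rfl⟩
  obtain rfl : q = 3 * e - p := by linarith
  have h6 : (3 : ℤ) ∣ t := by
    have h7 : 3 * (10 * (e * (3 * e ^ 2 - p * (3 * e - p)) + 81 * t ^ 3)) =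
        109 * (p * (3 * e - p)) * t := by linarith
    have h8 : (3 : ℤ) ∣ 109 * (p * (3 * e - p)) * t := Dvd.intro _ h7
    rcases Int.prime_three.dvd_or_dvd h8 with h8 | h8
    · rcases Int.prime_three.dvd_or_dvd h8 with h8 | h8
      · norm_num at h8
      · exact absurd h8 (fun h8 => (Int.prime_three.dvd_or_dvd h8).elim hp hq)
    · exact h8
  obtain ⟨t, rfl⟩ := h6
  refine ⟨e, t, by ring, by ring, ?_⟩
  have h7 : 10 * (e * (3 * e ^ 2 - p * (3 * e - p)) + 2187 * t ^ 3) =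
      109 * (p * (3 * e - p)) * t := by linarith
  have key : ∀ p e t : ZMod 9, 10 * (e * (3 * e ^ 2 - p * (3 * e - p)) + 2187 * t ^ 3) =
      109 * (p * (3 * e - p)) * t → 3 * p ≠ 0 → e - 2 * t = 0 := by decide
  have h9 : ∀ n : ℤ, (9 : ℤ) ∣ n ↔ (n : ZMod 9) = 0 := fun n =>
    (ZMod.intCast_zmod_eq_zero_iff_dvd n 9).symm
  rw [h9]
  push_cast
  refine key p e t (by exact_mod_cast congrArg (Int.cast : ℤ → ZMod 9) h7) ?_
  have h10 : ¬ (9 : ℤ) ∣ 3 * p := by omega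
  rw [h9] at h10
  exact_mod_cast h10

/-- If A and B are odd, A + Bω is ω² modulo 2; dividing by ω², or by 1 - ω when 3 divides A + B,
makes it 1 modulo 2. -/
theorem normalize_odd {A B : ℤ} (hA : A % 2 = 1) (hB : B % 2 = 1) :
    IsOddReal ⟨-B, A - B⟩ ∧ ∀ y, 3 * y = A + B → IsOddReal ⟨A - y, y⟩ := by
  refine ⟨⟨?_, ?_⟩, fun y hy => ⟨?_, ?_⟩⟩ <;> simp only <;> omega

theorem eq_mul_one (A B : ℤ) : (⟨A, B⟩ : Eisenstein) = ⟨-1, -1⟩ * ⟨-B, A - B⟩ := by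
  ext <;> simp

theorem eq_mul_three {A B y : ℤ} (hy : 3 * y = A + B) :
    (⟨A, B⟩ : Eisenstein) = ⟨1, -1⟩ * ⟨A - y, y⟩ := by
  ext <;> simp
  linarith

/-- Parity: exactly one of b, ρ is even, and both coordinates of the factor come out odd. At 3,
division by ω² serves when 3 divides b and division by 1 - ω when 3 divides ρ. In the second case b
is prime to 3, so g absorbs the 9 of 90; the final height comparison uses this. -/
theorem exists_normalizer_six {b g ρ : ℤ} (h : HessePoint 30 109 p q (ρ * g)) (hbg : b * g = 90)
    (hcop : IsCoprime b ρ) : ∃ κ e z, IsNormalizer κ e ∧ factor b 109 p q ρ = e * z ∧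
      (9 : ℤ) ∣ z.im ∧ ¬ (3 : ℤ) ∣ z.re ∧ IsOddReal z ∧ (κ = 3 → (9 : ℤ) ∣ g) := by
  have hodd : (b * p - 109 * ρ) % 2 = 1 ∧ (b * q - 109 * ρ) % 2 = 1 := by
    by_cases hρ : (2 : ℤ) ∣ ρ
    · obtain ⟨hp, hq, -⟩ := h.odd_of_even_six (hρ.mul_right _)
      have hb : ¬ (2 : ℤ) ∣ b := fun hb => by
        have := hcop.isUnit_of_dvd' hb hρ
        revert this; decide
      have h1 : ¬ (2 : ℤ) ∣ b * p := fun h => (Int.prime_two.dvd_or_dvd h).elim hb hp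
      have h2 : ¬ (2 : ℤ) ∣ b * q := fun h => (Int.prime_two.dvd_or_dvd h).elim hb hq
      omega
    · have hb : (2 : ℤ) ∣ b := by
        by_contra hb
        have hg : (2 : ℤ) ∣ g :=
          (Int.prime_two.dvd_or_dvd (by rw [hbg]; norm_num : (2 : ℤ) ∣ b * g)).resolve_left hb
        obtain ⟨-, -, t, ht⟩ := h.odd_of_even_six (hg.mul_left _)
        obtain ⟨g, rfl⟩ := hg
        have h3 : (2 : ℤ) ∣ ρ * g := ⟨t, by linarith⟩
        have h4 := (Int.prime_two.dvd_or_dvd h3).resolve_left hρ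
        obtain ⟨g, rfl⟩ := h4
        have : b * g * 4 = 90 := by linarith
        omega
      have h1 := hb.mul_right p
      have h2 := hb.mul_right q
      omega
  obtain ⟨ho1, ho3⟩ := normalize_odd hodd.1 hodd.2
  have h27 : ¬ (27 : ℤ) ∣ b * g := by rw [hbg]; norm_num
  have h9 : ∀ {a : ℤ}, ¬ (3 : ℤ) ∣ a → IsCoprime (9 : ℤ) a := fun {a} ha => by
    have := (Int.prime_three.coprime_iff_not_dvd.2 ha).pow_left (m := 2)
    norm_num at this
    exact this
  have hg9 : ¬ (3 : ℤ) ∣ b → ∃ g', g = 9 * g' ∧ ¬ (3 : ℤ) ∣ g' := fun hb => by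
    obtain ⟨g', rfl⟩ := (h9 hb).dvd_of_dvd_mul_left (by rw [hbg]; norm_num)
    refine ⟨g', rfl, ?_⟩
    rintro ⟨k, rfl⟩
    exact h27 ⟨b * k, by ring⟩
  by_cases hρ : (3 : ℤ) ∣ ρ
  · have hb : ¬ (3 : ℤ) ∣ b := fun hb => by
      have := hcop.isUnit_of_dvd' hb hρ
      revert this; decide
    obtain ⟨g, rfl, hg3⟩ := hg9 hb
    obtain ⟨ρ, rfl⟩ := hρ
    obtain ⟨hp, hq, h5 | ⟨e, t, h6, he, h7⟩⟩ := h.three_six ⟨ρ * (9 * g), by ring⟩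
    · exact absurd ⟨3 * ρ * g, by ring⟩ h5.2
    obtain rfl : t = ρ * g := by linarith
    obtain ⟨y, hy, hy9⟩ : ∃ y, 3 * y = (b * p - 109 * (3 * ρ)) + (b * q - 109 * (3 * ρ)) ∧
        (9 : ℤ) ∣ y := by
      refine ⟨b * e - 218 * ρ, by linear_combination -b * he, (h9 hg3).dvd_of_dvd_mul_left ?_⟩
      have hbg' : b * g = 10 := by linarith
      have h10 : g * (b * e - 218 * ρ) = 9 * (e - 24 * (ρ * g)) + (e - 2 * (ρ * g)) := by
        linear_combination e * hbg'
      rw [h10]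
      exact (dvd_mul_right _ _).add h7
    refine ⟨3, _, _, Or.inr ⟨rfl, rfl⟩, eq_mul_three hy, hy9, ?_, ho3 y hy,
      fun _ => dvd_mul_right _ _⟩
    have h1 : ¬ (3 : ℤ) ∣ b * p := fun h => (Int.prime_three.dvd_or_dvd h).elim hb hp
    simp only
    omega
  · have hb : (3 : ℤ) ∣ b := by
      by_contra hb
      obtain ⟨g, rfl, hg3⟩ := hg9 hb
      obtain ⟨hp, hq, h5 | ⟨e, t, h6, -, -⟩⟩ := h.three_six ⟨ρ * (3 * g), by ring⟩
      · exact h5.2 ⟨ρ * g, by ring⟩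
      · have h7 : (3 : ℤ) ∣ ρ * g := ⟨t, by linarith⟩
        exact (Int.prime_three.dvd_or_dvd h7).elim hρ hg3
    obtain ⟨b, rfl⟩ := hb
    refine ⟨1, _, _, Or.inl ⟨rfl, rfl⟩, eq_mul_one _ _, ?_, ?_, ho1, by norm_num⟩
    · simp only
      rw [sub_sub_sub_cancel_right, ← mul_sub, mul_assoc]
      suffices (3 : ℤ) ∣ b * (p - q) by
        obtain ⟨k, hk⟩ := this
        exact ⟨k, by rw [hk]; ring⟩
      by_cases hb : (3 : ℤ) ∣ b
      · exact hb.mul_right _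
      · obtain ⟨g, rfl⟩ :=
          (Int.prime_three.dvd_or_dvd (⟨10, by linarith⟩ : (3 : ℤ) ∣ b * g)).resolve_left hb
        have hg3 : ¬ (3 : ℤ) ∣ g := by
          rintro ⟨g, rfl⟩
          exact h27 ⟨b * g, by ring⟩
        obtain ⟨hp, hq, h5 | ⟨e, t, h6, -, -⟩⟩ := h.three_six ⟨ρ * g, by ring⟩
        · exact h5.1.mul_left _
        · have h7 : (3 : ℤ) ∣ ρ * g := ⟨3 * t, by linarith⟩
          exact absurd h7 fun h7 => (Int.prime_three.dvd_or_dvd h7).elim hρ hg3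
    · simp only [mul_assoc]
      omega

theorem even_eight (h : HessePoint 56 321 p q r) :
    ((2 : ℤ) ∣ r → ¬ (2 : ℤ) ∣ p → ¬ (2 : ℤ) ∣ q → (16 : ℤ) ∣ r) ∧
      ((8 : ℤ) ∣ r → ¬ (2 : ℤ) ∣ p ∧ ¬ (2 : ℤ) ∣ q) := by
  have h1 := h.eq
  have h2 : ¬ (2 : ℤ) ∣ p → ¬ (2 : ℤ) ∣ q → IsCoprime (16 : ℤ) (321 * (p * q)) := fun hp hq => by
    have h3 : ¬ (2 : ℤ) ∣ 321 * (p * q) := fun hd => by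
      rcases Int.prime_two.dvd_or_dvd hd with hd | hd
      · norm_num at hd
      · exact (Int.prime_two.dvd_or_dvd hd).elim hp hq
    have := (Int.prime_two.coprime_iff_not_dvd.2 h3).pow_left (m := 4)
    norm_num at this
    exact this
  constructor
  · intro hr hp hq
    refine (h2 hp hq).dvd_of_dvd_mul_left ?_
    have h3 : (2 : ℤ) ∣ p ^ 3 + q ^ 3 + r ^ 3 := by
      rw [← even_iff_two_dvd] at *
      simp only [Int.even_add, Int.even_pow]
      tauto
    obtain ⟨k, hk⟩ := h3
    rw [hk] at h1
    exact ⟨7 * k, by linarith⟩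
  · rintro ⟨t, rfl⟩
    have h3 : 7 * (p ^ 3 + q ^ 3 + (8 * t) ^ 3) = 321 * (p * q * t) := by linarith
    have h4 : ¬ ((2 : ℤ) ∣ p ∧ (2 : ℤ) ∣ q) := fun h' =>
      h.not_dvd (by decide) h'.1 h'.2 ⟨4 * t, by ring⟩
    have h5 : Even (p ^ 3 + q ^ 3 + (8 * t) ^ 3) ↔ Even (p * q * t) := by
      have := congrArg Even h3
      simpa [Int.even_mul, show ¬ Even (7 : ℤ) by decide, show ¬ Even (321 : ℤ) by decide] using this
    have h8 : Even (8 : ℤ) := by decide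
    simp only [Int.even_add, Int.even_mul, Int.even_pow, h8, true_or, ne_eq, OfNat.ofNat_ne_zero,
      not_false_eq_true, and_true, iff_true] at h5
    rw [← even_iff_two_dvd, ← even_iff_two_dvd] at *
    tauto

/-- If p ≡ r modulo 3 then all coordinates agree modulo 3, and 321 - 168 = 9 · 17 would force 3 to
divide them all. Otherwise they are distinct modulo 3, so 3 divides pqr but not pq + qr + rp. The
identity for p³+q³+r³-3pqr then yields the second factor 3 of the sum. -/
theorem three_eight (h : HessePoint 56 321 p q r) :
    (9 : ℤ) ∣ p + q + r ∧ ¬ (3 : ℤ) ∣ p - r := by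
  have h1 := h.eq
  have h2 := h.not_dvd (l := 3) (by decide)
  have hd : ∀ n : ℤ, (3 : ℤ) ∣ n ↔ (n : ZMod 3) = 0 := fun n =>
    (ZMod.intCast_zmod_eq_zero_iff_dvd n 3).symm
  have key : ∀ p q r : ZMod 3, 56 * (p ^ 3 + q ^ 3 + r ^ 3) = 321 * (p * q * r) →
      p + q + r = 0 := by decide
  obtain ⟨m, hm⟩ : (3 : ℤ) ∣ p + q + r := by
    rw [hd]
    push_cast
    exact key p q r (by exact_mod_cast congrArg (Int.cast : ℤ → ZMod 3) h1)
  have h3 : ¬ (3 : ℤ) ∣ p - r := by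
    rintro ⟨a, ha⟩
    obtain rfl : p = r + 3 * a := by linarith
    obtain ⟨b, rfl⟩ : ∃ b, q = r + 3 * b := ⟨m - r - a, by linarith⟩
    have h4 : (3 : ℤ) ∣ 17 * ((r + 3 * a) * (r + 3 * b) * r) :=
      ⟨56 * ((r + a + b) * (a ^ 2 - a * b + b ^ 2)), by linarith⟩
    rcases Int.prime_three.dvd_or_dvd h4 with h4 | h4
    · norm_num at h4
    · rw [Int.prime_three.dvd_mul, Int.prime_three.dvd_mul] at h4
      omega
  refine ⟨?_, h3⟩
  have key : ∀ p q r : ZMod 3, p + q + r = 0 → p - r ≠ 0 →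
      p * q * r = 0 ∧ p * q + q * r + r * p ≠ 0 := by decide
  obtain ⟨h4, h5⟩ := key p q r (by rw [hd] at *; exact_mod_cast (hd _).1 ⟨m, hm⟩)
    (by rw [hd] at h3; exact_mod_cast h3)
  have h4 : (3 : ℤ) ∣ p * q * r := by rw [hd]; exact_mod_cast h4
  have h5 : ¬ (3 : ℤ) ∣ p * q + q * r + r * p := by rw [hd]; exact_mod_cast h5
  obtain ⟨k, hk⟩ := h4
  obtain rfl : p = 3 * m - q - r := by linarith
  have h6 : 56 * (m * (3 * m ^ 2 - ((3 * m - q - r) * q + q * r + r * (3 * m - q - r)))) =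
      51 * k := by
    linarith
  have h7 : (3 : ℤ) ∣ 56 * (m * (3 * m ^ 2 - ((3 * m - q - r) * q + q * r + r * (3 * m - q - r)))) :=
    ⟨17 * k, by rw [h6]; ring⟩
  have h8 := (Int.prime_three.dvd_or_dvd h7).resolve_left (by norm_num)
  rcases Int.prime_three.dvd_or_dvd h8 with h8 | h8
  · rw [hm]
    exact mul_dvd_mul_left 3 h8
  · exact absurd ((dvd_sub_right ⟨m ^ 2, rfl⟩).1 h8) h5

theorem exists_normalizer_eight {b g ρ : ℤ} (h : HessePoint 56 321 p q (ρ * g)) (hbg : b * g = 56)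
    (hcop : IsCoprime b ρ) : ∃ z, factor b 107 p q ρ = ⟨1, -1⟩ * z ∧
      (3 : ℤ) ∣ z.im ∧ ¬ (3 : ℤ) ∣ z.re ∧ IsOddReal z := by
  obtain ⟨h16, h8⟩ := h.even_eight
  have hodd : (b * p - 107 * ρ) % 2 = 1 ∧ (b * q - 107 * ρ) % 2 = 1 := by
    have hb8 : ¬ (2 : ℤ) ∣ b → (8 : ℤ) ∣ g := fun hb => by
      have := (Int.prime_two.coprime_iff_not_dvd.2 hb).pow_left (m := 3)
      norm_num at this
      exact this.dvd_of_dvd_mul_left (by rw [hbg]; norm_num)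
    by_cases hρ : (2 : ℤ) ∣ ρ
    · have hb : ¬ (2 : ℤ) ∣ b := fun hb => by
        have := hcop.isUnit_of_dvd' hb hρ
        revert this; decide
      obtain ⟨hp, hq⟩ := h8 ((hb8 hb).mul_left _)
      have h1 : ¬ (2 : ℤ) ∣ b * p := fun h => (Int.prime_two.dvd_or_dvd h).elim hb hp
      have h2 : ¬ (2 : ℤ) ∣ b * q := fun h => (Int.prime_two.dvd_or_dvd h).elim hb hq
      omega
    · have hb : (2 : ℤ) ∣ b := by
        by_contra hb
        obtain ⟨g, rfl⟩ := hb8 hb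
        obtain ⟨hp, hq⟩ := h8 ⟨ρ * g, by ring⟩
        obtain ⟨t, ht⟩ := h16 ⟨4 * (ρ * g), by ring⟩ hp hq
        obtain ⟨g, rfl⟩ := (Int.prime_two.dvd_or_dvd
          (⟨t, by linarith⟩ : (2 : ℤ) ∣ ρ * g)).resolve_left hρ
        have : b * g * 16 = 56 := by linarith
        omega
      have h1 := hb.mul_right p
      have h2 := hb.mul_right q
      omega
  obtain ⟨-, ho3⟩ := normalize_odd hodd.1 hodd.2
  obtain ⟨⟨m, hm⟩, h3⟩ := h.three_eight
  have hg : ¬ (3 : ℤ) ∣ g := fun hg => by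
    have := hg.mul_left b
    rw [hbg] at this
    norm_num at this
  obtain ⟨y, hy, hy3⟩ : ∃ y, 3 * y = (b * p - 107 * ρ) + (b * q - 107 * ρ) ∧ (3 : ℤ) ∣ y := by
    have h9 : (3 ^ 2 : ℤ) ∣ (b * p - 107 * ρ) + (b * q - 107 * ρ) := by
      refine ((Int.prime_three.coprime_iff_not_dvd.2 hg).pow_left (m := 2)).dvd_of_dvd_mul_left ?_
      exact ⟨56 * m - 30 * (ρ * g), by linear_combination (p + q) * hbg + 56 * hm⟩
    obtain ⟨k, hk⟩ := h9
    exact ⟨3 * k, by rw [hk]; ring, dvd_mul_right _ _⟩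
  refine ⟨_, eq_mul_three hy, hy3, fun hx => h3 ?_, ho3 y hy⟩
  simp only at hx
  have h4 : (3 : ℤ) ∣ b * p - 107 * ρ := (dvd_sub_left hy3).1 hx
  have h5 : (3 : ℤ) ∣ 2 * (p - ρ * g) := by
    have : 2 * (p - ρ * g) = (b * p - 107 * ρ) * g - 3 * (18 * p - 35 * (ρ * g)) := by
      linear_combination -p * hbg
    rw [this]
    exact (h4.mul_right _).sub (dvd_mul_right _ _)
  exact (Int.prime_three.dvd_or_dvd h5).resolve_left (by norm_num)

end HessePoint

/-! ### Second half of the descent: triples that are cubes, by cubic residues -/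

/-- If `l ^ b * w` is a cube and the prime `l` does not divide `w`, then `3 ∣ b`. -/
theorem three_dvd_of_pow_mul_eq_cube {l w : ℤ} (hl : Prime l) (hw : ¬ l ∣ w) (b : ℕ) :
    ∀ {t : ℤ}, l ^ b * w = t ^ 3 → 3 ∣ b := by
  induction b using Nat.strong_induction_on with
  | _ b ih =>
    intro t h
    by_cases hb : b = 0
    · exact hb ▸ dvd_zero 3
    have h1 : l ∣ t := hl.dvd_of_dvd_pow (n := 3) (h ▸ ((dvd_pow_self l hb).mul_right w))
    obtain ⟨t, rfl⟩ := h1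
    by_cases hb3 : b < 3
    · refine absurd ?_ hw
      have h2 : l ^ b * w = l ^ b * (l ^ (3 - b) * t ^ 3) := by
        rw [h, ← mul_assoc, ← pow_add, Nat.add_sub_of_le hb3.le]; ring
      rw [mul_left_cancel₀ (pow_ne_zero b hl.ne_zero) h2]
      exact (dvd_pow_self l (by omega)).mul_right _
    · have h2 : l ^ (b - 3) * w = t ^ 3 := by
        apply mul_left_cancel₀ (pow_ne_zero 3 hl.ne_zero)
        rw [← mul_assoc, ← pow_add, Nat.add_sub_of_le (by omega), h]; ring
      have := ih (b - 3) (by omega) h2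
      omega

/-- Three exponents with sum divisible by `3`, one of which vanishes, are divisible by `3` if the
corresponding cubic residue symbols agree. -/
theorem three_dvd_exponents {P : ℕ} [Fact P.Prime] {e : ℕ} {l : ZMod P} (hl : l ^ e ≠ 1)
    (hl3 : (l ^ e) ^ 3 = 1) {u v w : ZMod P} {a b c : ℕ}
    (hu : u ≠ 0 → u ^ e = (l ^ e) ^ a) (hv : v ≠ 0 → v ^ e = (l ^ e) ^ b)
    (hw : w ≠ 0 → w ^ e = (l ^ e) ^ c) (huv : u ≠ 0 → v ≠ 0 → u ^ e = v ^ e)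
    (hvw : v ≠ 0 → w ≠ 0 → v ^ e = w ^ e) (hwu : w ≠ 0 → u ≠ 0 → w ^ e = u ^ e)
    (huv0 : u ≠ 0 ∨ v ≠ 0) (hvw0 : v ≠ 0 ∨ w ≠ 0) (hwu0 : w ≠ 0 ∨ u ≠ 0)
    (hsum : 3 ∣ a + b + c) (h0 : a = 0 ∨ b = 0 ∨ c = 0) : 3 ∣ a ∧ 3 ∣ b ∧ 3 ∣ c := by
  have key : ∀ m n : ℕ, (l ^ e) ^ m = (l ^ e) ^ n → m % 3 = n % 3 := by
    intro m n h
    rw [(isOfFinOrder_iff_pow_eq_one.2 ⟨3, by norm_num, hl3⟩).pow_eq_pow_iff_modEq,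
      orderOf_eq_prime hl3 hl] at h
    exact h
  have h1 : u ≠ 0 → v ≠ 0 → a % 3 = b % 3 := fun h h' =>
    key _ _ (by rw [← hu h, ← hv h', huv h h'])
  have h2 : v ≠ 0 → w ≠ 0 → b % 3 = c % 3 := fun h h' =>
    key _ _ (by rw [← hv h, ← hw h', hvw h h'])
  have h3 : w ≠ 0 → u ≠ 0 → c % 3 = a % 3 := fun h h' =>
    key _ _ (by rw [← hw h, ← hu h', hwu h h'])
  by_cases hu0 : u = 0 <;> by_cases hv0 : v = 0 <;> by_cases hw0 : w = 0 <;>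
    simp only [hu0, hv0, hw0, ne_eq, not_true_eq_false, not_false_eq_true, forall_const,
      or_false, or_true, IsEmpty.forall_iff] at * <;> omega

/-- Points of the curve `x + y + z = n g`, `x y z = (s g) ^ 3` have coordinates in one cubic residue
class, if this is true for `g = 1`. -/
theorem pow_eq_pow_of_curve {P : ℕ} [Fact P.Prime] {e : ℕ} {s n : ZMod P}
    (hn1 : (-1 : ZMod P) ^ e = 1)
    (key : ∀ x y : ZMod P, x * y * (n - x - y) = s ^ 3 → x ^ e = y ^ e)
    {x y z g : ZMod P} (hsum : x + y + z = n * g) (hprod : x * y * z = (s * g) ^ 3)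
    (hx : x ≠ 0) (hy : y ≠ 0) : x ^ e = y ^ e := by
  by_cases hg : g = 0
  · subst hg
    have hz : z = 0 := by
      simpa [hx, hy] using hprod
    obtain rfl : x = -y := by
      rw [hz] at hsum
      linear_combination hsum
    rw [neg_pow, hn1, one_mul]
  · have h1 := key (x / g) (y / g) (by
      field_simp
      linear_combination hprod - x * y * hsum)
    rw [div_pow, div_pow] at h1
    exact (div_left_inj' (pow_ne_zero e hg)).1 h1

/-- 31 divides 109³ - 90³, so the curve x + y + z = 109g, xyz = (30g)³ is singular modulo 31; there
all nonzero coordinates of a point lie in one cubic residue class, by a finite check. The prime 19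
plays this role in the next two lemmas. -/
theorem pow_ten_eq_six {x y z g : ZMod 31} (hsum : x + y + z = 109 * g)
    (hprod : x * y * z = (30 * g) ^ 3) (hx : x ≠ 0) (hy : y ≠ 0) : x ^ 10 = y ^ 10 := by
  have h1 : (-1 : ZMod 31) ^ 10 = 1 := by decide
  have h2 : ∀ x y : ZMod 31, x * y * (109 - x - y) = 30 ^ 3 → x ^ 10 = y ^ 10 := by decide
  have : Fact (Nat.Prime 31) := ⟨by norm_num⟩
  exact pow_eq_pow_of_curve h1 h2 hsum hprod hx hy

theorem pow_six_eq_six {x y z g : ZMod 19} (hsum : x + y + z = 109 * g)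
    (hprod : x * y * z = (30 * g) ^ 3) (hx : x ≠ 0) (hy : y ≠ 0) : x ^ 6 = y ^ 6 := by
  have h1 : (-1 : ZMod 19) ^ 6 = 1 := by decide
  have h2 : ∀ x y : ZMod 19, x * y * (109 - x - y) = 30 ^ 3 → x ^ 6 = y ^ 6 := by decide
  have : Fact (Nat.Prime 19) := ⟨by norm_num⟩
  exact pow_eq_pow_of_curve h1 h2 hsum hprod hx hy

theorem pow_six_eq_eight {x y z g : ZMod 19} (hsum : x + y + z = 321 * g)
    (hprod : x * y * z = (56 * g) ^ 3) (hx : x ≠ 0) (hy : y ≠ 0) : x ^ 6 = y ^ 6 := by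
  have h1 : (-1 : ZMod 19) ^ 6 = 1 := by decide
  have h2 : ∀ x y : ZMod 19, x * y * (321 - x - y) = 56 ^ 3 → x ^ 6 = y ^ 6 := by decide
  have : Fact (Nat.Prime 19) := ⟨by norm_num⟩
  exact pow_eq_pow_of_curve h1 h2 hsum hprod hx hy

/-- Three integers without common factor, with sum `n g` and product `(s g) ^ 3`. -/
structure PrimitiveTriple (s n g u v w : ℤ) : Prop where
  sum : u + v + w = n * g
  prod : u * v * w = (s * g) ^ 3
  primitive : ∃ x y z : ℤ, x * u + y * v + z * w = 1
  ne_zero : s * g ≠ 0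

namespace PrimitiveTriple

variable {s n g u v w : ℤ}

theorem rotate (h : PrimitiveTriple s n g u v w) : PrimitiveTriple s n g v w u := by
  obtain ⟨x, y, z, hxy⟩ := h.primitive
  exact ⟨by linear_combination h.sum, by linear_combination h.prod,
    ⟨y, z, x, by linear_combination hxy⟩, h.ne_zero⟩

/-- A prime dividing two members divides sg. If it divided g it would divide the sum and hence the
third member as well. -/
theorem not_dvd {l : ℤ} (h : PrimitiveTriple s n g u v w) (hl : Prime l) (hu : l ∣ u) (hv : l ∣ v) :
    ¬ l ∣ w ∧ l ∣ s := by
  have hw : ¬ l ∣ w := fun hw => by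
    obtain ⟨x, y, z, hxy⟩ := h.primitive
    exact hl.not_isUnit (isUnit_of_dvd_one
      (hxy ▸ ((hu.mul_left _).add (hv.mul_left _)).add (hw.mul_left _)))
  refine ⟨hw, ?_⟩
  have h1 : l ∣ s * g := hl.dvd_of_dvd_pow (n := 3) (h.prod ▸ (hu.mul_right v).mul_right w)
  refine (hl.dvd_or_dvd h1).resolve_right fun hg => hw ?_
  rw [show w = n * g - u - v by linarith [h.sum]]
  exact ((hg.mul_left _).sub hu).sub hv

theorem ne (h : PrimitiveTriple s n g u v w) : u ≠ 0 ∧ v ≠ 0 ∧ w ≠ 0 := by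
  have h1 : u * v * w ≠ 0 := h.prod ▸ pow_ne_zero 3 h.ne_zero
  exact ⟨left_ne_zero_of_mul (left_ne_zero_of_mul h1), right_ne_zero_of_mul (left_ne_zero_of_mul h1),
    right_ne_zero_of_mul h1⟩

/-- Each member of the triple is a cube outside of `2` and `3`. -/
theorem exists_eq_cube (h : PrimitiveTriple s n g u v w)
    (hS : ∀ l, Prime l → l ∣ s → l ∣ u → ¬ l ∣ (2 : ℤ) → ¬ l ∣ (3 : ℤ) → ¬ l ∣ v ∧ ¬ l ∣ w) :
    ∃ (a b : ℕ) (c : ℤ), u = 2 ^ a * 3 ^ b * c ^ 3 ∧ ¬ (2 : ℤ) ∣ c ∧ ¬ (3 : ℤ) ∣ c := by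
  obtain ⟨hu, hv, hw⟩ := h.ne
  obtain ⟨a, x, hx, hux⟩ := WfDvdMonoid.max_power_factor hu Int.prime_two.irreducible
  have hx0 : x ≠ 0 := by rintro rfl; exact hx (dvd_zero _)
  obtain ⟨b, y, hy, hxy⟩ := WfDvdMonoid.max_power_factor hx0 Int.prime_three.irreducible
  have hy0 : y ≠ 0 := by rintro rfl; exact hy (dvd_zero _)
  have hyu : y ∣ u := hux ▸ hxy ▸ Dvd.intro_left _ (by ring : 2 ^ a * 3 ^ b * y = _)
  have hy2 : ¬ (2 : ℤ) ∣ y := fun hd => hx (hxy ▸ hd.mul_left _)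
  have h2 : ∀ μ, Prime μ → μ ∣ y → ¬ μ ∣ (2 : ℤ) := fun μ hμ hμy hd =>
    hy2 ((hμ.associated_of_dvd Int.prime_two hd).symm.dvd.trans hμy)
  have h3 : ∀ μ, Prime μ → μ ∣ y → ¬ μ ∣ (3 : ℤ) := fun μ hμ hμy hd =>
    hy ((hμ.associated_of_dvd Int.prime_three hd).symm.dvd.trans hμy)
  obtain ⟨t, β, ht, hyβ⟩ := exists_unit_mul_cube (S := 2 ^ a * 3 ^ b) (w := y) (t := v * w)
    (D := 1) (m := s * g) (by rw [one_mul, ← h.prod, hux, hxy]; ring) hy0 one_ne_zero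
    (fun μ hμ _ hd => hμ.not_isUnit (isUnit_of_dvd_one hd))
    (fun μ hμ hμy hd => (hμ.dvd_or_dvd hd).elim (fun hd => h2 μ hμ hμy (hμ.dvd_of_dvd_pow hd))
      fun hd => h3 μ hμ hμy (hμ.dvd_of_dvd_pow hd))
    (fun μ hμ hμy hd => by
      have hμu := hμy.trans hyu
      have hμs : μ ∣ s := by
        rcases hμ.dvd_or_dvd hd with hd | hd
        · exact (h.not_dvd hμ hμu hd).2
        · exact (h.rotate.rotate.not_dvd hμ hd hμu).2
      have := hS μ hμ hμs hμu (h2 μ hμ hμy) (h3 μ hμ hμy)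
      exact (hμ.dvd_or_dvd hd).elim this.1 this.2)
  obtain ⟨c, hc⟩ : ∃ c : ℤ, y = c ^ 3 := by
    rcases Int.isUnit_iff.1 ht with rfl | rfl
    · exact ⟨β, by rw [hyβ]; ring⟩
    · exact ⟨-β, by rw [hyβ]; ring⟩
  subst hc
  exact ⟨a, b, c, by rw [hux, hxy]; ring, fun hd => hy2 (hd.trans (dvd_pow_self _ three_ne_zero)),
    fun hd => hy (hd.trans (dvd_pow_self _ three_ne_zero))⟩

/-- A triple of cubes is again a point of the Hesse cubic. -/
theorem hessePoint {x y z : ℤ} (h : PrimitiveTriple s n g (x ^ 3) (y ^ 3) (z ^ 3)) :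
    HessePoint s n x y z ∧ x * y * z = s * g := by
  have h1 : x * y * z = s * g := by
    have h3 : (x * y * z) ^ 3 = (s * g) ^ 3 := by rw [← h.prod]; ring
    exact (Odd.strictMono_pow (by decide : Odd 3)).injective h3
  obtain ⟨a, b, c, habc⟩ := h.primitive
  exact ⟨⟨by rw [h.sum, h1]; ring, ⟨a * x ^ 2, b * y ^ 2, c * z ^ 2, by linear_combination habc⟩,
    h1 ▸ h.ne_zero⟩, h1⟩

end PrimitiveTriple

theorem pow_residue {P : ℕ} [Fact P.Prime] {e : ℕ} (he : 3 * e = P - 1) {k l : ZMod P}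
    (hk : k ^ e = 1) {u c : ZMod P} {a b : ℕ} (h : u = k ^ a * l ^ b * c ^ 3) (hu : u ≠ 0) :
    u ^ e = (l ^ e) ^ b := by
  have he0 : e ≠ 0 := by
    rintro rfl
    have := (Fact.out : P.Prime).two_le
    omega
  have hc : c ≠ 0 := by rintro rfl; exact hu (by rw [h]; ring)
  have hc1 : (c ^ 3) ^ e = 1 := by rw [← pow_mul, he, ZMod.pow_card_sub_one_eq_one hc]
  rw [h, mul_pow, mul_pow, hc1, mul_one, ← pow_mul, mul_comm a, pow_mul, hk, one_pow, one_mul,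
    ← pow_mul, mul_comm b, pow_mul]

namespace PrimitiveTriple

variable {s n g u v w : ℤ}

theorem ne_zero_or_ne_zero {P : ℕ} (h : PrimitiveTriple s n g u v w) (hP : P.Prime)
    (hs : ¬ (P : ℤ) ∣ s) : (u : ZMod P) ≠ 0 ∨ (v : ZMod P) ≠ 0 := by
  by_contra! h0
  rw [ZMod.intCast_zmod_eq_zero_iff_dvd, ZMod.intCast_zmod_eq_zero_iff_dvd] at h0
  exact hs (h.not_dvd (Nat.prime_iff_prime_int.1 hP) h0.1 h0.2).2

/-- Removal of a prime `l` from the exponents, by means of cubic residues modulo `P`. -/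
theorem three_dvd_exponents {P e a₁ a₂ a₃ b₁ b₂ b₃ : ℕ} {k l c₁ c₂ c₃ : ℤ}
    (h : PrimitiveTriple s n g u v w) (hP : P.Prime) (hs : ¬ (P : ℤ) ∣ s) (he : 3 * e = P - 1)
    (hk : (k : ZMod P) ^ e = 1) (hl1 : (l : ZMod P) ^ e ≠ 1) (hl3 : ((l : ZMod P) ^ e) ^ 3 = 1)
    (hlp : Prime l) (hkl : ¬ l ∣ k)
    (key : ∀ {x y z g : ZMod P}, x + y + z = n * g → x * y * z = (s * g) ^ 3 → x ≠ 0 → y ≠ 0 →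
      x ^ e = y ^ e)
    (hu : u = k ^ a₁ * l ^ b₁ * c₁ ^ 3) (hv : v = k ^ a₂ * l ^ b₂ * c₂ ^ 3)
    (hw : w = k ^ a₃ * l ^ b₃ * c₃ ^ 3) (h₁ : ¬ l ∣ c₁) (h₂ : ¬ l ∣ c₂) (h₃ : ¬ l ∣ c₃) :
    3 ∣ b₁ ∧ 3 ∣ b₂ ∧ 3 ∣ b₃ := by
  have : Fact P.Prime := ⟨hP⟩
  have cast : ∀ {t c : ℤ} {a b : ℕ}, t = k ^ a * l ^ b * c ^ 3 →
      (t : ZMod P) = (k : ZMod P) ^ a * (l : ZMod P) ^ b * (c : ZMod P) ^ 3 := by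
    rintro t c a b rfl
    push_cast
    rfl
  have hsum : ((u : ZMod P) + v + w) = n * g := by exact_mod_cast congrArg (Int.cast) h.sum
  have hprod : ((u : ZMod P) * v * w) = (s * g) ^ 3 := by exact_mod_cast congrArg (Int.cast) h.prod
  refine _root_.three_dvd_exponents hl1 hl3 (pow_residue he hk (cast hu))
    (pow_residue he hk (cast hv)) (pow_residue he hk (cast hw)) (key hsum hprod)
    (key (z := (u : ZMod P)) (g := (g : ZMod P)) (by linear_combination hsum)
      (by linear_combination hprod))
    (key (z := (v : ZMod P)) (g := (g : ZMod P)) (by linear_combination hsum)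
      (by linear_combination hprod))
    (h.ne_zero_or_ne_zero hP hs) (h.rotate.ne_zero_or_ne_zero hP hs)
    (h.rotate.rotate.ne_zero_or_ne_zero hP hs) ?_ ?_
  · refine three_dvd_of_pow_mul_eq_cube (w := k ^ (a₁ + a₂ + a₃) * (c₁ * c₂ * c₃) ^ 3) (t := s * g)
      hlp ?_ _ ?_
    · intro hd
      rcases hlp.dvd_or_dvd hd with hd | hd
      · exact hkl (hlp.dvd_of_dvd_pow hd)
      · have hd := hlp.dvd_of_dvd_pow hd
        rw [hlp.dvd_mul, hlp.dvd_mul] at hd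
        tauto
    · rw [← h.prod, hu, hv, hw]; ring
  · by_contra! h0
    have hd : ∀ {t c : ℤ} {a b : ℕ}, t = k ^ a * l ^ b * c ^ 3 → b ≠ 0 → l ∣ t := by
      rintro t c a b rfl hb
      exact ((dvd_pow_self l hb).mul_left _).mul_right _
    exact (h.not_dvd hlp (hd hu h0.1) (hd hv h0.2.1)).1 (hd hw h0.2.2)

theorem exists_cubes_six (h : PrimitiveTriple 30 109 g u v w) (huv : ¬ ((5 : ℤ) ∣ u ∧ (5 : ℤ) ∣ v))
    (hvw : ¬ ((5 : ℤ) ∣ v ∧ (5 : ℤ) ∣ w)) (hwu : ¬ ((5 : ℤ) ∣ w ∧ (5 : ℤ) ∣ u)) :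
    ∃ x y z : ℤ, u = x ^ 3 ∧ v = y ^ 3 ∧ w = z ^ 3 := by
  have p5 : Prime (5 : ℤ) := by norm_num
  have hS : ∀ l t : ℤ, Prime l → l ∣ 30 → l ∣ t → ¬ l ∣ (2 : ℤ) → ¬ l ∣ (3 : ℤ) →
      (5 : ℤ) ∣ t ∧ ∀ t', l ∣ t' → (5 : ℤ) ∣ t' := fun l t hl h30 ht h2 h3 => by
    have h5 : l ∣ 5 := by
      rw [show (30 : ℤ) = 2 * (3 * 5) by norm_num] at h30
      exact (hl.dvd_or_dvd ((hl.dvd_or_dvd h30).resolve_left h2)).resolve_left h3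
    have := (hl.associated_of_dvd p5 h5).symm.dvd
    exact ⟨this.trans ht, fun t' ht' => this.trans ht'⟩
  obtain ⟨a₁, b₁, c₁, hu, hu2, hu3⟩ := h.exists_eq_cube fun l hl h30 ht h2 h3 => by
    obtain ⟨h5, h5'⟩ := hS l _ hl h30 ht h2 h3
    exact ⟨fun h' => huv ⟨h5, h5' _ h'⟩, fun h' => hwu ⟨h5' _ h', h5⟩⟩
  obtain ⟨a₂, b₂, c₂, hv, hv2, hv3⟩ := h.rotate.exists_eq_cube fun l hl h30 ht h2 h3 => by
    obtain ⟨h5, h5'⟩ := hS l _ hl h30 ht h2 h3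
    exact ⟨fun h' => hvw ⟨h5, h5' _ h'⟩, fun h' => huv ⟨h5' _ h', h5⟩⟩
  obtain ⟨a₃, b₃, c₃, hw, hw2, hw3⟩ := h.rotate.rotate.exists_eq_cube fun l hl h30 ht h2 h3 => by
    obtain ⟨h5, h5'⟩ := hS l _ hl h30 ht h2 h3
    exact ⟨fun h' => hwu ⟨h5, h5' _ h'⟩, fun h' => hvw ⟨h5' _ h', h5⟩⟩
  -- 2 is a cube modulo 31 and 3 is not, so residues modulo 31 see only the exponents of 3. Once
  -- these are multiples of 3, residues modulo 19, where 2 is not a cube, settle the exponents of 2.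
  obtain ⟨⟨b₁, rfl⟩, ⟨b₂, rfl⟩, ⟨b₃, rfl⟩⟩ := h.three_dvd_exponents (P := 31) (e := 10) (k := 2)
    (l := 3) (by norm_num) (by norm_num) (by norm_num) (by decide) (by decide) (by decide)
    Int.prime_three (by norm_num) (by push_cast; exact pow_ten_eq_six) hu hv hw hu3 hv3 hw3
  have h2 : ∀ {b : ℕ} {c : ℤ}, ¬ (2 : ℤ) ∣ c → ¬ (2 : ℤ) ∣ 3 ^ b * c := fun hc hd =>
    (Int.prime_two.dvd_or_dvd hd).elim
      (fun hd => absurd (Int.prime_two.dvd_of_dvd_pow hd) (by norm_num)) hc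
  obtain ⟨⟨a₁, rfl⟩, ⟨a₂, rfl⟩, ⟨a₃, rfl⟩⟩ := h.three_dvd_exponents (P := 19) (e := 6) (k := 1)
    (l := 2) (a₁ := 0) (a₂ := 0) (a₃ := 0) (by norm_num) (by norm_num) (by norm_num) (by decide)
    (by decide) (by decide) Int.prime_two (by norm_num) (by push_cast; exact pow_six_eq_six)
    (c₁ := 3 ^ b₁ * c₁) (c₂ := 3 ^ b₂ * c₂) (c₃ := 3 ^ b₃ * c₃)
    (by rw [hu]; ring) (by rw [hv]; ring) (by rw [hw]; ring) (h2 hu2) (h2 hv2) (h2 hw2)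
  exact ⟨2 ^ a₁ * 3 ^ b₁ * c₁, 2 ^ a₂ * 3 ^ b₂ * c₂, 2 ^ a₃ * 3 ^ b₃ * c₃,
    by rw [hu]; ring, by rw [hv]; ring, by rw [hw]; ring⟩

/-- When 3 does not divide s, it divides at most one member, and the product is a cube. -/
theorem three_dvd_exponent_three {a b : ℕ} {c : ℤ} (h : PrimitiveTriple s n g u v w)
    (hs : ¬ (3 : ℤ) ∣ s) (hu : u = 2 ^ a * 3 ^ b * c ^ 3) (hc : ¬ (3 : ℤ) ∣ c) : 3 ∣ b := by
  by_cases hb : b = 0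
  · exact hb ▸ dvd_zero 3
  have h3 : (3 : ℤ) ∣ u := hu ▸ ((dvd_pow_self 3 hb).mul_left _).mul_right _
  have hv : ¬ (3 : ℤ) ∣ v := fun hd => hs (h.not_dvd Int.prime_three h3 hd).2
  have hw : ¬ (3 : ℤ) ∣ w := fun hd => hs (h.rotate.rotate.not_dvd Int.prime_three hd h3).2
  refine three_dvd_of_pow_mul_eq_cube (w := 2 ^ a * (c ^ 3 * (v * w))) (t := s * g)
    Int.prime_three ?_ _ (by rw [← h.prod, hu]; ring)
  intro hd
  rcases Int.prime_three.dvd_or_dvd hd with hd | hd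
  · exact absurd (Int.prime_three.dvd_of_dvd_pow hd) (by norm_num)
  rcases Int.prime_three.dvd_or_dvd hd with hd | hd
  · exact hc (Int.prime_three.dvd_of_dvd_pow hd)
  · exact (Int.prime_three.dvd_or_dvd hd).elim hv hw

theorem exists_cubes_eight (h : PrimitiveTriple 56 321 g u v w)
    (huv : ¬ ((7 : ℤ) ∣ u ∧ (7 : ℤ) ∣ v))
    (hvw : ¬ ((7 : ℤ) ∣ v ∧ (7 : ℤ) ∣ w)) (hwu : ¬ ((7 : ℤ) ∣ w ∧ (7 : ℤ) ∣ u)) :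
    ∃ x y z : ℤ, u = x ^ 3 ∧ v = y ^ 3 ∧ w = z ^ 3 := by
  have p7 : Prime (7 : ℤ) := by norm_num
  have hS : ∀ l t : ℤ, Prime l → l ∣ 56 → l ∣ t → ¬ l ∣ (2 : ℤ) →
      (7 : ℤ) ∣ t ∧ ∀ t', l ∣ t' → (7 : ℤ) ∣ t' := fun l t hl h56 ht h2 => by
    have h7 : l ∣ 7 := by
      rw [show (56 : ℤ) = 2 ^ 3 * 7 by norm_num] at h56
      exact (hl.dvd_or_dvd h56).resolve_left fun hd => h2 (hl.dvd_of_dvd_pow hd)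
    have := (hl.associated_of_dvd p7 h7).symm.dvd
    exact ⟨this.trans ht, fun t' ht' => this.trans ht'⟩
  obtain ⟨a₁, b₁, c₁, hu, hu2, hu3⟩ := h.exists_eq_cube fun l hl h56 ht h2 _ => by
    obtain ⟨h7, h7'⟩ := hS l _ hl h56 ht h2
    exact ⟨fun h' => huv ⟨h7, h7' _ h'⟩, fun h' => hwu ⟨h7' _ h', h7⟩⟩
  obtain ⟨a₂, b₂, c₂, hv, hv2, hv3⟩ := h.rotate.exists_eq_cube fun l hl h56 ht h2 _ => by
    obtain ⟨h7, h7'⟩ := hS l _ hl h56 ht h2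
    exact ⟨fun h' => hvw ⟨h7, h7' _ h'⟩, fun h' => huv ⟨h7' _ h', h7⟩⟩
  obtain ⟨a₃, b₃, c₃, hw, hw2, hw3⟩ := h.rotate.rotate.exists_eq_cube fun l hl h56 ht h2 _ => by
    obtain ⟨h7, h7'⟩ := hS l _ hl h56 ht h2
    exact ⟨fun h' => hwu ⟨h7, h7' _ h'⟩, fun h' => hvw ⟨h7' _ h', h7⟩⟩
  obtain ⟨b₁, rfl⟩ := h.three_dvd_exponent_three (by norm_num) hu hu3
  obtain ⟨b₂, rfl⟩ := h.rotate.three_dvd_exponent_three (by norm_num) hv hv3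
  obtain ⟨b₃, rfl⟩ := h.rotate.rotate.three_dvd_exponent_three (by norm_num) hw hw3
  have h2 : ∀ {b : ℕ} {c : ℤ}, ¬ (2 : ℤ) ∣ c → ¬ (2 : ℤ) ∣ 3 ^ b * c := fun hc hd =>
    (Int.prime_two.dvd_or_dvd hd).elim
      (fun hd => absurd (Int.prime_two.dvd_of_dvd_pow hd) (by norm_num)) hc
  obtain ⟨⟨a₁, rfl⟩, ⟨a₂, rfl⟩, ⟨a₃, rfl⟩⟩ := h.three_dvd_exponents (P := 19) (e := 6) (k := 1)
    (l := 2) (a₁ := 0) (a₂ := 0) (a₃ := 0) (by norm_num) (by norm_num) (by norm_num) (by decide)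
    (by decide) (by decide) Int.prime_two (by norm_num) (by push_cast; exact pow_six_eq_eight)
    (c₁ := 3 ^ b₁ * c₁) (c₂ := 3 ^ b₂ * c₂) (c₃ := 3 ^ b₃ * c₃)
    (by rw [hu]; ring) (by rw [hv]; ring) (by rw [hw]; ring) (h2 hu2) (h2 hv2) (h2 hw2)
  exact ⟨2 ^ a₁ * 3 ^ b₁ * c₁, 2 ^ a₂ * 3 ^ b₂ * c₂, 2 ^ a₃ * 3 ^ b₃ * c₃,
    by rw [hu]; ring, by rw [hv]; ring, by rw [hw]; ring⟩

end PrimitiveTriple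

/-- Three integers, not all zero, divided by their greatest common divisor. -/
theorem exists_common_factor {u v w : ℤ} (h : u * v * w ≠ 0) :
    ∃ d x y z : ℤ, d ≠ 0 ∧ u = d * x ∧ v = d * y ∧ w = d * z ∧
      ∃ a b c, a * x + b * y + c * z = 1 := by
  obtain ⟨d, hd⟩ : ∃ d : ℤ, Ideal.span {u, v, w} = Ideal.span {d} :=
    (IsPrincipalIdealRing.principal (Ideal.span {u, v, w})).principal
  have hdvd : ∀ t ∈ ({u, v, w} : Set ℤ), d ∣ t := fun t ht => by
    rw [← Ideal.mem_span_singleton, ← hd]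
    exact Ideal.subset_span ht
  obtain ⟨x, hx⟩ := hdvd u (by simp)
  obtain ⟨y, hy⟩ := hdvd v (by simp)
  obtain ⟨z, hz⟩ := hdvd w (by simp)
  have hd0 : d ≠ 0 := by
    rintro rfl
    exact h (by rw [hx]; ring)
  have h1 : d ∈ Ideal.span {u, v, w} := hd ▸ Ideal.mem_span_singleton_self d
  rw [Ideal.mem_span_insert] at h1
  obtain ⟨a, t, ht, h1⟩ := h1
  obtain ⟨b, c, ht⟩ := Ideal.mem_span_pair.1 ht
  refine ⟨d, x, y, z, hd0, hx, hy, hz, a, b, c, ?_⟩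
  apply mul_left_cancel₀ hd0
  rw [← ht, hx, hy, hz] at h1
  linear_combination -h1

/-- Division of three integers with sum `n g` and product `(s g) ^ 3` by their common factor. -/
theorem exists_primitiveTriple {s n g u v w : ℤ} (hsn : IsCoprime s n) (hg : s * g ≠ 0)
    (hsum : u + v + w = n * g) (hprod : u * v * w = (s * g) ^ 3) :
    ∃ d g' u' v' w', g = d * g' ∧ u = d * u' ∧ v = d * v' ∧ w = d * w' ∧
      PrimitiveTriple s n g' u' v' w' ∧ ∀ e, e ∣ u → e ∣ v → e ∣ w → e ∣ d := by
  obtain ⟨d, u', v', w', hd0, rfl, rfl, rfl, x, y, z, hxy⟩ :=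
    exists_common_factor (hprod ▸ pow_ne_zero 3 hg : u * v * w ≠ 0)
  obtain ⟨g', rfl⟩ : d ∣ g := by
    have h1 : d ∣ n * g := ⟨u' + v' + w', by rw [← hsum]; ring⟩
    have h2 : d ∣ s * g := by
      rw [← Int.pow_dvd_pow_iff three_ne_zero, ← hprod]
      exact ⟨u' * v' * w', by ring⟩
    obtain ⟨a, b, hab⟩ := hsn
    rw [show g = a * (s * g) + b * (n * g) by linear_combination -g * hab]
    exact (h2.mul_left _).add (h1.mul_left _)
  refine ⟨d, g', u', v', w', rfl, rfl, rfl, rfl, ⟨?_, ?_, ⟨x, y, z, hxy⟩, ?_⟩, fun e h1 h2 h3 => ?_⟩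
  · apply mul_left_cancel₀ hd0
    linear_combination hsum
  · apply mul_left_cancel₀ (pow_ne_zero 3 hd0)
    linear_combination hprod
  · rintro h0
    exact hg (by linear_combination d * h0)
  · rw [show d = x * (d * u') + y * (d * v') + z * (d * w') by linear_combination -d * hxy]
    exact ((h1.mul_left _).add (h2.mul_left _)).add (h3.mul_left _)

/-! ### Trace forms: the point on the isogenous curve and its size -/

namespace ReducedHesse.Factorization

variable {c C E κ b p q r u v γ N : ℤ}

/-- The relation between the real cube and the trace form. -/
theorem trace_eq (h : Factorization c C E κ b p q r u v γ N) :
    E * (C * γ ^ 3 + (2 * u - v) * (-u - v) * (2 * v - u)) = 3 * c * γ * (u ^ 2 - u * v + v ^ 2) := by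
  linear_combination (-3 * c * γ) * h.norm + (-3 * c * κ) * h.mul - E * h.linear + E * h.sub + 2 * E * h.im

/-- The traces of β, ωβ, ω²β, with β = u + vω, sum to 0, have second symmetric function -3N(β) and
product Tr(β³). Expanding the product and inserting `trace_eq` leaves a multiple of γ³, and c³ - E³C
is the cube of 90 or 56. -/
theorem prod_eq (h : Factorization c C E κ b p q r u v γ N) :
    (E * (2 * u - v) + c * γ) * (E * (-u - v) + c * γ) * (E * (2 * v - u) + c * γ) =
      (c ^ 3 - E ^ 3 * C) * γ ^ 3 := by
  linear_combination E ^ 2 * h.trace_eq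

/-- No prime `l` dividing `E + c` divides two of the three trace forms. -/
theorem eq_zero_of_two {F : Type*} [Field F] (h3 : (3 : F) ≠ 0) {E c κ bp bq r u v γ N : F}
    (hEc : c = -E) (him : κ * (bq - c * r) = -(u ^ 3 + v ^ 3 - 3 * u * v ^ 2))
    (hsub : κ * (bp - bq) = 3 * u * v * (u - v)) (hnorm : u ^ 2 - u * v + v ^ 2 = κ * N)
    (hmul : γ * N = E * r) (h : (2 * u - v = γ ∧ -u - v = γ) ∨ (-u - v = γ ∧ 2 * v - u = γ) ∨
      (2 * v - u = γ ∧ 2 * u - v = γ)) : κ * bp = 0 ∧ κ * bq = 0 := by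
  have h1 : κ * (E * r) = γ ^ 3 := by
    rw [← hmul]
    rcases h with ⟨h, h'⟩ | ⟨h, h'⟩ | ⟨h, h'⟩
    · obtain rfl : u = 0 := (mul_eq_zero.1 (by linear_combination h - h' : 3 * u = 0)).resolve_left h3
      obtain rfl : v = -γ := by linear_combination -h'
      linear_combination -γ * hnorm
    · obtain rfl : v = 0 := (mul_eq_zero.1 (by linear_combination h' - h : 3 * v = 0)).resolve_left h3
      obtain rfl : u = -γ := by linear_combination -h'
      linear_combination -γ * hnorm
    · obtain rfl : u = v :=
        sub_eq_zero.1 ((mul_eq_zero.1 (by linear_combination h' - h : 3 * (u - v) = 0)).resolve_left h3)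
      obtain rfl : u = γ := by linear_combination h'
      linear_combination -u * hnorm
  have h2 : 3 * u * v * (u - v) = 0 ∧ -(u ^ 3 + v ^ 3 - 3 * u * v ^ 2) = γ ^ 3 := by
    rcases h with ⟨h, h'⟩ | ⟨h, h'⟩ | ⟨h, h'⟩
    · obtain rfl : u = 0 := (mul_eq_zero.1 (by linear_combination h - h' : 3 * u = 0)).resolve_left h3
      obtain rfl : v = -γ := by linear_combination -h'
      constructor <;> ring
    · obtain rfl : v = 0 := (mul_eq_zero.1 (by linear_combination h' - h : 3 * v = 0)).resolve_left h3
      obtain rfl : u = -γ := by linear_combination -h'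
      constructor <;> ring
    · obtain rfl : u = v :=
        sub_eq_zero.1 ((mul_eq_zero.1 (by linear_combination h' - h : 3 * (u - v) = 0)).resolve_left h3)
      obtain rfl : u = γ := by linear_combination h'
      constructor <;> ring
  rw [h2.1] at hsub
  rw [h2.2, hEc] at him
  constructor
  · linear_combination hsub + him - h1
  · linear_combination him - h1

end ReducedHesse.Factorization

namespace ReducedHesse.Factorization

variable {c C E κ b p q r u v γ N : ℤ}

/-- Modulo l each form is E(t - γ) with t a trace, so two vanishing forms determine u + vω as -γ
times a cube root of unity. This forces bp ≡ bq ≡ 0. -/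
theorem not_dvd_two {l : ℕ} (h : Factorization c C E κ b p q r u v γ N) (hl : l.Prime)
    (h3 : ¬ (l : ℤ) ∣ 3) (hE : ¬ (l : ℤ) ∣ E) (hEc : (l : ℤ) ∣ c + E) (hκ : ¬ (l : ℤ) ∣ κ)
    (hb : ¬ (l : ℤ) ∣ b) (hpq : ¬ ((l : ℤ) ∣ p ∧ (l : ℤ) ∣ q)) :
    ¬ ((l : ℤ) ∣ E * (2 * u - v) + c * γ ∧ (l : ℤ) ∣ E * (-u - v) + c * γ) ∧
    ¬ ((l : ℤ) ∣ E * (-u - v) + c * γ ∧ (l : ℤ) ∣ E * (2 * v - u) + c * γ) ∧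
    ¬ ((l : ℤ) ∣ E * (2 * v - u) + c * γ ∧ (l : ℤ) ∣ E * (2 * u - v) + c * γ) := by
  have : Fact l.Prime := ⟨hl⟩
  have hd : ∀ n : ℤ, (l : ℤ) ∣ n ↔ (n : ZMod l) = 0 := fun n =>
    (ZMod.intCast_zmod_eq_zero_iff_dvd n l).symm
  simp only [hd, Int.cast_add, Int.cast_mul, Int.cast_sub, Int.cast_neg, Int.cast_ofNat] at *
  have hEc' : (c : ZMod l) = -E := by linear_combination hEc
  have him := congrArg (Int.cast : ℤ → ZMod l) h.im
  have hsub := congrArg (Int.cast : ℤ → ZMod l) h.sub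
  have hnorm := congrArg (Int.cast : ℤ → ZMod l) h.norm
  have hmul := congrArg (Int.cast : ℤ → ZMod l) h.mul
  push_cast at him hsub hnorm hmul
  have key := eq_zero_of_two h3 hEc' him hsub hnorm hmul
  have heq : ∀ t : ZMod l, (E : ZMod l) * t + c * γ = 0 → t = γ := fun t ht => by
    apply mul_left_cancel₀ hE
    linear_combination ht - γ * hEc'
  have hfin : ¬ ((κ : ZMod l) * (b * p) = 0 ∧ (κ : ZMod l) * (b * q) = 0) := fun h' => by
    simp only [mul_eq_zero, hκ, hb, false_or] at h'
    exact hpq h'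
  exact ⟨fun h' => hfin (key (.inl ⟨heq _ h'.1, heq _ h'.2⟩)),
    fun h' => hfin (key (.inr (.inl ⟨heq _ h'.1, heq _ h'.2⟩))),
    fun h' => hfin (key (.inr (.inr ⟨heq _ h'.1, heq _ h'.2⟩)))⟩

theorem norm_linear (h : Factorization c C E κ b p q r u v γ N) (hκ : κ ≠ 0) :
    (b * p - c * r) ^ 2 - (b * p - c * r) * (b * q - c * r) + (b * q - c * r) ^ 2 = κ * N ^ 3 := by
  have h1 : (κ * (b * p - b * q)) ^ 2 + κ * (b * p - b * q) * (κ * (b * q - c * r)) +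
      (κ * (b * q - c * r)) ^ 2 = (κ * N) ^ 3 := by
    rw [h.sub, h.im, ← h.norm]; ring
  apply mul_left_cancel₀ (pow_ne_zero 2 hκ)
  linear_combination h1

/-- The norm `N` and the quotient of `γ` by a factor `d` that is divisible by `E` if `γ` is. -/
theorem lt_or_eq {d g : ℤ} (h : Factorization c C E κ b p q r u v γ N) (hE : Prime E)
    (hEpos : 0 < E) (hr : r ≠ 0) (hg : γ = d * g) (hd : E ∣ γ → E ∣ d) :
    |g| < |r| ∨ |g| ≤ |r| ∧ ((N = 1 ∧ γ = E * r) ∨ (N = E ∧ γ = r)) := by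
  have hN := h.norm_pos
  have hmul := h.mul
  have hg0 : γ ≠ 0 := by
    rintro rfl
    rw [zero_mul] at hmul
    exact mul_ne_zero hE.ne_zero hr hmul.symm
  have key : ∀ k : ℤ, k ≠ 0 → 1 < N → r = k * g * N → |g| < |r| := by
    intro k hk hN1 hrk
    have hk1 := Int.one_le_abs hk
    have hg1 : 0 < |g| := abs_pos.2 (by rintro rfl; exact hg0 (by rw [hg, mul_zero]))
    rw [hrk, abs_mul, abs_mul, abs_of_pos hN]
    nlinarith [mul_le_mul_of_nonneg_right hk1 hg1.le]
  have hle : g ∣ r → |g| ≤ |r| := fun h =>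
    Int.le_of_dvd (abs_pos.2 hr) ((abs_dvd_abs _ _).2 h)
  by_cases hEγ : E ∣ γ
  · obtain ⟨k, rfl⟩ := hd hEγ
    by_cases hN1 : N = 1
    · right
      rw [hN1, mul_one] at hmul
      refine ⟨hle ⟨k, ?_⟩, .inl ⟨hN1, hmul⟩⟩
      apply mul_left_cancel₀ hE.ne_zero
      rw [← hmul, hg]; ring
    · left
      refine key k (by rintro rfl; simp at hg; exact hg0 hg) (by omega) ?_
      apply mul_left_cancel₀ hE.ne_zero
      rw [← hmul, hg]; ring
  · obtain ⟨n, rfl⟩ := (hE.dvd_or_dvd (Dvd.intro _ hmul.symm)).resolve_left hEγ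
    have hn : 0 < n := pos_of_mul_pos_right hN hEpos.le
    have hr' : γ * n = r := by
      apply mul_left_cancel₀ hE.ne_zero
      rw [← hmul]; ring
    by_cases hn1 : n = 1
    · right
      rw [hn1, mul_one] at hr'
      exact ⟨hle ⟨d, by rw [← hr', hg, mul_comm]⟩, .inr ⟨by rw [hn1, mul_one], hr'⟩⟩
    · left
      have hd1 := Int.one_le_abs (z := d) (by rintro rfl; simp at hg; exact hg0 hg)
      have hg1 : 0 < |g| := abs_pos.2 (by rintro rfl; exact hg0 (by rw [hg, mul_zero]))
      have h1 : 1 * |g| ≤ |d| * |g| := mul_le_mul_of_nonneg_right hd1 hg1.le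
      rw [← hr', hg, abs_mul, abs_mul, abs_of_pos hn]
      nlinarith [show 2 ≤ n by omega]

/-- Norm 1 bounds |A + B| by 2, while A + B is a cubic polynomial in r that is huge for r ≠ 0. -/
theorem ne_one_six (h : Factorization 109 19 31 1 b p q r u v γ N) (hr : r ≠ 0) :
    ¬ (N = 1 ∧ γ = 31 * r) := by
  rintro ⟨rfl, rfl⟩
  have h1 := h.norm_linear one_ne_zero
  have h2 := h.linear
  generalize hA : b * p - 109 * r = A at h1
  generalize hB : b * q - 109 * r = B at h1
  have h3 : A + B = 566029 * r ^ 3 - 327 * r := by rw [← hA, ← hB]; linarith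
  have h4 : (A + B) ^ 2 ≤ 4 := by nlinarith [sq_nonneg (A - B)]
  have h5 : -2 ≤ A + B ∧ A + B ≤ 2 := by constructor <;> nlinarith
  rw [h3] at h5
  rcases lt_or_gt_of_ne hr with h0 | h0
  · nlinarith [mul_pos (neg_pos.2 h0) (neg_pos.2 h0)]
  · nlinarith [mul_pos h0 h0]

theorem ne_thirtyone_six (h : Factorization 109 19 31 1 b p q r u v γ N)
    (hp : b * p ≠ 0) (hq : b * q ≠ 0) (hr : r ≠ 0) : ¬ (N = 31 ∧ γ = r) := by
  rintro ⟨rfl, rfl⟩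
  have h1 := h.norm_linear one_ne_zero
  have h2 := h.linear
  generalize hA : b * p - 109 * γ = A at h1
  generalize hB : b * q - 109 * γ = B at h1
  have h3 : A + B = 19 * γ ^ 3 - 327 * γ := by rw [← hA, ← hB]; linarith
  have h4 : (A + B) ^ 2 + 3 * (A - B) ^ 2 = 119164 := by linarith
  have h5 : -346 ≤ A + B ∧ A + B ≤ 346 := by constructor <;> nlinarith [sq_nonneg (A - B)]
  have h6 : -5 < γ ∧ γ < 5 := by
    rw [h3] at h5
    constructor <;> by_contra! h0 <;> nlinarith [sq_nonneg γ]
  -- Among the small values of γ, ±2 and ±3 violate the bound on A + B, and ±4 would need 36900,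
  -- which lies strictly between 192² and 193², to be a square. What is left are the points with p =
  -- 0 or q = 0.
  have h8 : γ ^ 2 = 1 ∧ (A - B) ^ 2 = 90 ^ 2 := by
    rw [h3] at h4
    generalize A - B = D at *
    obtain ⟨h6, h6'⟩ := h6
    have hsq : D ^ 2 ≠ 36900 := fun h' => by
      rcases le_or_gt |D| 192 with h0 | h0
      · have := sq_le_sq' (neg_le_of_abs_le h0) (le_of_abs_le h0)
        omega
      · have := sq_le_sq.2 (show |(193 : ℤ)| ≤ |D| from Int.add_one_le_of_lt h0)
        omega
    have := sq_nonneg D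
    interval_cases γ <;> first | exact absurd rfl hr | omega
  rcases sq_eq_sq_iff_eq_or_eq_neg.1 h8.2 with h9 | h9 <;>
    rcases sq_eq_one_iff.1 h8.1 with rfl | rfl <;>
    first | exact hp (by linarith) | exact hq (by linarith)

theorem ne_one_eight (h : Factorization 107 153 19 3 b p q r u v γ N) (hr : r ≠ 0) :
    ¬ (N = 1 ∧ γ = 19 * r) := by
  rintro ⟨rfl, rfl⟩
  have h1 := h.norm_linear three_ne_zero
  have h2 := h.linear
  generalize hA : b * p - 107 * r = A at h1
  generalize hB : b * q - 107 * r = B at h1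
  have h3 : A + B = 349809 * r ^ 3 - 321 * r := by rw [← hA, ← hB]; linarith
  have h4 : (A + B) ^ 2 ≤ 12 := by nlinarith [sq_nonneg (A - B)]
  have h5 : -4 ≤ A + B ∧ A + B ≤ 4 := by constructor <;> nlinarith
  rw [h3] at h5
  rcases lt_or_gt_of_ne hr with h0 | h0
  · nlinarith [mul_pos (neg_pos.2 h0) (neg_pos.2 h0)]
  · nlinarith [mul_pos h0 h0]

theorem ne_nineteen_eight (h : Factorization 107 153 19 3 b p q r u v γ N)
    (hp : b * p ≠ 0) (hq : b * q ≠ 0) (hr : r ≠ 0) : ¬ (N = 19 ∧ γ = r) := by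
  rintro ⟨rfl, rfl⟩
  have h1 := h.norm_linear three_ne_zero
  have h2 := h.linear
  generalize hA : b * p - 107 * γ = A at h1
  generalize hB : b * q - 107 * γ = B at h1
  have h3 : A + B = 51 * γ ^ 3 - 321 * γ := by rw [← hA, ← hB]; linarith
  have h4 : (A + B) ^ 2 + 3 * (A - B) ^ 2 = 82308 := by linarith
  have h5 : -287 ≤ A + B ∧ A + B ≤ 287 := by constructor <;> nlinarith [sq_nonneg (A - B)]
  have h6 : -3 < γ ∧ γ < 3 := by
    rw [h3] at h5
    constructor <;> by_contra! h0 <;> nlinarith [sq_nonneg γ]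
  have h8 : γ ^ 2 = 1 ∧ (A - B) ^ 2 = 56 ^ 2 := by
    rw [h3] at h4
    generalize A - B = D at *
    obtain ⟨h6, h6'⟩ := h6
    have hsq : D ^ 2 ≠ 9184 := fun h' => by
      rcases le_or_gt |D| 95 with h0 | h0
      · have := sq_le_sq' (neg_le_of_abs_le h0) (le_of_abs_le h0)
        omega
      · have := sq_le_sq.2 (show |(96 : ℤ)| ≤ |D| from Int.add_one_le_of_lt h0)
        omega
    interval_cases γ <;> first | exact absurd rfl hr | omega
  rcases sq_eq_sq_iff_eq_or_eq_neg.1 h8.2 with h9 | h9 <;>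
    rcases sq_eq_one_iff.1 h8.1 with rfl | rfl <;>
    first | exact hp (by linarith) | exact hq (by linarith)

end ReducedHesse.Factorization

theorem exists_coprime_reduction {m : ℤ} (hm : m ≠ 0) (r : ℤ) :
    ∃ b g ρ : ℤ, r = ρ * g ∧ b * g = m ∧ IsCoprime b ρ ∧ 0 < g := by
  have hg := Int.gcd_pos_of_ne_zero_left r hm
  obtain ⟨b, ρ, hcop, hb, hr⟩ := Int.exists_gcd_one hg
  exact ⟨b, Int.gcd m r, ρ, hr, hb.symm, Int.isCoprime_iff_gcd_eq_one.2 hcop, by exact_mod_cast hg⟩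

/-! ### The infinite descent -/

namespace HessePoint

open ReducedHesse

variable {s n p q r : ℤ}

/-- The new height is 30|γ'| and the old one |pqg||ρ|, so this divisibility reduces the comparison
of heights to that of γ' with ρ. -/
theorem dvd_six {b g ρ : ℤ} (h : HessePoint 30 109 p q (ρ * g)) (hbg : b * g = 90)
    (hcop : IsCoprime b ρ) : (30 : ℤ) ∣ p * q * g := by
  have h1 := h.eq
  have hg : g ≠ 0 := right_ne_zero_of_mul (hbg ▸ by norm_num : b * g ≠ 0)
  obtain ⟨k, hk⟩ : b ∣ 327 * (p * q) := by
    refine hcop.dvd_of_dvd_mul_left (y := ρ) ⟨p ^ 3 + q ^ 3 + (ρ * g) ^ 3, ?_⟩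
    apply mul_left_cancel₀ hg
    linear_combination (-3) * h1 - (p ^ 3 + q ^ 3 + (ρ * g) ^ 3) * hbg
  have h2 : 109 * (p * q * g) = 30 * k := by
    have : 327 * (p * q * g) = 90 * k := by linear_combination g * hk + k * hbg
    linarith
  omega

theorem dvd_eight {b g ρ : ℤ} (h : HessePoint 56 321 p q (ρ * g)) (hbg : b * g = 56)
    (hcop : IsCoprime b ρ) : (56 : ℤ) ∣ p * q * g := by
  have h1 := h.eq
  have hg : g ≠ 0 := right_ne_zero_of_mul (hbg ▸ by norm_num : b * g ≠ 0)
  obtain ⟨k, hk⟩ : b ∣ 321 * (p * q) := by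
    refine hcop.dvd_of_dvd_mul_left (y := ρ) ⟨p ^ 3 + q ^ 3 + (ρ * g) ^ 3, ?_⟩
    apply mul_left_cancel₀ hg
    linear_combination (-1) * h1 - (p ^ 3 + q ^ 3 + (ρ * g) ^ 3) * hbg
  have h2 : 321 * (p * q * g) = 56 * k := by linear_combination g * hk + k * hbg
  omega

theorem abs_mul_lt {m ρ t k : ℤ} (ht : t ≠ 0) (hm : 0 < m) (hmt : m ∣ t)
    (hk : |k| < |ρ| ∨ |k| ≤ |ρ| ∧ m < |t| ∧ ρ ≠ 0) : |m * k| < |t * ρ| := by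
  have h1 : m ≤ |t| := Int.le_of_dvd (abs_pos.2 ht) ((dvd_abs _ _).2 hmt)
  rw [abs_mul, abs_mul, abs_of_pos hm]
  rcases hk with hk | ⟨hk, h2, h3⟩
  · nlinarith [abs_nonneg k]
  · have := abs_pos.2 h3
    nlinarith

theorem ne_zero_mul {b g ρ m : ℤ} (h : HessePoint s n p q (ρ * g)) (hbg : b * g = m) (hm : m ≠ 0) :
    p ≠ 0 ∧ q ≠ 0 ∧ ρ ≠ 0 ∧ b ≠ 0 ∧ g ≠ 0 := by
  have := h.ne_zero
  subst hbg
  simp only [ne_eq, mul_eq_zero, not_or] at this hm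
  tauto

theorem descent_six (h : HessePoint 30 109 p q r) (h5 : (5 : ℤ) ∣ r) :
    ∃ x y z, HessePoint 30 109 x y z ∧ |x * y * z| < |p * q * r| := by
  obtain ⟨b, g, ρ, rfl, hbg, hcop, hg⟩ := exists_coprime_reduction (m := 90) (by norm_num) r
  obtain ⟨hp, hq, hρ, hb0, hg0⟩ := h.ne_zero_mul hbg (by norm_num)
  obtain ⟨κ, e, z, he, hz, him, hre, hodd, hκ9⟩ := h.exists_normalizer_six hbg hcop
  have hred : ReducedHesse 109 (19 * 31 ^ 3) b p q ρ := by
    have := h.reducedHesse (c := 109) hg0 (by rw [hbg]; norm_num) (by norm_num) hcop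
    rw [hbg] at this
    norm_num at this ⊢
    exact this
  obtain ⟨u, v, γ, N, hF⟩ := factorization_six hred hρ he hz him hre hodd
  have hκ : κ = 1 ∨ κ = 3 := he.imp And.left And.left
  have hκ0 : κ ≠ 0 := by rcases hκ with rfl | rfl <;> norm_num
  have p5 : Prime (5 : ℤ) := by norm_num
  have hb5 : ¬ (5 : ℤ) ∣ b := fun hd => by
    have hρ5 : ¬ (5 : ℤ) ∣ ρ := fun hd' => p5.not_isUnit (hcop.isUnit_of_dvd' hd hd')
    obtain ⟨g', rfl⟩ := (p5.dvd_or_dvd h5).resolve_left hρ5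
    obtain ⟨b', rfl⟩ := hd
    have : 25 * (b' * g') = 90 := by linarith
    omega
  -- 5 divides c + E = 109 + 31; for a = 8 the prime 7 divides 107 + 19.
  obtain ⟨n01, n12, n20⟩ := hF.not_dvd_two (l := 5) (by norm_num) (by norm_num) (by norm_num)
    (by norm_num) (by rcases hκ with rfl | rfl <;> norm_num) hb5
    (fun h' => h.not_dvd p5.not_isUnit h'.1 h'.2 h5)
  have hprod := hF.prod_eq
  have hγ0 : γ ≠ 0 := by
    rintro rfl
    have := hF.mul
    rw [zero_mul] at this
    exact hρ (by linarith)
  have h31 : (31 : ℤ) ∣ γ → (31 : ℤ) ∣ 31 * (2 * u - v) + 109 * γ ∧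
      (31 : ℤ) ∣ 31 * (-u - v) + 109 * γ ∧ (31 : ℤ) ∣ 31 * (2 * v - u) + 109 * γ := by
    rintro ⟨k, rfl⟩
    refine ⟨?_, ?_, ?_⟩ <;> omega
  -- The three forms agree modulo 3 and their product is (90γ)³, so 3 divides each; dividing by 3
  -- turns the constants 327 and 90 into 109 and 30.
  obtain ⟨m0, hm0⟩ : (3 : ℤ) ∣ 31 * (2 * u - v) + 109 * γ := by
    have h1 : (3 : ℤ) ∣ (31 * (2 * u - v) + 109 * γ) * (31 * (-u - v) + 109 * γ) *
        (31 * (2 * v - u) + 109 * γ) := by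
      rw [hprod]
      exact ⟨243000 * γ ^ 3, by ring⟩
    rw [Int.prime_three.dvd_mul, Int.prime_three.dvd_mul] at h1
    omega
  obtain ⟨m1, hm1⟩ : (3 : ℤ) ∣ 31 * (-u - v) + 109 * γ := by omega
  obtain ⟨m2, hm2⟩ : (3 : ℤ) ∣ 31 * (2 * v - u) + 109 * γ := by omega
  rw [hm0, hm1, hm2] at hprod
  obtain ⟨d, γ', w0, w1, w2, hγ', rfl, rfl, rfl, hT, hd⟩ := exists_primitiveTriple (s := 30) (n := 109)
    (g := γ) (u := m0) (v := m1) (w := m2) (by norm_num) (by simpa using hγ0) (by linarith)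
    (by
      apply mul_left_cancel₀ (by norm_num : (27 : ℤ) ≠ 0)
      linear_combination hprod)
  rw [hm0, hm1, hm2] at h31
  rw [hm0, hm1] at n01
  rw [hm1, hm2] at n12
  rw [hm2, hm0] at n20
  have hmul : ∀ {t : ℤ}, (5 : ℤ) ∣ t → (5 : ℤ) ∣ 3 * (d * t) := fun ht => (ht.mul_left _).mul_left _
  obtain ⟨x, y, w, rfl, rfl, rfl⟩ := hT.exists_cubes_six (fun h' => n01 ⟨hmul h'.1, hmul h'.2⟩)
    (fun h' => n12 ⟨hmul h'.1, hmul h'.2⟩) (fun h' => n20 ⟨hmul h'.1, hmul h'.2⟩)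
  obtain ⟨hH, hxyw⟩ := hT.hessePoint
  refine ⟨x, y, w, hH, ?_⟩
  have p31 : Prime (31 : ℤ) := by norm_num
  have h3 : ∀ {t : ℤ}, (31 : ℤ) ∣ 3 * t → (31 : ℤ) ∣ t := fun ht =>
    (p31.dvd_or_dvd ht).resolve_left (by norm_num)
  have hlt := hF.lt_or_eq p31 (by norm_num) hρ hγ' fun hd31 => by
    obtain ⟨h1, h2, h3'⟩ := h31 hd31
    exact hd 31 (h3 h1) (h3 h2) (h3 h3')
  have h30 := h.dvd_six hbg hcop
  have ht : p * q * g ≠ 0 := mul_ne_zero (mul_ne_zero hp hq) hg0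
  rw [hxyw, show p * q * (ρ * g) = p * q * g * ρ by ring]
  -- Only the boundary cases of `lt_or_eq` remain. For κ = 1 they are impossible; for κ = 3 both 9
  -- and 5 divide g, so |pqg| ≥ 45 > 30.
  refine abs_mul_lt ht (by norm_num) h30 (hlt.imp_right fun hcase => ?_)
  rcases hκ with rfl | rfl
  · rcases hcase.2 with hcase | hcase
    · exact absurd hcase (hF.ne_one_six hρ)
    · exact absurd hcase (hF.ne_thirtyone_six (mul_ne_zero hb0 hp) (mul_ne_zero hb0 hq) hρ)
  · refine ⟨hcase.1, ?_, hρ⟩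
    have hg5 : (5 : ℤ) ∣ g := (p5.dvd_or_dvd (hbg ▸ by norm_num : (5 : ℤ) ∣ b * g)).resolve_left hb5
    have hg45 : (45 : ℤ) ∣ p * q * g := (by
      have := hκ9 rfl
      omega : (45 : ℤ) ∣ g).mul_left _
    have := Int.le_of_dvd (abs_pos.2 ht) ((dvd_abs _ _).2 hg45)
    omega

theorem descent_eight (h : HessePoint 56 321 p q r) (h7 : (7 : ℤ) ∣ r) :
    ∃ x y z, HessePoint 56 321 x y z ∧ |x * y * z| < |p * q * r| := by
  obtain ⟨b, g, ρ, rfl, hbg, hcop, hg⟩ := exists_coprime_reduction (m := 56) (by norm_num) r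
  obtain ⟨hp, hq, hρ, hb0, hg0⟩ := h.ne_zero_mul hbg (by norm_num)
  obtain ⟨z, hz, him, hre, hodd⟩ := h.exists_normalizer_eight hbg hcop
  have hred : ReducedHesse 107 (19 ^ 3 * 153) b p q ρ := by
    have := h.reducedHesse (c := 107) hg0 (by rw [hbg]; norm_num) (by norm_num) hcop
    rw [hbg] at this
    norm_num at this ⊢
    exact this
  obtain ⟨u, v, γ, N, hF⟩ := factorization_eight hred hρ (.inr ⟨rfl, rfl⟩) hz him hre hodd
  have p7 : Prime (7 : ℤ) := by norm_num
  have hb7 : ¬ (7 : ℤ) ∣ b := fun hd => by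
    have hρ7 : ¬ (7 : ℤ) ∣ ρ := fun hd' => p7.not_isUnit (hcop.isUnit_of_dvd' hd hd')
    obtain ⟨g', rfl⟩ := (p7.dvd_or_dvd h7).resolve_left hρ7
    obtain ⟨b', rfl⟩ := hd
    have : 49 * (b' * g') = 56 := by linarith
    omega
  obtain ⟨n01, n12, n20⟩ := hF.not_dvd_two (l := 7) (by norm_num) (by norm_num) (by norm_num)
    (by norm_num) (by norm_num) hb7 (fun h' => h.not_dvd p7.not_isUnit h'.1 h'.2 h7)
  have hprod := hF.prod_eq
  have hγ0 : γ ≠ 0 := by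
    rintro rfl
    have := hF.mul
    rw [zero_mul] at this
    exact hρ (by linarith)
  have h19 : (19 : ℤ) ∣ γ → (19 : ℤ) ∣ 19 * (2 * u - v) + 107 * γ ∧
      (19 : ℤ) ∣ 19 * (-u - v) + 107 * γ ∧ (19 : ℤ) ∣ 19 * (2 * v - u) + 107 * γ := by
    rintro ⟨k, rfl⟩
    refine ⟨?_, ?_, ?_⟩ <;> omega
  obtain ⟨d, γ', w0, w1, w2, hγ', hw0, hw1, hw2, hT, hd⟩ :=
    exists_primitiveTriple (s := 56) (n := 321) (g := γ) (u := 19 * (2 * u - v) + 107 * γ)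
      (v := 19 * (-u - v) + 107 * γ) (w := 19 * (2 * v - u) + 107 * γ) (by norm_num)
      (by simpa using hγ0) (by ring) (by linear_combination hprod)
  have hmul : ∀ {t : ℤ}, (7 : ℤ) ∣ t → (7 : ℤ) ∣ d * t := fun ht => ht.mul_left _
  obtain ⟨x, y, w, rfl, rfl, rfl⟩ := hT.exists_cubes_eight
    (fun h' => n01 ⟨hw0 ▸ hmul h'.1, hw1 ▸ hmul h'.2⟩)
    (fun h' => n12 ⟨hw1 ▸ hmul h'.1, hw2 ▸ hmul h'.2⟩)
    (fun h' => n20 ⟨hw2 ▸ hmul h'.1, hw0 ▸ hmul h'.2⟩)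
  obtain ⟨hH, hxyw⟩ := hT.hessePoint
  refine ⟨x, y, w, hH, ?_⟩
  have hlt := hF.lt_or_eq (by norm_num) (by norm_num) hρ hγ' fun hd19 => by
    obtain ⟨h1, h2, h3⟩ := h19 hd19
    exact hd 19 h1 h2 h3
  have h56 := h.dvd_eight hbg hcop
  have ht : p * q * g ≠ 0 := mul_ne_zero (mul_ne_zero hp hq) hg0
  rw [hxyw, show p * q * (ρ * g) = p * q * g * ρ by ring]
  refine abs_mul_lt ht (by norm_num) h56 (hlt.imp_right fun hcase => ?_)
  rcases hcase.2 with hcase | hcase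
  · exact absurd hcase (hF.ne_one_eight hρ)
  · exact absurd hcase (hF.ne_nineteen_eight (mul_ne_zero hb0 hp) (mul_ne_zero hb0 hq) hρ)

/-- Infinite descent on the height `|p q r|`, for a prime `l` that divides one coordinate. -/
theorem false_of_descent {l : ℤ} (hl : Prime l) (hs : l ∣ s) (hn : ¬ l ∣ n)
    (key : ∀ {p q r : ℤ}, HessePoint s n p q r → l ∣ r →
      ∃ x y z, HessePoint s n x y z ∧ |x * y * z| < |p * q * r|) :
    ¬ HessePoint s n p q r := by
  suffices ∀ (k : ℕ) {p q r : ℤ}, (p * q * r).natAbs = k → ¬ HessePoint s n p q r from this _ rfl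
  intro k
  induction k using Nat.strong_induction_on with
  | _ k ih =>
    rintro p q r rfl h
    have step : ∃ x y z, HessePoint s n x y z ∧ |x * y * z| < |p * q * r| := by
      -- Since l divides s but not n, it divides some coordinate, and cyclic rotation makes that the
      -- last one.
      have h1 : l ∣ n * (p * q * r) := h.eq ▸ hs.mul_right _
      have h2 := (hl.dvd_or_dvd h1).resolve_left hn
      rw [hl.dvd_mul, hl.dvd_mul] at h2
      rcases h2 with (h2 | h2) | h2
      · rw [show p * q * r = q * r * p by ring]
        exact key h.rotate h2
      · rw [show p * q * r = r * p * q by ring]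
        exact key h.rotate.rotate h2
      · exact key h h2
    obtain ⟨x, y, z, hxyz, hlt⟩ := step
    refine ih _ ?_ rfl hxyz
    rw [Int.abs_eq_natAbs, Int.abs_eq_natAbs] at hlt
    exact_mod_cast hlt

theorem false_six : ¬ HessePoint 30 109 p q r :=
  false_of_descent (l := 5) (by norm_num) (by norm_num) (by norm_num) descent_six

theorem false_eight : ¬ HessePoint 56 321 p q r :=
  false_of_descent (l := 7) (by norm_num) (by norm_num) (by norm_num) descent_eight

/-- A rational point of the Hesse cubic outside of the coordinate lines yields a primitive one. -/
theorem exists_of_rat {p q r : ℚ} (h0 : p * q * r ≠ 0)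
    (h : (s : ℚ) * (p ^ 3 + q ^ 3 + r ^ 3) = n * (p * q * r)) :
    ∃ x y z : ℤ, HessePoint s n x y z := by
  obtain ⟨u, v, w, t, ht, hu, hv, hw⟩ : ∃ u v w t : ℤ, (t : ℚ) ≠ 0 ∧ p * t = u ∧ q * t = v ∧
      r * t = w := by
    have hp := p.den_ne_zero
    have hq := q.den_ne_zero
    have hr := r.den_ne_zero
    refine ⟨p.num * q.den * r.den, p.den * q.num * r.den, p.den * q.den * r.num,
      p.den * q.den * r.den, ?_, ?_, ?_, ?_⟩
    · push_cast
      positivity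
    · push_cast; rw [← Rat.mul_den_eq_num p]; ring
    · push_cast; rw [← Rat.mul_den_eq_num q]; ring
    · push_cast; rw [← Rat.mul_den_eq_num r]; ring
  have h1 : s * (u ^ 3 + v ^ 3 + w ^ 3) = n * (u * v * w) := by
    have : (s : ℚ) * (u ^ 3 + v ^ 3 + w ^ 3) = n * (u * v * w) := by
      rw [← hu, ← hv, ← hw]
      linear_combination (t : ℚ) ^ 3 * h
    exact_mod_cast this
  have h2 : u * v * w ≠ 0 := by
    have : (u * v * w : ℚ) ≠ 0 := by
      rw [← hu, ← hv, ← hw, show p * t * (q * t) * (r * t) = p * q * r * (t : ℚ) ^ 3 by ring]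
      exact mul_ne_zero h0 (pow_ne_zero 3 ht)
    exact_mod_cast this
  obtain ⟨d, x, y, z, hd, rfl, rfl, rfl, a, b, c, habc⟩ := exists_common_factor h2
  have hd3 := pow_ne_zero 3 hd
  refine ⟨x, y, z, ?_, ⟨a, b, c, habc⟩, ?_⟩
  · apply mul_left_cancel₀ hd3
    linear_combination h1
  · rintro h3
    exact h2 (by linear_combination d ^ 3 * h3)

end HessePoint

theorem mainTheorem5 :
    (∀ a : ℚ, a = 6 ∨ a = 8 → ¬ ∃ c : ℚ × ℚ, c ∈ lynessPeriodic a 9) ∧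
    ((¬ ∃ c : ℚ × ℚ, 0 < c.1 ∧ 0 < c.2 ∧ c ∈ lynessPeriodic 9 9) ∧
      (lynessPeriodic 9 9).Infinite) := by
  refine ⟨?_, ?_, lynessPeriodic_nine_infinite⟩
  · rintro a (rfl | rfl) ⟨c, x, hx, -, -, hp⟩
    · obtain ⟨p, q, r, h0, h⟩ := exists_hesse_of_lyness_six hx hp
      obtain ⟨u, v, w, hH⟩ := HessePoint.exists_of_rat (s := 30) (n := 109) h0 (by push_cast; exact h)
      exact HessePoint.false_six hH
    · obtain ⟨p, q, r, h0, h⟩ := exists_hesse_of_lyness_eight hx hp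
      obtain ⟨u, v, w, hH⟩ := HessePoint.exists_of_rat (s := 56) (n := 321) h0 (by push_cast; exact h)
      exact HessePoint.false_eight hH
  · rintro ⟨c, h0, h1, x, hx, hx0, hx1, hp⟩
    have := hx.curve hp
    rw [hx0, hx1] at this
    exact no_pos_point_nine h0 h1 this
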